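/- **Setting.** Let $B>0$ and let $G=(V,A,g)$ be a directed graph on $V=\{1,\dots,n\}$ with gains $g:A\to[-B,B]$. A car at $u$ with charge $b\in[0,B]$ can traverse an arc $uv$ iff $b+g(uv)\ge 0$, and then arrives with charge $\min\{b+g(uv),B\}$. Let $\alpha_b(P)$ be the final charge after traversing a (not necessarily simple, possibly one-vertex) path $P$ starting with charge $b$ ($-\infty$ if impossible), and $\alpha_b(s,t)=\max_P\alpha_b(P)$ over paths $P$ from $s$ to $t$ ($-\infty$ if none can be traversed). Write $\log=\log_2$. Tables have entries in $\mathbb R\cup\{-\infty\}$, with $-\infty+a=-\infty$, $|-\infty|=+\infty$ and $\max\emptyset=-\infty$; "$X\uparrow y$" means $X\leftarrow\max\{X,y\}$. $\kappa_1,\dots,\kappa_5>0$ are constants, and probabilities are truncated to $[0,1]$. **Compute-Shortcuts$(G)$** (randomized, returns a table $M$). Start with $M[i][j]=g(ij)$ for arcs $ij$, $M[i][i]=\max\{0,g(ii)\}$ ($=0$ if $ii\notin A$) and $-\infty$ elsewhere. Repeat $\lceil\kappa_1\log^2 n\rceil$ times: $M\leftarrow$ Update-Shortcuts$(M)$. Return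 $M$. *Update-Shortcuts$(M)$.* Let $r=\lceil\kappa_2 n^{1/2}\rceil$, $M'=M$. Repeat $r$ times: with probability $(\log n)/r$ do $M'\leftarrow\max\{M',\text{Long-Shortcuts}(M)\}$; then (always) $M\leftarrow$ Short-Shortcuts$(M)$. Return $\max\{M,M'\}$. *Short-Shortcuts$(M)$.* For $p,q$ let $J(p,q)=p+q$ if $p,q\ge 0$; otherwise $J(p,q)=\min\{p,0\}+\min\{q,0\}$ if this is $\ge -B$, and $-\infty$ if not. Let $M_2[x][z]=\max_y J(M[x][y],M[y][z])$, $M_3[x][z]=\max_y J(M[x][y],M_2[y][z])$, and $D=\max\{M,M_2,M_3\}$. For all $x,y,z$, with $m=M[x][y]$: if $m\ge0$, let $k=\max\{M[y][a]+M[a][z]: -m\le M[y][a]\le 0\}$, and if $m+k\ge m$ then $D[x][z]\uparrow m+k$. If $m\le 0$, let $k=\max\{M[y][a]+M[a][z]:0\le M[y][a]\le|m|\}$; if $-B\le m+k\le m$ then $D[x][z]\uparrow m+k$; if $m+k\ge m$ then $D[x][z]\uparrow m$; and $D[x][z]\uparrow\min\{m,\max\{M[a][z]:M[y][a]\ge|m|\}\}$.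 Return $D$. The remaining procedures use a structure $D$ with entries $D[x][y]$, $D[xy][z]$, $D[x][yz]$, initialized by $D[x][y]=D[xy][y]=D[x][xy]=M[x][y]$, all other entries $-\infty$. In every procedure below entries carrying a superscript $0$ are those at the start of the call. Loops over tuples run in lexicographic order. *Breadth-Search.* For all $x,y,z$: $D[xy][z]\uparrow M[x][y]+\max_a D^0[ya][z]$, where $a$ ranges over $-M[x][y]\le M[y][a]\le 0$ if $M[x][y]\ge 0$ and over $0\le M[y][a]\le|M[x][y]|$ otherwise; symmetrically $D[z][yx]\uparrow \max_a D^0[z][ay]+M[y][x]$, where $-M[y][x]\le M[a][y]\le 0$ if $M[y][x]\ge0$ and $0\le M[a][y]\le|M[y][x]|$ otherwise. *Concatenate$(U,W,X)$.* For $(u,v,w,x)\in U\times V\times W\times X$: if $M[u][v]<0$, $D[uv][x]\uparrow D[uv][w]+\max\{D^0[wa][x]:-(D[uv][w]-M[u][v])\le M[w][a]\le0\}$; if $M[v][u]<0$, $D[x][vu]\uparrow \max\{D^0[x][aw]:-(D[w][vu]-M[v][u])\le M[a][w]\le0\}+D[w][vu]$. *Concatenate-Opposite$(U,W,X)$.*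 For $(u,v,w,x)\in U\times V\times W\times X$: if $M[u][v]<0$, then $D[uv][x]\uparrow D[uv][w]+\max\{D^0[w][ax]: M[a][x]\ge0,\ M[a][x]-D^0[w][ax]\le D[uv][w]-M[u][v],\ D^0[w][ax]\le|D[uv][w]|\}$, after which $D[uv][x]\leftarrow 0$ if some $a$ has $M[a][x]\ge0$, $D^0[w][ax]\ge|D[uv][w]|$, $M[a][x]\le|M[u][v]|$. If $M[v][u]<0$, then $D[x][vu]\uparrow\max\{D^0[xa][w]:M[x][a]\ge0,\ M[x][a]-D^0[xa][w]\le D[w][vu]-M[v][u],\ D^0[xa][w]\le|D[w][vu]|\}+D[w][vu]$, after which $D[x][vu]\leftarrow0$ if some $a$ has $M[x][a]\ge0$, $D^0[xa][w]\ge|D[w][vu]|$, $M[x][a]\le|M[v][u]|$. *Compute-Funnels$(M)$.* Initialize $D$; let $q=\lceil\kappa_3n^{2/3}\rceil$. Do Breadth-Search $\lceil n/q\rceil$ times; sample $S\subseteq V$, every vertex independently with probability $\kappa_4(\log n)q/n$; do Concatenate$(S,S,S)$ $\lceil\log n\rceil$ times, Concatenate$(S,S,V)$ once, and Breadth-Search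 $\lceil n/q\rceil$ times. Return $D$. *Long-Shortcuts$(M)$.* $D\leftarrow$ Compute-Funnels$(M)$, $T\leftarrow\emptyset$. For $i=1,\dots,\lceil\log(n^{1/2}\log^2n)\rceil$: sample $T_i\subseteq V$, every vertex independently with probability $\kappa_5\log^2 n/(2^in^{1/2})$; $2^i$ times do Concatenate-Opposite$(T_i,V,V)$ followed by Concatenate$(T_i,V,V)$; $T\leftarrow T\cup T_i$. Then for all $(u,v,x,y)\in T\times V^3$: if $M[u][v]\le0$, put $\sigma=D[uv][x]+M[x][y]$ and: $D[u][y]\uparrow\sigma$ if $-B\le\sigma\le M[u][v]$; $D[u][y]\uparrow M[u][v]$ if $\sigma\ge M[u][v]$; $D[v][y]\uparrow\sigma-M[u][v]$ if $\sigma\ge0$. If $M[v][u]\le0$, put $\tau=M[y][x]+D[x][vu]$ and: $D[y][u]\uparrow\tau$ if $-B\le\tau\le M[v][u]$; $D[y][u]\uparrow M[v][u]$ if $\tau\ge M[v][u]$; $D[y][v]\uparrow\tau-M[v][u]$ if $\tau\ge0$. Return the table $D[\cdot][\cdot]$. **The graph $H^\star$.** From the table $M$ returned by Compute-Shortcuts$(G)$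 let $H$ be the directed graph on two copies $\{v^0\},\{v^B\}$ of $V$ with these arcs, for $x,y,z\in V$: $x^0z^0$ if $M[x][y]+M[y][z]\ge0$ and $M[x][y]\ge0$; $x^0y^B$ if $M[x][y]\ge B$, or $M[x][y]+M[y][x]>0$ and $M[x][y]>0$; $x^By^0$ if $M[x][y]\ne-\infty$; $x^Bz^B$ if $M[x][y]+M[y][z]\ge0$ and $M[y][z]\ge0$. Let $H^\star$ be the transitive closure of $H$. **Theorem.** For every $c>0$ there is $K>0$ such that for all constants $\kappa_1,\dots,\kappa_5\ge K$, all $n$, $B$, $G$ as above and all $s,t\in V$: if $\alpha_0(s,t)=B$, then $$\Pr\big[s^0t^B\in E(H^\star)\big]\ \ge\ 1-n^{-c}.$$ -/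

import Mathlib

noncomputable section

namespace ElectricCar

/-- A road network on the vertex set `Fin n`: a set of arcs and a real gain for every arc
(the value of `gain` on pairs that are not arcs is never used). -/
structure RoadNetwork (n : ℕ) where
  Arc : Fin n → Fin n → Prop
  gain : Fin n → Fin n → ℝ

namespace RoadNetwork

variable {n : ℕ} (G : RoadNetwork n)

/-- `P = v₁ … vₖ` (with `k ≥ 1`) is a path from `s` to `t`; vertices may repeat. -/
def IsPath (s t : Fin n) (P : List (Fin n)) : Prop :=
  P.head? = some s ∧ P.getLast? = some t ∧ P.IsChain G.Arc

/-- `α_b(P)`: the final charge when the vertex sequence is traversed with initial charge `b`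
and battery capacity `B`, and `⊥ = -∞` if it cannot be traversed. -/
def pathCharge (B : ℝ) : ℝ → List (Fin n) → EReal
  | b, [] => (b : EReal)
  | b, [_] => (b : EReal)
  | b, u :: v :: l =>
      if 0 ≤ b + G.gain u v then pathCharge B (min (b + G.gain u v) B) (v :: l) else ⊥

/-- `α_b(s,t)`: the maximum final charge at `t` when starting at `s` with charge `b`;
`⊥ = -∞` if no path from `s` to `t` can be traversed. -/
def alpha (B b : ℝ) (s t : Fin n) : EReal :=
  ⨆ (P : List (Fin n)) (_ : G.IsPath s t P), G.pathCharge B b P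

end RoadNetwork

/-! ### Shortcut tables and the data structure -/

/-- A table `M[x][y]` of gains, with `⊥ = -∞` for missing arcs. -/
abbrev Table (n : ℕ) := Fin n → Fin n → EReal

/-- The data structure `D`: `sc x y = D[x][y]`, `fst x y z = D[xy][z]`, `lst x y z = D[x][yz]`. -/
structure DS (n : ℕ) where
  sc : Table n
  fst : Fin n → Fin n → Fin n → EReal
  lst : Fin n → Fin n → Fin n → EReal

variable {n : ℕ}

def DS.init (M : Table n) : DS n where
  sc := M
  fst := fun x y z => if z = y then M x y else ⊥
  lst := fun a x y => if a = x then M x y else ⊥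

/-- `D[xy][z] ← val`. -/
def DS.setFst (D : DS n) (x y z : Fin n) (val : EReal) : DS n :=
  { D with fst := fun x' y' z' => if x' = x ∧ y' = y ∧ z' = z then val else D.fst x' y' z' }

/-- `D[x][yz] ← val`. -/
def DS.setLst (D : DS n) (x y z : Fin n) (val : EReal) : DS n :=
  { D with lst := fun x' y' z' => if x' = x ∧ y' = y ∧ z' = z then val else D.lst x' y' z' }

/-- Absolute value; `|-∞| = +∞`. -/
def eabs (x : EReal) : EReal := max x (-x)

/-- Range-tree query: the largest second key `k a` over all `a` whose keys satisfy `p a`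
(`-∞` if there is none). -/
def rangeMax (p : Fin n → Prop) (k : Fin n → EReal) : EReal := ⨆ (a : Fin n) (_ : p a), k a

/-! ### Short shortcuts -/

open Classical in
/-- Gain recorded for the concatenation of a piece of gain `p` with a piece of gain `q`:
ascending if both are nonnegative, otherwise descending after dropping every positive gain. -/
def joinGain (B : ℝ) (p q : EReal) : EReal :=
  if 0 ≤ p ∧ 0 ≤ q then p + q
  else if ((-B : ℝ) : EReal) ≤ min p 0 + min q 0 then min p 0 + min q 0 else ⊥

/-- The table `M₂` of 2-shortcuts. -/
def twoShortcuts (B : ℝ) (M : Table n) : Table n :=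
  fun x z => ⨆ y, joinGain B (M x y) (M y z)

/-- The table `M₃` of easy 3-shortcuts: an arc followed by a 2-shortcut. -/
def easyThreeShortcuts (B : ℝ) (M : Table n) : Table n :=
  fun x z => ⨆ y, joinGain B (M x y) (twoShortcuts B M y z)

/-- Trivial-Shortcuts, as a table. -/
def trivialShortcuts (B : ℝ) (M : Table n) : Table n :=
  M ⊔ twoShortcuts B M ⊔ easyThreeShortcuts B M

open Classical in
/-- The values written to `D[x][z]` for the triple `x, y, z` by the main loop of
Short-Shortcuts (hard 3-shortcuts `x y a z`). -/
def hardThree (B : ℝ) (M : Table n) (x y z : Fin n) : EReal :=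
  let m := M x y
  -- largest gain at `z` without going below `x`
  let k := rangeMax (fun a => -m ≤ M y a ∧ M y a ≤ 0) (fun a => M y a + M a z)
  -- largest gain at `z` without going above `x`
  let l := rangeMax (fun a => 0 ≤ M y a ∧ M y a ≤ eabs m) (fun a => M y a + M a z)
  -- largest gain of the last arc while going above `x`
  let h := rangeMax (fun a => eabs m ≤ M y a) (fun a => M a z)
  max
    (if 0 ≤ m ∧ m ≤ m + k then m + k else ⊥)
    (if m ≤ 0 then
      max (if m + l ≤ m ∧ ((-B : ℝ) : EReal) ≤ m + l then m + l else ⊥)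
        (max (if m ≤ m + l then m else ⊥) (min m h))
    else ⊥)

/-- Short-Shortcuts. -/
def shortShortcuts (B : ℝ) (M : Table n) : Table n :=
  fun x z => max (trivialShortcuts B M x z) (⨆ y, hardThree B M x y z)

/-! ### Arc-bounded paths -/

/-- The admissible gains of the neighbouring arc, next to an arc of gain `m`, in Breadth-Search. -/
def OppositeWithin (m k : EReal) : Prop :=
  (0 ≤ m → -m ≤ k ∧ k ≤ 0) ∧ (¬ 0 ≤ m → 0 ≤ k ∧ k ≤ eabs m)

/-- Breadth-Search: extend arc-bounded paths by one arc. All range trees are built before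
any update. -/
def breadthSearch (M : Table n) (D : DS n) : DS n where
  sc := D.sc
  fst := fun x y z =>
    max (D.fst x y z)
      (M x y + rangeMax (fun a => OppositeWithin (M x y) (M y a)) (fun a => D.fst y a z))
  lst := fun z y x =>
    max (D.lst z y x)
      (rangeMax (fun a => OppositeWithin (M y x) (M a y)) (fun a => D.lst z a y) + M y x)

/-- The tuples of `U × V × W × X` in lexicographic order. -/
def tuples (U W X : Finset (Fin n)) : List (Fin n × Fin n × Fin n × Fin n) :=
  ((List.finRange n).filter (· ∈ U)) ×ˢ ((List.finRange n) ×ˢ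
    (((List.finRange n).filter (· ∈ W)) ×ˢ ((List.finRange n).filter (· ∈ X))))

open Classical in
/-- One iteration of the loop of Concatenate; `D₀` is the data structure from which the range
trees were built, `D` the current one. -/
def concatStep (M : Table n) (D₀ D : DS n) : Fin n × Fin n × Fin n × Fin n → DS n
  | (u, v, w, x) =>
    let D₁ :=
      if M u v < 0 then
        D.setFst u v x (max (D.fst u v x) (D.fst u v w +
          rangeMax (fun a => -(D.fst u v w - M u v) ≤ M w a ∧ M w a ≤ 0)
            (fun a => D₀.fst w a x)))
      else D
    if M v u < 0 then
      D₁.setLst x v u (max (D₁.lst x v u)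
        (rangeMax (fun a => -(D₁.lst w v u - M v u) ≤ M a w ∧ M a w ≤ 0)
          (fun a => D₀.lst x a w) + D₁.lst w v u))
    else D₁

/-- Concatenate. -/
def concatenate (M : Table n) (U W X : Finset (Fin n)) (D : DS n) : DS n :=
  (tuples U W X).foldl (concatStep M D) D

open Classical in
/-- One iteration of the loop of Concatenate-Opposite; `D₀` is the data structure from which
the range trees were built, `D` the current one. -/
def concatOppStep (M : Table n) (D₀ D : DS n) : Fin n × Fin n × Fin n × Fin n → DS n
  | (u, v, w, x) =>
    let D₁ :=
      if M u v < 0 then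
        D.setFst u v x (max (D.fst u v x) (D.fst u v w +
          rangeMax (fun a => 0 ≤ M a x ∧ M a x - D₀.lst w a x ≤ D.fst u v w - M u v ∧
              D₀.lst w a x ≤ eabs (D.fst u v w))
            (fun a => D₀.lst w a x)))
      else D
    let D₂ :=
      if M u v < 0 ∧ ∃ a, 0 ≤ M a x ∧ eabs (D₁.fst u v w) ≤ D₀.lst w a x ∧
          M a x ≤ eabs (M u v) then
        D₁.setFst u v x 0
      else D₁
    let D₃ :=
      if M v u < 0 then
        D₂.setLst x v u (max (D₂.lst x v u)
          (rangeMax (fun a => 0 ≤ M x a ∧ M x a - D₀.fst x a w ≤ D₂.lst w v u - M v u ∧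
              D₀.fst x a w ≤ eabs (D₂.lst w v u))
            (fun a => D₀.fst x a w) + D₂.lst w v u))
      else D₂
    if M v u < 0 ∧ ∃ a, 0 ≤ M x a ∧ eabs (D₃.lst w v u) ≤ D₀.fst x a w ∧
        M x a ≤ eabs (M v u) then
      D₃.setLst x v u 0
    else D₃

/-- Concatenate-Opposite. -/
def concatenateOpposite (M : Table n) (U W X : Finset (Fin n)) (D : DS n) : DS n :=
  (tuples U W X).foldl (concatOppStep M D) D

/-- Arc-Bounded-To-Monotone: the resulting table of shortcuts. The six lines are the six
kinds of assignments to an entry `D[p][q]`. -/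
def arcBoundedToMonotone (B : ℝ) (M : Table n) (D : DS n) (T : Finset (Fin n)) : Table n :=
  fun p q => D.sc p q
    ⊔ (⨆ (v : Fin n) (x : Fin n) (_ : p ∈ T ∧ M p v ≤ 0 ∧
          ((-B : ℝ) : EReal) ≤ D.fst p v x + M x q ∧ D.fst p v x + M x q ≤ M p v),
        D.fst p v x + M x q)
    ⊔ (⨆ (v : Fin n) (x : Fin n) (_ : p ∈ T ∧ M p v ≤ 0 ∧ M p v ≤ D.fst p v x + M x q), M p v)
    ⊔ (⨆ (u : Fin n) (x : Fin n) (_ : u ∈ T ∧ M u p ≤ 0 ∧ 0 ≤ D.fst u p x + M x q),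
        -(M u p) + (D.fst u p x + M x q))
    ⊔ (⨆ (v : Fin n) (x : Fin n) (_ : q ∈ T ∧ M v q ≤ 0 ∧
          ((-B : ℝ) : EReal) ≤ M p x + D.lst x v q ∧ M p x + D.lst x v q ≤ M v q),
        M p x + D.lst x v q)
    ⊔ (⨆ (v : Fin n) (x : Fin n) (_ : q ∈ T ∧ M v q ≤ 0 ∧ M v q ≤ M p x + D.lst x v q), M v q)
    ⊔ (⨆ (u : Fin n) (x : Fin n) (_ : u ∈ T ∧ M q u ≤ 0 ∧ 0 ≤ M p x + D.lst x q u),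
        (M p x + D.lst x q u) - M q u)

/-! ### Randomness -/

/-- A coin that shows `true` with probability `q` (truncated to `[0,1]`). -/
def coin (q : ℝ) : PMF Bool :=
  PMF.ofFintype (fun b => cond b (min 1 (ENNReal.ofReal q)) (1 - min 1 (ENNReal.ofReal q)))
    (by simp [add_tsub_cancel_of_le])

def sampleFrom (q : ℝ) : List (Fin n) → PMF (Finset (Fin n))
  | [] => PMF.pure ∅
  | v :: l => (coin q).bind fun b => (sampleFrom q l).map fun S => if b then insert v S else S

/-- Every vertex is put into the sample independently with probability `q`. -/
def sampleVertices (n : ℕ) (q : ℝ) : PMF (Finset (Fin n)) := sampleFrom q (List.finRange n)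

/-- The constants hidden in the `Θ(·)`s of the algorithm. -/
structure Constants where
  /-- number of outer iterations -/
  outer : ℝ
  /-- number of inner iterations -/
  inner : ℝ
  /-- the parameter `s` of Compute-Funnels -/
  funnel : ℝ
  /-- sampling probability in Compute-Funnels -/
  funnelSample : ℝ
  /-- sampling probabilities in Long-Shortcuts -/
  longSample : ℝ

def Constants.AtLeast (κ : Constants) (K : ℝ) : Prop :=
  K ≤ κ.outer ∧ K ≤ κ.inner ∧ K ≤ κ.funnel ∧ K ≤ κ.funnelSample ∧ K ≤ κ.longSample

/-- Logarithm to base 2. -/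
def lg (n : ℕ) : ℝ := Real.logb 2 n

/-- Compute-Funnels. -/
def computeFunnels (κ : Constants) (M : Table n) : PMF (DS n) :=
  let s : ℕ := ⌈κ.funnel * (n : ℝ) ^ (2 / 3 : ℝ)⌉₊
  let L : ℕ := ⌈(n : ℝ) / s⌉₊
  let D₁ := (breadthSearch M)^[L] (DS.init M)
  (sampleVertices n (κ.funnelSample * lg n * s / n)).map fun S =>
    let D₂ := (concatenate M S S S)^[⌈lg n⌉₊] D₁
    let D₃ := concatenate M S S Finset.univ D₂
    (breadthSearch M)^[L] D₃

/-- Round `i` of the loop of Long-Shortcuts. -/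
def longRound (κ : Constants) (M : Table n) (i : ℕ) (st : DS n × Finset (Fin n)) :
    PMF (DS n × Finset (Fin n)) :=
  (sampleVertices n (κ.longSample * lg n ^ 2 / (2 ^ i * (n : ℝ) ^ (1 / 2 : ℝ)))).map fun T =>
    ((fun D => concatenate M T Finset.univ Finset.univ
        (concatenateOpposite M T Finset.univ Finset.univ D))^[2 ^ i] st.1,
      st.2 ∪ T)

/-- The rounds `1, …, k` of the loop of Long-Shortcuts, started from `D` and `T = ∅`. -/
def longRounds (κ : Constants) (M : Table n) (D : DS n) : ℕ → PMF (DS n × Finset (Fin n))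
  | 0 => PMF.pure (D, ∅)
  | k + 1 => (longRounds κ M D k).bind (longRound κ M (k + 1))

/-- Long-Shortcuts. -/
def longShortcuts (κ : Constants) (B : ℝ) (M : Table n) : PMF (Table n) :=
  (computeFunnels κ M).bind fun D =>
    (longRounds κ M D ⌈Real.logb 2 ((n : ℝ) ^ (1 / 2 : ℝ) * lg n ^ 2)⌉₊).map fun st =>
      arcBoundedToMonotone B M st.1 st.2

/-- One inner iteration of Update-Shortcuts on the pair `(M, M')`. -/
def innerIteration (κ : Constants) (B : ℝ) (r : ℕ) (st : Table n × Table n) :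
    PMF (Table n × Table n) :=
  (coin (lg n / r)).bind fun b =>
    if b then (longShortcuts κ B st.1).map fun N => (shortShortcuts B st.1, st.2 ⊔ N)
    else PMF.pure (shortShortcuts B st.1, st.2)

/-- `k`-fold repetition of a randomized step. -/
def repeatStep {α : Type} (f : α → PMF α) : ℕ → α → PMF α
  | 0, a => PMF.pure a
  | k + 1, a => (f a).bind (repeatStep f k)

/-- Update-Shortcuts. -/
def updateShortcuts (κ : Constants) (B : ℝ) (M : Table n) : PMF (Table n) :=
  let r : ℕ := ⌈κ.inner * (n : ℝ) ^ (1 / 2 : ℝ)⌉₊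
  (repeatStep (innerIteration κ B r) r (M, M)).map fun st => st.1 ⊔ st.2

open Classical in
/-- The initial table: the gain of every arc, `0` on the diagonal, `-∞` elsewhere. -/
def initialTable (G : RoadNetwork n) : Table n :=
  fun i j => max (if G.Arc i j then (G.gain i j : EReal) else ⊥) (if i = j then 0 else ⊥)

/-- Compute-Shortcuts: the distribution of the table returned by Stage I. -/
def computeShortcuts (κ : Constants) (G : RoadNetwork n) (B : ℝ) : PMF (Table n) :=
  repeatStep (updateShortcuts κ B) ⌈κ.outer * lg n ^ 2⌉₊ (initialTable G)

/-! ### The graph `H` and its transitive closure -/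

/-- The two copies `v⁰` and `v^B` of every vertex. -/
inductive Level
  | zero
  | full

/-- The arcs of `H`. -/
inductive HArc (B : ℝ) (M : Table n) : Fin n × Level → Fin n × Level → Prop
  | zeroZero (x y z : Fin n) (h₁ : 0 ≤ M x y + M y z) (h₂ : 0 ≤ M x y) :
      HArc B M (x, Level.zero) (z, Level.zero)
  | zeroFull (x y : Fin n) (h : (B : EReal) ≤ M x y ∨ (0 < M x y + M y x ∧ 0 < M x y)) :
      HArc B M (x, Level.zero) (y, Level.full)
  | fullZero (x y : Fin n) (h : M x y ≠ ⊥) :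
      HArc B M (x, Level.full) (y, Level.zero)
  | fullFull (x y z : Fin n) (h₁ : 0 ≤ M x y + M y z) (h₂ : 0 ≤ M y z) :
      HArc B M (x, Level.full) (z, Level.full)

/-- The arcs of the transitive closure `H⋆` of `H`. -/
def HStarArc (B : ℝ) (M : Table n) : Fin n × Level → Fin n × Level → Prop :=
  Relation.TransGen (HArc B M)

end ElectricCar

end

/-! The proof shows that with high probability the final table is complete (`Complete`,
`not_complete_le`): for any two distinct vertices and each of two kinds of simple path in the
initial table, the entry is at least the gain of every such path. Ascending paths start lowest, end
highest and count by total gain; for the others what counts is a lower bound on the gain of all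
subpaths. Given a complete table the rest is deterministic (`Complete.hStarArc`).

Completeness. Fix the two ends, the kind and the best gain, and follow the length l of a shortest
admissible path in the current table. A cut is a pair of consecutive arcs of the same sign, or the
second pair at a local minimum of arc size. Short-Shortcuts saves a sixth of the number of cuts, and
always at least one arc (`IsTracked.short_of_cuts`, `IsTracked.short_save_one`). So if l is O(√n),
or the number of cuts is Ω(l/√n), it saves a fraction Ω(1/√n) of the arcs. Otherwise cuts are rare,
and a stretch without cuts is an opening funnel followed by a closing one. Compute-Funnels is likely
to find all funnels (`fstOK_funnelsFrom`). From a sampled descending arc, each iteration of a round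
of Long-Shortcuts then gets past one more cut, as long as the path stays in the range of that arc
(`fstOK_iterate_longStep`), and the exit arc gives a shortcut. A count over dyadic numbers of cuts
(`exists_scale`) shows that at some scale the samples cover Ω(l/log n) positions, so with
probability at least 1/2 the length falls by the factor 1 - 1/(384 log n) (`IsTracked.long_save`).
Long-Shortcuts commutes with reversal, so the better of the path and its reverse may be used.

Within Update-Shortcuts the first table evolves deterministically. Either Short-Shortcuts alone
achieves this factor, or in at least half of the iterations Long-Shortcuts is likely to achieve it;
so an update succeeds with probability at least 1/5 (`updateShortcuts_fail_le`). The mean of l^s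
with s = ⌈384 log n⌉ (counted as 0 once l ≤ 1) hence shrinks by 9/10 per update, and Θ(log² n)
updates followed by a union bound over kinds and pairs of ends give completeness.

From a complete table to the closure. While the car follows its walk, `Reaches` keeps a simple path,
carrying enough charge, from a vertex that the closure reaches either empty or full. If the next arc
closes a cycle, then either the prefix is as good, or the cycle gains charge; in the latter case its
lowest vertex has a zero-to-full arc to some vertex of the cycle, and the simple path restarts there
fully charged (`Complete.reaches_step`). -/

namespace ElectricCar

/-! ### Covering and counting intervals of positions along a path. -/

/-- Vitali covering for intervals of natural numbers. -/
lemma exists_disjoint_intervals (J : Finset (ℕ × ℕ)) (hJ : ∀ p ∈ J, p.1 < p.2) (D : Finset ℕ)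
    (hD : ∀ d ∈ D, ∃ p ∈ J, p.1 ≤ d ∧ d < p.2) :
    ∃ F ⊆ J, (∀ p ∈ F, ∀ q ∈ F, p ≠ q → p.2 ≤ q.1 ∨ q.2 ≤ p.1) ∧
      D.card ≤ ∑ p ∈ F, 3 * (p.2 - p.1) := by
  classical
  induction hk : J.card using Nat.strong_induction_on generalizing J D with
  | _ k ih =>
  rcases J.eq_empty_or_nonempty with rfl | hne
  · refine ⟨∅, by simp, by simp, ?_⟩
    have : D = ∅ := by
      apply Finset.eq_empty_of_forall_notMem
      intro d hd
      obtain ⟨p, hp, _⟩ := hD d hd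
      simp at hp
    simp [this]
  -- Greedy choice: keep a longest interval and discard all that meet it. A point covered only by
  -- discarded intervals lies in the interval three times as long around `p`.
  obtain ⟨p, hp, hmax⟩ := J.exists_max_image (fun p => p.2 - p.1) hne
  have hp' := hJ p hp
  set J' := J.filter (fun q => q.2 ≤ p.1 ∨ p.2 ≤ q.1) with hJ'
  have hpJ' : p ∉ J' := by simp only [hJ', Finset.mem_filter]; omega
  set D' := D.filter (fun d => ∃ q ∈ J', q.1 ≤ d ∧ d < q.2) with hD'
  obtain ⟨F, hFJ, hdis, hcard⟩ := ih J'.card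
    (by rw [← hk]; exact Finset.card_lt_card ⟨Finset.filter_subset _ _, fun h => hpJ' (h hp)⟩) J'
    (fun q hq => hJ q (Finset.mem_of_mem_filter q hq)) D'
    (fun d hd => (Finset.mem_filter.1 hd).2) rfl
  have hpF : p ∉ F := fun h => hpJ' (hFJ h)
  refine ⟨insert p F, ?_, ?_, ?_⟩
  · intro q hq
    rcases Finset.mem_insert.1 hq with rfl | hq
    · exact hp
    · exact Finset.mem_of_mem_filter q (hFJ hq)
  · intro a ha b hb hab
    rcases Finset.mem_insert.1 ha with ha | ha <;> rcases Finset.mem_insert.1 hb with hb | hb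
    · exact absurd (ha.trans hb.symm) hab
    · have := (Finset.mem_filter.1 (hFJ hb)).2
      rw [ha]
      exact this.symm
    · have := (Finset.mem_filter.1 (hFJ ha)).2
      rw [hb]
      exact this
    · exact hdis a ha b hb hab
  · rw [Finset.sum_insert hpF]
    have h1 : D.card ≤ D'.card + (D \ D').card := by
      have := Finset.card_sdiff_add_card_eq_card
        (Finset.filter_subset (fun d => ∃ q ∈ J', q.1 ≤ d ∧ d < q.2) D)
      rw [← hD'] at this
      omega
    have h2 : (D \ D') ⊆ Finset.Ico (p.1 - (p.2 - p.1)) (p.2 + (p.2 - p.1)) := by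
      intro d hd
      rw [Finset.mem_sdiff] at hd
      obtain ⟨q, hq, h1, h2⟩ := hD d hd.1
      have hq' := hmax q hq
      have : q ∉ J' := fun h => hd.2 (Finset.mem_filter.2 ⟨hd.1, q, h, h1, h2⟩)
      simp only [hJ', Finset.mem_filter, hq, true_and] at this
      rw [Finset.mem_Ico]
      omega
    have h3 := Finset.card_le_card h2
    rw [Nat.card_Ico] at h3
    omega

/-- Disjoint jumps can be used together. -/
lemma exists_chain_of_disjoint (good : ℕ → ℕ → Prop) (l : ℕ)
    (hstep : ∀ a, a < l → good a (a + 1)) (F : Finset (ℕ × ℕ))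
    (hF : ∀ p ∈ F, p.1 < p.2 ∧ p.2 ≤ l ∧ good p.1 p.2)
    (hdis : ∀ p ∈ F, ∀ q ∈ F, p ≠ q → p.2 ≤ q.1 ∨ q.2 ≤ p.1) :
    ∀ d p, l = p + d → (∀ q ∈ F, ¬ (q.1 < p ∧ p < q.2)) →
    ∃ (k : ℕ) (φ : ℕ → ℕ), φ 0 = p ∧ φ k = l ∧
      (∀ i, i < k → φ i < φ (i + 1) ∧ good (φ i) (φ (i + 1))) ∧
      k + ∑ q ∈ F.filter (fun q => p ≤ q.1), (q.2 - q.1 - 1) ≤ d := by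
  classical
  intro d
  induction d using Nat.strong_induction_on with
  | _ d ih =>
  intro p hl hp
  have prepend : ∀ b, p < b → good p b → (∃ (k : ℕ) (φ : ℕ → ℕ), φ 0 = b ∧ φ k = l ∧
      (∀ i, i < k → φ i < φ (i + 1) ∧ good (φ i) (φ (i + 1))) ∧
      k + 1 + ∑ q ∈ F.filter (fun q => p ≤ q.1), (q.2 - q.1 - 1) ≤ d) →
      ∃ (k : ℕ) (φ : ℕ → ℕ), φ 0 = p ∧ φ k = l ∧
      (∀ i, i < k → φ i < φ (i + 1) ∧ good (φ i) (φ (i + 1))) ∧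
      k + ∑ q ∈ F.filter (fun q => p ≤ q.1), (q.2 - q.1 - 1) ≤ d := by
    rintro b hpb hg ⟨k, φ, h0, hk, hs, hc⟩
    refine ⟨k + 1, fun i => Nat.casesOn i p φ, rfl, hk, ?_, hc⟩
    intro i hi
    cases i with
    | zero => simpa [h0] using ⟨hpb, hg⟩
    | succ i => exact hs i (by omega)
  rcases Nat.eq_zero_or_pos d with rfl | hd
  · refine ⟨0, fun _ => p, rfl, by simp only; omega, by simp, ?_⟩
    rw [Finset.filter_false_of_mem]
    · simp
    · intro q hq h
      have := hF q hq
      omega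
  -- The position `p` is strictly inside no jump of `F`. So either a jump starts here and is taken,
  -- saving its length minus one, or a single step is safe.
  by_cases hj : ∃ q ∈ F, q.1 = p
  · obtain ⟨q, hq, rfl⟩ := hj
    obtain ⟨hq1, hq2, hq3⟩ := hF q hq
    refine prepend q.2 hq1 hq3 ?_
    obtain ⟨k, φ, h0, hk, hs, hc⟩ := ih (l - q.2) (by omega) q.2 (by omega) (by
      intro x hx hh
      have := hF x hx
      rcases eq_or_ne x q with rfl | hne
      · omega
      · have := hdis x hx q hq hne
        omega)
    refine ⟨k, φ, h0, hk, hs, ?_⟩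
    have : F.filter (fun x => q.1 ≤ x.1) = insert q (F.filter (fun x => q.2 ≤ x.1)) := by
      ext x
      simp only [Finset.mem_filter, Finset.mem_insert]
      constructor
      · rintro ⟨hx, h⟩
        rcases eq_or_ne x q with rfl | hne
        · exact Or.inl rfl
        · have := hdis x hx q hq hne
          have := hF x hx
          exact Or.inr ⟨hx, by omega⟩
      · rintro (rfl | ⟨hx, h⟩)
        · exact ⟨hq, le_rfl⟩
        · exact ⟨hx, by omega⟩
    rw [this, Finset.sum_insert (by simp only [Finset.mem_filter]; omega)]
    omega
  · push Not at hj
    refine prepend (p + 1) (by omega) (hstep p (by omega)) ?_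
    obtain ⟨k, φ, h0, hk, hs, hc⟩ := ih (d - 1) (by omega) (p + 1) (by omega) (by
      intro x hx hh
      have h1 := hp x hx
      have h2 := hj x hx
      omega)
    refine ⟨k, φ, h0, hk, hs, ?_⟩
    have : F.filter (fun x => p ≤ x.1) = F.filter (fun x => p + 1 ≤ x.1) := by
      ext x
      simp only [Finset.mem_filter]
      constructor
      · rintro ⟨hx, h⟩
        have h2 := hj x hx
        exact ⟨hx, by omega⟩
      · rintro ⟨hx, h⟩
        exact ⟨hx, by omega⟩
    rw [this]
    omega

/-- If the points of `D` are covered by good jumps, then a chain of good steps saves a sixth of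
`D`. -/
lemma exists_chain_of_cover (good : ℕ → ℕ → Prop) (l : ℕ)
    (hstep : ∀ a, a < l → good a (a + 1)) (D : Finset ℕ)
    (hD : ∀ d ∈ D, ∃ a b, a ≤ d ∧ d < b ∧ a + 2 ≤ b ∧ b ≤ l ∧ good a b) :
    ∃ (k : ℕ) (φ : ℕ → ℕ), φ 0 = 0 ∧ φ k = l ∧
      (∀ i, i < k → φ i < φ (i + 1) ∧ good (φ i) (φ (i + 1))) ∧ 6 * k + D.card ≤ 6 * l := by
  classical
  choose! f g h1 h2 h3 h4 h5 using hD
  obtain ⟨F, hFJ, hdis, hcard⟩ := exists_disjoint_intervals (D.image fun d => (f d, g d))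
    (by
      intro p hp
      obtain ⟨d, hd, rfl⟩ := Finset.mem_image.1 hp
      have := h3 d hd
      simp only; omega) D
    (fun d hd => ⟨(f d, g d), Finset.mem_image_of_mem _ hd, h1 d hd, h2 d hd⟩)
  have hF : ∀ p ∈ F, p.1 + 2 ≤ p.2 ∧ p.2 ≤ l ∧ good p.1 p.2 := by
    intro p hp
    obtain ⟨d, hd, rfl⟩ := Finset.mem_image.1 (hFJ hp)
    exact ⟨h3 d hd, h4 d hd, h5 d hd⟩
  obtain ⟨k, φ, a, b, c, e⟩ := exists_chain_of_disjoint good l hstep F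
    (fun p hp => ⟨by have := (hF p hp).1; omega, (hF p hp).2⟩) hdis l 0 (by omega) (by simp)
  refine ⟨k, φ, a, b, c, ?_⟩
  -- A jump of length at least 2 saves at least half its length, which turns the 3 of the covering
  -- into 6.
  have : ∑ p ∈ F, 3 * (p.2 - p.1) ≤ ∑ p ∈ F, 6 * (p.2 - p.1 - 1) :=
    Finset.sum_le_sum fun p hp => by have := (hF p hp).1; omega
  rw [← Finset.mul_sum, ← Finset.mul_sum] at this
  rw [← Finset.mul_sum] at hcard
  simp only [Nat.zero_le, Finset.filter_true] at e
  omega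

/-- If every interval `[e, r e)` with `e ∈ A` holds at least `b` points of `Q` and every point of
`A` lies in at most `t` of these intervals, then `b * |A| ≤ t * |Q|`. -/
lemma mul_card_le_of_shallow (r : ℕ → ℕ) (b t : ℝ) (ht : 0 ≤ t) (A Q : Finset ℕ)
    (hr : ∀ e ∈ A, e < r e)
    (hQ : ∀ e ∈ A, b ≤ ((Q.filter fun j => e ≤ j ∧ j < r e).card : ℝ))
    (hA : ∀ a ∈ A, ((A.filter fun e => e ≤ a ∧ a < r e).card : ℝ) ≤ t) :
    b * A.card ≤ t * Q.card := by
  classical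
  induction hk : A.card using Nat.strong_induction_on generalizing A Q with
  | _ k ih =>
  rcases A.eq_empty_or_nonempty with rfl | hne
  · simp at hk; subst hk; simp; positivity
  -- Take the interval that ends first. Every a in `A` before its end satisfies a ≤ m < r e ≤ r a
  -- for the last such position m, so at most t positions are removed with `A1`, while at least b
  -- points of `Q` go with `Q1`.
  obtain ⟨e, he, hmin⟩ := A.exists_min_image r hne
  have hre := hr e he
  set A1 := A.filter (fun a => a < r e) with hA1
  set A2 := A.filter (fun a => ¬ a < r e) with hA2
  have hcA : A1.card + A2.card = A.card := Finset.card_filter_add_card_filter_not _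
  have heA1 : e ∈ A1 := Finset.mem_filter.2 ⟨he, hre⟩
  have hA1t : (A1.card : ℝ) ≤ t := by
    obtain ⟨m, hm, hmm⟩ := A1.exists_max_image id ⟨e, heA1⟩
    refine le_trans ?_ (hA m (Finset.mem_of_mem_filter m hm))
    norm_cast
    apply Finset.card_le_card
    intro a ha
    have h1 := hmm a ha
    have h2 := Finset.mem_filter.1 ha
    have h3 := hmin a h2.1
    have h4 := (Finset.mem_filter.1 hm).2
    simp only [id] at h1
    exact Finset.mem_filter.2 ⟨h2.1, h1, by omega⟩
  set Q1 := Q.filter (fun j => j < r e) with hQ1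
  set Q2 := Q.filter (fun j => ¬ j < r e) with hQ2
  have hcQ : Q1.card + Q2.card = Q.card := Finset.card_filter_add_card_filter_not _
  have hbQ : b ≤ Q1.card := by
    refine (hQ e he).trans ?_
    norm_cast
    apply Finset.card_le_card
    intro j hj
    rw [Finset.mem_filter] at hj ⊢
    exact ⟨hj.1, hj.2.2⟩
  have hpos : 0 < A1.card := Finset.card_pos.2 ⟨e, heA1⟩
  have := ih A2.card (by omega) A2 Q2 (fun a ha => hr a (Finset.mem_of_mem_filter a ha)) (by
    intro a ha
    have h0 := (Finset.mem_filter.1 ha).2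
    refine (hQ a (Finset.mem_of_mem_filter a ha)).trans ?_
    norm_cast
    apply Finset.card_le_card
    intro j hj
    rw [Finset.mem_filter] at hj ⊢
    exact ⟨Finset.mem_filter.2 ⟨hj.1, by omega⟩, hj.2⟩) (by
    intro a ha
    refine le_trans ?_ (hA a (Finset.mem_of_mem_filter a ha))
    norm_cast
    apply Finset.card_le_card
    intro j hj
    rw [Finset.mem_filter] at hj ⊢
    exact ⟨Finset.mem_of_mem_filter j hj.1, hj.2⟩) rfl
  rw [← hk, ← hcA, ← hcQ]
  push_cast
  nlinarith
end ElectricCar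

/-! ### Paths as height functions and the two kinds of admissibility. -/

namespace ElectricCar
variable {n : ℕ}

/-- The heights `H` realise exactly the gains of the table along the first `l` arcs of `v`. -/
def Exact (M : Table n) (v : ℕ → Fin n) (l : ℕ) (H : ℕ → ℝ) : Prop :=
  ∀ k, k < l → M (v k) (v (k + 1)) = ((H (k + 1) - H k : ℝ) : EReal)

/-- Admissible height functions: ascending ones gain at least `τ`, with the start lowest and the
end highest; the others never lose more than `-τ`. -/
def Adm (B : ℝ) (asc : Bool) (τ : ℝ) (l : ℕ) (h : ℕ → ℝ) : Prop :=
  (∀ a b, a ≤ b → b ≤ l → -B ≤ h b - h a) ∧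
  (asc = true → (∀ a, a ≤ l → h 0 ≤ h a ∧ h a ≤ h l) ∧ τ ≤ h l - h 0) ∧
  (asc = false → -B ≤ τ ∧ ∀ a b, a ≤ b → b ≤ l → τ ≤ h b - h a)

/-- A simple path with exact heights which is admissible. -/
structure IsTracked (B : ℝ) (asc : Bool) (τ : ℝ) (x y : Fin n) (M : Table n) (l : ℕ)
    (v : ℕ → Fin n) (H : ℕ → ℝ) : Prop where
  source : v 0 = x
  target : v l = y
  inj : Set.InjOn v (Set.Iic l)
  exact : Exact M v l H
  adm : Adm B asc τ l H

/-- There is an admissible path with at most `k` arcs. -/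
def HasPath (B : ℝ) (asc : Bool) (τ : ℝ) (x y : Fin n) (M : Table n) (k : ℕ) : Prop :=
  ∃ l, l ≤ k ∧ ∃ v H, IsTracked B asc τ x y M l v H

/-- Admissibility only asks for lower bounds on gains of subpaths, so larger increments preserve it.
This is why shortcuts may be compared by inequality only. -/
lemma Adm.of_le {B : ℝ} {asc : Bool} {τ : ℝ} {l : ℕ} {h h' : ℕ → ℝ} (hh : Adm B asc τ l h)
    (hle : ∀ a b, a ≤ b → b ≤ l → h b - h a ≤ h' b - h' a) : Adm B asc τ l h' := by
  refine ⟨fun a b hab hb => (hh.1 a b hab hb).trans (hle a b hab hb), fun hasc => ?_,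
    fun hasc => ⟨(hh.2.2 hasc).1, fun a b hab hb =>
      ((hh.2.2 hasc).2 a b hab hb).trans (hle a b hab hb)⟩⟩
  obtain ⟨h1, h2⟩ := hh.2.1 hasc
  refine ⟨fun a ha => ⟨?_, ?_⟩, ?_⟩
  · have := hle 0 a (by omega) ha
    have := (h1 a ha).1
    linarith
  · have := hle a l ha le_rfl
    have := (h1 a ha).2
    linarith
  · have := hle 0 l (by omega) le_rfl
    linarith

lemma Adm.comp {B : ℝ} {asc : Bool} {τ : ℝ} {l k : ℕ} {h : ℕ → ℝ} {φ : ℕ → ℕ}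
    (hh : Adm B asc τ l h) (h0 : φ 0 = 0) (hk : φ k = l)
    (hφ : ∀ a b, a ≤ b → b ≤ k → φ a ≤ φ b) : Adm B asc τ k (fun i => h (φ i)) := by
  have hl : ∀ a, a ≤ k → φ a ≤ l := fun a ha => hk ▸ hφ a k ha le_rfl
  refine ⟨fun a b hab hb => hh.1 _ _ (hφ a b hab hb) (hl b hb), fun hasc => ?_,
    fun hasc => ⟨(hh.2.2 hasc).1, fun a b hab hb =>
      (hh.2.2 hasc).2 _ _ (hφ a b hab hb) (hl b hb)⟩⟩
  obtain ⟨h1, h2⟩ := hh.2.1 hasc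
  simp only [h0, hk]
  exact ⟨fun a ha => h1 _ (hl a ha), h2⟩

lemma HasPath.mono_length {B : ℝ} {asc : Bool} {τ : ℝ} {x y : Fin n} {M : Table n} {k k' : ℕ}
    (h : HasPath B asc τ x y M k) (hk : k ≤ k') : HasPath B asc τ x y M k' := by
  obtain ⟨l, hl, h⟩ := h
  exact ⟨l, hl.trans hk, h⟩

/-- A path is found in any table that dominates the increments of an admissible height function
along a chain of positions. -/
lemma hasPath_of_chain {B : ℝ} {asc : Bool} {τ : ℝ} {x y : Fin n} {M' : Table n} {l k : ℕ}
    {v : ℕ → Fin n} {h : ℕ → ℝ} {φ : ℕ → ℕ} (hM' : ∀ x y, M' x y ≠ ⊤)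
    (hx : v 0 = x) (hy : v l = y) (hinj : Set.InjOn v (Set.Iic l)) (hadm : Adm B asc τ l h)
    (h0 : φ 0 = 0) (hk : φ k = l)
    (hφ : ∀ i, i < k → φ i < φ (i + 1) ∧
      ((h (φ (i + 1)) - h (φ i) : ℝ) : EReal) ≤ M' (v (φ i)) (v (φ (i + 1)))) :
    HasPath B asc τ x y M' k := by
  have hmono : ∀ a b, a ≤ b → b ≤ k → φ a ≤ φ b := by
    intro a b hab
    induction b, hab using Nat.le_induction with
    | base => simp
    | succ b hab ih =>
      intro hb
      exact (ih (by omega)).trans (hφ b (by omega)).1.le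
  have hinj' : ∀ a b, a < b → b ≤ k → φ a < φ b := by
    intro a b hab hb
    exact (hφ a (by omega)).1.trans_le (hmono (a + 1) b hab hb)
  -- The heights `h` merely bound the entries from below; exact heights are the partial sums of the
  -- entries themselves.
  set g : ℕ → ℝ := fun i => (M' (v (φ i)) (v (φ (i + 1)))).toReal with hg
  have hge : ∀ i, i < k → M' (v (φ i)) (v (φ (i + 1))) = (g i : EReal) := by
    intro i hi
    refine (EReal.coe_toReal (hM' _ _) ?_).symm
    intro hbot
    have := (hφ i hi).2
    rw [hbot] at this
    exact EReal.coe_ne_bot _ (le_bot_iff.1 this)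
  have hle : ∀ i, i < k → h (φ (i + 1)) - h (φ i) ≤ g i := by
    intro i hi
    have := (hφ i hi).2
    rw [hge i hi] at this
    exact_mod_cast this
  refine ⟨k, le_rfl, fun i => v (φ i), fun j => ∑ i ∈ Finset.range j, g i, by simp [h0, hx],
    by simp [hk, hy], ?_, ?_, ?_⟩
  · intro a ha b hb hab
    simp only [Set.mem_Iic] at ha hb
    have hab' := hinj (show φ a ∈ Set.Iic l from hk ▸ hmono a k ha le_rfl)
      (show φ b ∈ Set.Iic l from hk ▸ hmono b k hb le_rfl) hab
    rcases lt_trichotomy a b with h | h | h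
    · have := hinj' a b h hb; omega
    · exact h
    · have := hinj' b a h ha; omega
  · intro i hi
    rw [hge i hi]
    simp only [Finset.sum_range_succ]
    congr 1
    ring
  · refine (hadm.comp h0 hk hmono).of_le ?_
    intro a b hab
    induction b, hab using Nat.le_induction with
    | base => simp
    | succ b hab ih =>
      intro hb
      have h1 := ih (by omega)
      have h2 := hle b (by omega)
      simp only [Finset.sum_range_succ] at h1 ⊢
      linarith

lemma HasPath.mono {B : ℝ} {asc : Bool} {τ : ℝ} {x y : Fin n} {M M' : Table n} {k : ℕ}
    (h : HasPath B asc τ x y M k) (hM' : ∀ x y, M' x y ≠ ⊤) (hle : M ≤ M') :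
    HasPath B asc τ x y M' k := by
  obtain ⟨l, hl, v, H, h⟩ := h
  refine HasPath.mono_length (hasPath_of_chain (φ := id) hM' h.source h.target h.inj h.adm rfl rfl
    fun i hi => ⟨Nat.lt_succ_self i, ?_⟩) hl
  simp only [id]
  rw [← h.exact i hi]
  exact hle _ _

lemma HasPath.le_of_one {B : ℝ} {asc : Bool} {τ : ℝ} {x y : Fin n} {M : Table n}
    (h : HasPath B asc τ x y M 1) (hxy : x ≠ y) : (τ : EReal) ≤ M x y := by
  obtain ⟨l, hl, v, H, h⟩ := h
  have : l = 1 := by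
    have : l ≠ 0 := by
      rintro rfl
      exact hxy (h.source.symm.trans h.target)
    omega
  subst this
  have h1 := h.exact 0 (by omega)
  rw [h.source, zero_add, h.target] at h1
  rw [h1]
  cases asc
  · exact_mod_cast (h.adm.2.2 rfl).2 0 1 (by omega) le_rfl
  · exact_mod_cast (h.adm.2.1 rfl).2

/-- Exchanging the roles of rows and columns. -/
def Table.tr (M : Table n) : Table n := fun x y => M y x

lemma IsTracked.tr {B : ℝ} {asc : Bool} {τ : ℝ} {x y : Fin n} {M : Table n} {l : ℕ}
    {v : ℕ → Fin n} {H : ℕ → ℝ} (h : IsTracked B asc τ x y M l v H) :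
    IsTracked B asc τ y x M.tr l (fun i => v (l - i)) (fun i => -H (l - i)) := by
  refine ⟨by simp [h.target], by simp [h.source], ?_, ?_, ?_, ?_, ?_⟩
  · intro a ha b hb hab
    simp only [Set.mem_Iic] at ha hb
    have := h.inj (show l - a ∈ Set.Iic l from Nat.sub_le _ _)
      (show l - b ∈ Set.Iic l from Nat.sub_le _ _) hab
    omega
  · intro k hk
    have := h.exact (l - (k + 1)) (by omega)
    rw [show l - (k + 1) + 1 = l - k by omega] at this
    simp only [Table.tr, this]
    congr 1
    ring
  · intro a b hab hb
    have := h.adm.1 (l - b) (l - a) (by omega) (by omega)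
    simp only
    linarith
  · intro hasc
    obtain ⟨h1, h2⟩ := h.adm.2.1 hasc
    simp only [Nat.sub_zero, Nat.sub_self]
    refine ⟨fun a ha => ?_, by linarith⟩
    have := h1 (l - a) (Nat.sub_le _ _)
    constructor <;> linarith [this.1, this.2]
  · intro hasc
    refine ⟨(h.adm.2.2 hasc).1, fun a b hab hb => ?_⟩
    have := (h.adm.2.2 hasc).2 (l - b) (l - a) (by omega) (by omega)
    linarith

lemma HasPath.tr {B : ℝ} {asc : Bool} {τ : ℝ} {x y : Fin n} {M : Table n} {k : ℕ}
    (h : HasPath B asc τ x y M k) : HasPath B asc τ y x M.tr k := by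
  obtain ⟨l, hl, v, H, h⟩ := h
  exact ⟨l, hl, _, _, h.tr⟩

/-! ### Pairs of consecutive arcs -/

/-- Two consecutive arcs of opposite signs, the second not larger than the first. -/
def Closing (H : ℕ → ℝ) (f : ℕ) : Prop :=
  (H f < H (f + 1) ∧ H (f + 2) < H (f + 1) ∧ H f ≤ H (f + 2)) ∨
  (H (f + 1) < H f ∧ H (f + 1) < H (f + 2) ∧ H (f + 2) ≤ H f)

/-- Two consecutive arcs of opposite signs, the first not larger than the second. -/
def WeakOpening (H : ℕ → ℝ) (f : ℕ) : Prop :=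
  (H f < H (f + 1) ∧ H (f + 2) ≤ H f) ∨ (H (f + 1) < H f ∧ H f ≤ H (f + 2))

/-- Two consecutive arcs of opposite signs, the first smaller than the second. -/
def Opening (H : ℕ → ℝ) (f : ℕ) : Prop :=
  (H f < H (f + 1) ∧ H (f + 2) < H f) ∨ (H (f + 1) < H f ∧ H f < H (f + 2))

/-- Two consecutive arcs that do not have opposite signs. -/
def SameSign (H : ℕ → ℝ) (f : ℕ) : Prop :=
  (H f ≤ H (f + 1) ∧ H (f + 1) ≤ H (f + 2)) ∨ (H (f + 1) ≤ H f ∧ H (f + 2) ≤ H (f + 1))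

/-- A pair of consecutive arcs of the same sign, or the second pair of a local minimum. -/
def Cut (H : ℕ → ℝ) (f : ℕ) : Prop :=
  SameSign H f ∨ (Opening H f ∧ 1 ≤ f ∧ Closing H (f - 1))

lemma closing_or_opening_or_sameSign (H : ℕ → ℝ) (f : ℕ) :
    Closing H f ∨ Opening H f ∨ SameSign H f := by
  unfold Closing Opening SameSign
  rcases lt_trichotomy (H f) (H (f + 1)) with h1 | h1 | h1 <;>
  rcases lt_trichotomy (H (f + 1)) (H (f + 2)) with h2 | h2 | h2 <;>
  rcases le_or_gt (H f) (H (f + 2)) with h3 | h3 <;> grind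

lemma Opening.weak {H : ℕ → ℝ} {f : ℕ} (h : Opening H f) : WeakOpening H f := by
  unfold Opening at h; unfold WeakOpening
  rcases h with h | h
  · exact Or.inl ⟨h.1, h.2.le⟩
  · exact Or.inr ⟨h.1, h.2.le⟩

/-- An opening pair after a closing one is a cut, so closing pairs propagate up to the next cut.
Hence a stretch without cuts is an opening funnel followed by a closing funnel. -/
lemma Closing.not_cut_next {H : ℕ → ℝ} {f : ℕ} (h : Closing H f) (hc : ¬ Cut H (f + 1)) :
    Closing H (f + 1) := by
  rcases closing_or_opening_or_sameSign H (f + 1) with h1 | h1 | h1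
  · exact h1
  · exact absurd (Or.inr ⟨h1, by omega, by simpa using h⟩) hc
  · exact absurd (Or.inl h1) hc

/-- In a closing funnel all heights stay between those of the first arc. -/
lemma closing_bounded {H : ℕ → ℝ} {r : ℕ} : ∀ d e, r = e + 1 + d →
    (∀ f, e ≤ f → f + 2 ≤ r → Closing H f) → ∀ k, e ≤ k → k ≤ r →
    min (H e) (H (e + 1)) ≤ H k ∧ H k ≤ max (H e) (H (e + 1)) := by
  intro d
  induction d with
  | zero =>
    intro e hr _ k hk hkr
    obtain rfl | rfl : k = e ∨ k = e + 1 := by omega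
    · simp
    · simp
  | succ d ih =>
    intro e hr hC k hk hkr
    rcases eq_or_lt_of_le hk with rfl | hk'
    · simp
    have h1 := ih (e + 1) (by omega) (fun f hf hfr => hC f (by omega) hfr) k hk' hkr
    have h2 := hC e le_rfl (by omega)
    rw [show e + 1 + 1 = e + 2 from rfl] at h1
    unfold Closing at h2
    rcases h2 with h2 | h2
    · rw [min_eq_right h2.2.1.le, max_eq_left h2.2.1.le] at h1
      rw [min_eq_left h2.1.le, max_eq_right h2.1.le]
      exact ⟨by linarith, h1.2⟩
    · rw [min_eq_left h2.2.1.le, max_eq_right h2.2.1.le] at h1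
      rw [min_eq_right h2.1.le, max_eq_left h2.1.le]
      exact ⟨h1.1, by linarith⟩
end ElectricCar

/-! ### Short-Shortcuts: the contractions it records and the number of arcs it saves. -/

namespace ElectricCar
variable {n : ℕ}

lemma le_rangeMax {p : Fin n → Prop} {k : Fin n → EReal} (a : Fin n) (ha : p a) :
    k a ≤ rangeMax p k := le_iSup₂_of_le a ha le_rfl

lemma iSup_ne_top {ι : Type*} [Finite ι] {f : ι → EReal} (h : ∀ i, f i ≠ ⊤) : ⨆ i, f i ≠ ⊤ := by
  rcases isEmpty_or_nonempty ι with hι | hι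
  · simp
  · obtain ⟨i, hi⟩ := exists_eq_ciSup_of_finite (f := f)
    rw [← hi]
    exact h i

lemma iSup_prop_ne_top {p : Prop} {a : EReal} (h : p → a ≠ ⊤) : (⨆ _ : p, a) ≠ ⊤ := by
  by_cases hp : p
  · simpa [hp] using h hp
  · simp [hp]

lemma max_ne_top {a b : EReal} (ha : a ≠ ⊤) (hb : b ≠ ⊤) : max a b ≠ ⊤ := by
  rcases max_choice a b with h | h <;> rw [h] <;> assumption

lemma rangeMax_ne_top {p : Fin n → Prop} {k : Fin n → EReal} (h : ∀ a, p a → k a ≠ ⊤) :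
    rangeMax p k ≠ ⊤ := iSup_ne_top fun a => iSup_prop_ne_top (h a)

lemma joinGain_ne_top (B : ℝ) {p q : EReal} (hp : p ≠ ⊤) (hq : q ≠ ⊤) : joinGain B p q ≠ ⊤ := by
  unfold joinGain
  split_ifs
  · exact EReal.add_ne_top hp hq
  · refine EReal.add_ne_top ?_ ?_ <;> exact ne_top_of_le_ne_top EReal.zero_ne_top (min_le_right _ _)
  · exact bot_ne_top

lemma twoShortcuts_ne_top (B : ℝ) {M : Table n} (hM : ∀ x y, M x y ≠ ⊤) (x z : Fin n) :
    twoShortcuts B M x z ≠ ⊤ := iSup_ne_top fun y => joinGain_ne_top B (hM x y) (hM y z)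

lemma hardThree_ne_top (B : ℝ) {M : Table n} (hM : ∀ x y, M x y ≠ ⊤) (x y z : Fin n) :
    hardThree B M x y z ≠ ⊤ := by
  have hadd : ∀ a, M y a + M a z ≠ ⊤ := fun a => EReal.add_ne_top (hM y a) (hM a z)
  unfold hardThree
  simp only
  refine max_ne_top ?_ ?_
  · split_ifs
    · exact EReal.add_ne_top (hM x y) (rangeMax_ne_top fun a _ => hadd a)
    · exact bot_ne_top
  · split_ifs
    · refine max_ne_top ?_ (max_ne_top ?_ ?_)
      · exact EReal.add_ne_top (hM x y) (rangeMax_ne_top fun a _ => hadd a)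
      · exact hM x y
      · exact ne_top_of_le_ne_top (hM x y) (min_le_left _ _)
    · refine max_ne_top ?_ (max_ne_top ?_ ?_)
      · exact EReal.add_ne_top (hM x y) (rangeMax_ne_top fun a _ => hadd a)
      · exact bot_ne_top
      · exact ne_top_of_le_ne_top (hM x y) (min_le_left _ _)
    · refine max_ne_top ?_ (max_ne_top ?_ ?_)
      · exact bot_ne_top
      · exact hM x y
      · exact ne_top_of_le_ne_top (hM x y) (min_le_left _ _)
    · refine max_ne_top ?_ (max_ne_top ?_ ?_)
      · exact bot_ne_top
      · exact bot_ne_top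
      · exact ne_top_of_le_ne_top (hM x y) (min_le_left _ _)
    · exact bot_ne_top

lemma shortShortcuts_ne_top (B : ℝ) {M : Table n} (hM : ∀ x y, M x y ≠ ⊤) : ∀ x z,
    shortShortcuts B M x z ≠ ⊤ := by
  intro x z
  refine max_ne_top (max_ne_top (max_ne_top (hM x z) (twoShortcuts_ne_top B hM x z)) ?_)
    (iSup_ne_top fun y => hardThree_ne_top B hM x y z)
  exact iSup_ne_top fun y => joinGain_ne_top B (hM x y) (twoShortcuts_ne_top B hM y z)

lemma le_shortShortcuts (B : ℝ) (M : Table n) : M ≤ shortShortcuts B M := fun _ _ =>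
  le_max_of_le_left (le_max_of_le_left (le_max_left _ _))

lemma joinGain_le_short (B : ℝ) (M : Table n) (x y z : Fin n) :
    joinGain B (M x y) (M y z) ≤ shortShortcuts B M x z :=
  le_max_of_le_left (le_max_of_le_left (le_max_of_le_right
    (le_iSup (fun y => joinGain B (M x y) (M y z)) y)))

lemma hardThree_le_short (B : ℝ) (M : Table n) (x y z : Fin n) :
    hardThree B M x y z ≤ shortShortcuts B M x z :=
  le_max_of_le_right (le_iSup (fun y => hardThree B M x y z) y)

section Reals
variable {B : ℝ} {M : Table n} {x y a z : Fin n} {p q m : ℝ}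

lemma short_pair_sum (hp : M x y = (p : EReal)) (hq : M y z = (q : EReal))
    (h : (0 ≤ p ∧ 0 ≤ q) ∨ (p ≤ 0 ∧ q ≤ 0 ∧ -B ≤ p + q)) :
    ((p + q : ℝ) : EReal) ≤ shortShortcuts B M x z := by
  refine le_trans ?_ (joinGain_le_short B M x y z)
  rw [hp, hq]
  unfold joinGain
  by_cases h0 : 0 ≤ p ∧ 0 ≤ q
  · rw [if_pos (by exact_mod_cast h0)]
    exact le_of_eq (by push_cast; rfl)
  · rw [if_neg (by exact_mod_cast h0)]
    obtain ⟨h1, h2, h3⟩ := h.resolve_left h0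
    rw [min_eq_left (by exact_mod_cast h1), min_eq_left (by exact_mod_cast h2),
      if_pos (by exact_mod_cast h3)]
    exact le_of_eq (by push_cast; rfl)

lemma short_pair_second (hp : M x y = (p : EReal)) (hq : M y z = (q : EReal))
    (h0 : 0 ≤ p) (h1 : q < 0) (h2 : -B ≤ q) : (q : EReal) ≤ shortShortcuts B M x z := by
  refine le_trans ?_ (joinGain_le_short B M x y z)
  rw [hp, hq]
  unfold joinGain
  rw [if_neg (by norm_cast; intro h; linarith [h.2]), min_eq_right (by exact_mod_cast h0),
    min_eq_left (by exact_mod_cast h1.le), zero_add, if_pos (by exact_mod_cast h2)]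

lemma short_pair_first (hp : M x y = (p : EReal)) (hq : M y z = (q : EReal))
    (h0 : p < 0) (h1 : 0 ≤ q) (h2 : -B ≤ p) : (p : EReal) ≤ shortShortcuts B M x z := by
  refine le_trans ?_ (joinGain_le_short B M x y z)
  rw [hp, hq]
  unfold joinGain
  rw [if_neg (by norm_cast; intro h; linarith [h.1]), min_eq_left (by exact_mod_cast h0.le),
    min_eq_right (by exact_mod_cast h1), add_zero, if_pos (by exact_mod_cast h2)]

lemma short_triple_up (hm : M x y = (m : EReal)) (hp : M y a = (p : EReal))
    (hq : M a z = (q : EReal)) (h0 : 0 ≤ m) (h1 : -m ≤ p) (h2 : p ≤ 0) (h3 : 0 ≤ p + q) :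
    ((m + (p + q) : ℝ) : EReal) ≤ shortShortcuts B M x z := by
  refine le_trans ?_ (hardThree_le_short B M x y z)
  have hk : ((p + q : ℝ) : EReal) ≤
      rangeMax (fun a => -M x y ≤ M y a ∧ M y a ≤ 0) (fun a => M y a + M a z) := by
    refine le_trans (le_of_eq ?_) (le_rangeMax a ?_)
    · rw [hp, hq]; push_cast; rfl
    · rw [hm, hp]; exact ⟨by exact_mod_cast h1, by exact_mod_cast h2⟩
  unfold hardThree
  simp only
  refine le_max_of_le_left ?_
  have h5 : (m : EReal) + ((p + q : ℝ) : EReal) ≤ M x y +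
      rangeMax (fun a => -M x y ≤ M y a ∧ M y a ≤ 0) (fun a => M y a + M a z) := by
    rw [← hm]
    gcongr
  rw [if_pos ⟨by rw [hm]; exact_mod_cast h0, le_trans (by rw [hm]; norm_cast; linarith) h5⟩]
  refine le_trans (le_of_eq ?_) h5
  push_cast; rfl

/-- The range query may return more than `p + q`, in which case the entry is capped at `m`. A bound
`s` below both values covers either branch. -/
lemma short_triple_down (hm : M x y = (m : EReal)) (hp : M y a = (p : EReal))
    (hq : M a z = (q : EReal)) (h0 : m ≤ 0) (h1 : 0 ≤ p) (h2 : p ≤ -m) {s : ℝ} (hs : s ≤ m)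
    (hs' : s ≤ m + (p + q)) (hB : -B ≤ s) :
    (s : EReal) ≤ shortShortcuts B M x z := by
  refine le_trans ?_ (hardThree_le_short B M x y z)
  have hk : ((p + q : ℝ) : EReal) ≤
      rangeMax (fun a => 0 ≤ M y a ∧ M y a ≤ eabs (M x y)) (fun a => M y a + M a z) := by
    refine le_trans (le_of_eq ?_) (le_rangeMax a ?_)
    · rw [hp, hq]; push_cast; rfl
    · rw [hm, hp]
      refine ⟨by exact_mod_cast h1, le_max_of_le_right ?_⟩
      exact_mod_cast h2
  unfold hardThree
  simp only
  refine le_max_of_le_right ?_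
  have h5 : (s : EReal) ≤ M x y +
      rangeMax (fun a => 0 ≤ M y a ∧ M y a ≤ eabs (M x y)) (fun a => M y a + M a z) := by
    refine le_trans (b := (m : EReal) + ((p + q : ℝ) : EReal)) (by exact_mod_cast hs') ?_
    rw [← hm]
    gcongr
  rw [if_pos (by rw [hm]; exact_mod_cast h0)]
  rcases le_total (M x y + rangeMax (fun a => 0 ≤ M y a ∧ M y a ≤ eabs (M x y))
    (fun a => M y a + M a z)) (M x y) with h | h
  · refine le_max_of_le_left ?_
    rw [if_pos ⟨h, le_trans (by exact_mod_cast hB) h5⟩]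
    exact h5
  · refine le_max_of_le_right (le_max_of_le_left ?_)
    rw [if_pos h, hm]
    exact_mod_cast hs

lemma short_triple_min (hm : M x y = (m : EReal)) (hp : M y a = (p : EReal))
    (hq : M a z = (q : EReal)) (h0 : m ≤ 0) (h1 : -m ≤ p) {s : ℝ} (hs : s ≤ m) (hs' : s ≤ q) :
    (s : EReal) ≤ shortShortcuts B M x z := by
  refine le_trans ?_ (hardThree_le_short B M x y z)
  unfold hardThree
  simp only
  refine le_max_of_le_right ?_
  rw [if_pos (by rw [hm]; exact_mod_cast h0)]
  refine le_max_of_le_right (le_max_of_le_right (le_min (by rw [hm]; exact_mod_cast hs) ?_))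
  refine le_trans (b := M a z) (by rw [hq]; exact_mod_cast hs')
    (le_rangeMax (p := fun a => eabs (M x y) ≤ M y a) (k := fun a => M a z) a ?_)
  rw [hm, hp]
  refine max_le ?_ (by exact_mod_cast h1)
  exact_mod_cast (show m ≤ p by linarith)

end Reals

section Tracked
variable {B : ℝ} {asc : Bool} {τ : ℝ} {x y : Fin n} {M M' : Table n} {l : ℕ}
  {v : ℕ → Fin n} {H : ℕ → ℝ}

lemma IsTracked.coe_le (h : IsTracked B asc τ x y M l v H) (hle : M ≤ M') {a : ℕ} (ha : a < l) :
    ((H (a + 1) - H a : ℝ) : EReal) ≤ M' (v a) (v (a + 1)) := by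
  rw [← h.exact a ha]; exact hle _ _

/-- Contractions that lose no gain. -/
lemma IsTracked.hasPath_of_cover (h : IsTracked B asc τ x y M l v H)
    (hM' : ∀ x y, M' x y ≠ ⊤) (hle : M ≤ M') (D : Finset ℕ)
    (hD : ∀ d ∈ D, ∃ a b, a ≤ d ∧ d < b ∧ a + 2 ≤ b ∧ b ≤ l ∧
      ((H b - H a : ℝ) : EReal) ≤ M' (v a) (v b)) :
    ∃ k, HasPath B asc τ x y M' k ∧ 6 * k + D.card ≤ 6 * l := by
  obtain ⟨k, φ, h0, hk, hφ, hc⟩ := exists_chain_of_cover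
    (fun a b => ((H b - H a : ℝ) : EReal) ≤ M' (v a) (v b)) l (fun a ha => h.coe_le hle ha) D hD
  exact ⟨k, hasPath_of_chain hM' h.source h.target h.inj h.adm h0 hk hφ, hc⟩

/-- For descending targets only drops matter, so the arcs up to `b` may be replaced by one whose
gain is merely that of the piece from `c` to `b`: the new heights start at `H c`, and each drop
along them is a drop of the old path. -/
lemma IsTracked.hasPath_lossy_start (h : IsTracked B false τ x y M l v H)
    (hM' : ∀ x y, M' x y ≠ ⊤) (hle : M ≤ M') {b c : ℕ} (hcb : c ≤ b) (hb : b ≤ l) (hb1 : 1 ≤ b)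
    (hv : ((H b - H c : ℝ) : EReal) ≤ M' (v 0) (v b)) :
    HasPath B false τ x y M' (l + 1 - b) := by
  have hτ := (h.adm.2.2 rfl).2
  set w : ℕ → Fin n := fun i => if i = 0 then v 0 else v (i + b - 1) with hw
  set h' : ℕ → ℝ := fun i => if i = 0 then H c else H (i + b - 1) with hh'
  refine hasPath_of_chain (l := l + 1 - b) (v := w) (h := h') (φ := id) hM' (by simp [hw, h.source])
    ?_ ?_ ⟨?_, by simp, fun _ => ⟨(h.adm.2.2 rfl).1, ?_⟩⟩ rfl rfl ?_
  · simp only [hw]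
    rw [if_neg (by omega), show l + 1 - b + b - 1 = l by omega, h.target]
  · intro i hi j hj hij
    simp only [Set.mem_Iic] at hi hj
    simp only [hw] at hij
    split_ifs at hij with h1 h2 h2
    · omega
    · have := h.inj (show 0 ∈ Set.Iic l by simp) (show j + b - 1 ∈ Set.Iic l by
        simp only [Set.mem_Iic]; omega) hij
      omega
    · have := h.inj (show i + b - 1 ∈ Set.Iic l by simp only [Set.mem_Iic]; omega)
        (show 0 ∈ Set.Iic l by simp) hij
      omega
    · have := h.inj (show i + b - 1 ∈ Set.Iic l by simp only [Set.mem_Iic]; omega)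
        (show j + b - 1 ∈ Set.Iic l by simp only [Set.mem_Iic]; omega) hij
      omega
  · intro i j hij hj
    simp only [hh']
    split_ifs with h1 h2 h2
    · exact h.adm.1 c c le_rfl (by omega)
    · omega
    · exact h.adm.1 _ _ (by omega) (by omega)
    · exact h.adm.1 _ _ (by omega) (by omega)
  · intro i j hij hj
    simp only [hh']
    split_ifs with h1 h2 h2
    · exact hτ c c le_rfl (by omega)
    · omega
    · exact hτ _ _ (by omega) (by omega)
    · exact hτ _ _ (by omega) (by omega)
  · intro i hi
    refine ⟨by simp, ?_⟩
    simp only [id, hw, hh', Nat.succ_ne_zero, if_false]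
    rw [show i + 1 + b - 1 = i + b by omega]
    split_ifs with h1
    · subst h1; simpa using hv
    · have := h.coe_le hle (a := i + b - 1) (by omega)
      rwa [show i + b - 1 + 1 = i + b by omega] at this

lemma IsTracked.hasPath_lossy_end (h : IsTracked B false τ x y M l v H)
    (hM' : ∀ x y, M' x y ≠ ⊤) (hle : M ≤ M') {a c : ℕ} (hac : a ≤ c) (hc : c ≤ l) (ha : a < l)
    (hv : ((H c - H a : ℝ) : EReal) ≤ M' (v a) (v l)) :
    HasPath B false τ x y M' (a + 1) := by
  have hτ := (h.adm.2.2 rfl).2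
  set w : ℕ → Fin n := fun i => if i ≤ a then v i else v l with hw
  set h' : ℕ → ℝ := fun i => if i ≤ a then H i else H c with hh'
  refine hasPath_of_chain (l := a + 1) (v := w) (h := h') (φ := id) hM' (by simp [hw, h.source])
    (by simp [hw, h.target]) ?_ ⟨?_, by simp, fun _ => ⟨(h.adm.2.2 rfl).1, ?_⟩⟩ rfl rfl ?_
  · intro i hi j hj hij
    simp only [Set.mem_Iic] at hi hj
    simp only [hw] at hij
    split_ifs at hij with h1 h2 h2
    · exact h.inj (show i ∈ Set.Iic l by simp only [Set.mem_Iic]; omega)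
        (show j ∈ Set.Iic l by simp only [Set.mem_Iic]; omega) hij
    · have := h.inj (show i ∈ Set.Iic l by simp only [Set.mem_Iic]; omega)
        (show l ∈ Set.Iic l by simp) hij
      omega
    · have := h.inj (show l ∈ Set.Iic l by simp)
        (show j ∈ Set.Iic l by simp only [Set.mem_Iic]; omega) hij
      omega
    · omega
  · intro i j hij hj
    simp only [hh']
    split_ifs with h1 h2 h2
    · exact h.adm.1 _ _ hij (by omega)
    · omega
    · exact h.adm.1 _ _ (by omega) (by omega)
    · exact h.adm.1 _ _ le_rfl (by omega)
  · intro i j hij hj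
    simp only [hh']
    split_ifs with h1 h2 h2
    · exact hτ _ _ hij (by omega)
    · omega
    · exact hτ _ _ (by omega) (by omega)
    · exact hτ _ _ le_rfl (by omega)
  · intro i hi
    refine ⟨by simp, ?_⟩
    simp only [id, hw, hh']
    have hia : i ≤ a := by omega
    by_cases h1 : i + 1 ≤ a
    · simp only [hia, h1, if_true]
      exact h.coe_le hle (by omega)
    · obtain rfl : i = a := by omega
      simp only [le_refl, h1, if_true, if_false]
      exact hv

lemma IsTracked.sameSign_jump (h : IsTracked B asc τ x y M l v H) {f : ℕ} (hf : f + 2 ≤ l)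
    (hs : SameSign H f) :
    ((H (f + 2) - H f : ℝ) : EReal) ≤ shortShortcuts B M (v f) (v (f + 2)) := by
  have := short_pair_sum (B := B) (h.exact f (by omega)) (h.exact (f + 1) (by omega)) (by
    have hB := h.adm.1 f (f + 2) (by omega) hf
    rcases hs with hs | hs
    · left; constructor <;> linarith [hs.1, hs.2]
    · right; refine ⟨by linarith [hs.1], by linarith [hs.2], by linarith⟩)
  refine le_trans (le_of_eq ?_) this
  congr 1; ring

/-- The middle arc is the smallest of the three, so the extreme heights are at the ends and the hard
3-shortcut records the full gain. Up-down-up and down-up-down are the two cases. -/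
lemma IsTracked.localMin_jump (h : IsTracked B asc τ x y M l v H) {e : ℕ} (hf : e + 3 ≤ l)
    (hcl : Closing H e) (ho : WeakOpening H (e + 1)) :
    ((H (e + 3) - H e : ℝ) : EReal) ≤ shortShortcuts B M (v e) (v (e + 3)) := by
  have e1 := h.exact e (by omega)
  have e2 := h.exact (e + 1) (by omega)
  have e3 := h.exact (e + 2) (by omega)
  have hB := h.adm.1 e (e + 3) (by omega) hf
  unfold WeakOpening at ho
  unfold Closing at hcl
  simp only [add_assoc] at ho e2 e3
  norm_num at ho e2 e3
  rcases hcl with hcl | hcl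
  · have := short_triple_up (B := B) e1 e2 e3 (by linarith) (by linarith) (by linarith)
      (by rcases ho with ho | ho <;> linarith)
    refine le_trans (le_of_eq ?_) this
    congr 1; ring
  · refine short_triple_down (B := B) e1 e2 e3 (by linarith) (by linarith) (by linarith) ?_ ?_ hB
    · rcases ho with ho | ho <;> linarith
    · linarith

/-- Every cut can be contracted by Short-Shortcuts. -/
lemma IsTracked.cut_jump (h : IsTracked B asc τ x y M l v H) {f : ℕ} (hf : f + 2 ≤ l)
    (hc : Cut H f) : ∃ a b, a ≤ f ∧ f < b ∧ a + 2 ≤ b ∧ b ≤ l ∧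
      ((H b - H a : ℝ) : EReal) ≤ shortShortcuts B M (v a) (v b) := by
  rcases hc with hs | ⟨ho, hf1, hcl⟩
  · exact ⟨f, f + 2, le_rfl, by omega, le_rfl, hf, h.sameSign_jump hf hs⟩
  · obtain ⟨e, rfl⟩ : ∃ e, f = e + 1 := ⟨f - 1, by omega⟩
    rw [Nat.add_sub_cancel] at hcl
    exact ⟨e, e + 3, by omega, by omega, by omega, hf, h.localMin_jump hf hcl ho.weak⟩

open Classical in
/-- All cuts of a path with `l` arcs. -/
noncomputable def cuts (H : ℕ → ℝ) (l : ℕ) : Finset ℕ := (Finset.range (l - 1)).filter (Cut H)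

lemma IsTracked.short_of_cuts (h : IsTracked B asc τ x y M l v H) (hM : ∀ x y, M x y ≠ ⊤) :
    ∃ k, HasPath B asc τ x y (shortShortcuts B M) k ∧ 6 * k + (cuts H l).card ≤ 6 * l :=
  h.hasPath_of_cover (shortShortcuts_ne_top B hM) (le_shortShortcuts B M) _
    fun f hf => by
      simp only [cuts, Finset.mem_filter, Finset.mem_range] at hf
      exact h.cut_jump (by omega) hf.2

/-- No symmetry of Short-Shortcuts is needed: a cut of the reversed path is a same-sign pair or a
local minimum of the path itself. Reversal turns `Closing` into `WeakOpening` and `Opening` into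
`Closing`. -/
lemma IsTracked.short_of_cuts_tr (h : IsTracked B asc τ x y M l v H) (hM : ∀ x y, M x y ≠ ⊤) :
    ∃ k, HasPath B asc τ x y (shortShortcuts B M) k ∧
      6 * k + (cuts (fun i => -H (l - i)) l).card ≤ 6 * l := by
  classical
  obtain ⟨k, hk, hc⟩ := h.hasPath_of_cover (shortShortcuts_ne_top B hM) (le_shortShortcuts B M)
    ((cuts (fun i => -H (l - i)) l).image fun f => l - 2 - f) (by
      intro d hd
      obtain ⟨f, hf, rfl⟩ := Finset.mem_image.1 hd
      simp only [cuts, Finset.mem_filter, Finset.mem_range] at hf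
      obtain ⟨hfl, hcut⟩ := hf
      obtain ⟨g, rfl⟩ : ∃ g, l = g + 2 + f := ⟨l - 2 - f, by omega⟩
      rw [show g + 2 + f - 2 - f = g by omega]
      rcases hcut with hs | ⟨ho, hf1, hcl⟩
      · refine ⟨g, g + 2, le_rfl, by omega, le_rfl, by omega, h.sameSign_jump (by omega) ?_⟩
        unfold SameSign at hs
        beta_reduce at hs
        rw [show g + 2 + f - f = g + 2 by omega, show g + 2 + f - (f + 1) = g + 1 by omega,
          show g + 2 + f - (f + 2) = g by omega] at hs
        unfold SameSign
        rcases hs with hs | hs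
        · left; constructor <;> linarith [hs.1, hs.2]
        · right; constructor <;> linarith [hs.1, hs.2]
      · obtain ⟨e, rfl⟩ : ∃ e, f = e + 1 := ⟨f - 1, by omega⟩
        refine ⟨g, g + 3, le_rfl, by omega, by omega, by omega, h.localMin_jump (by omega) ?_ ?_⟩
        · unfold Opening at ho
          beta_reduce at ho
          rw [show g + 2 + (e + 1) - (e + 1) = g + 2 by omega,
            show g + 2 + (e + 1) - (e + 1 + 1) = g + 1 by omega,
            show g + 2 + (e + 1) - (e + 1 + 2) = g by omega] at ho
          unfold Closing
          rcases ho with ho | ho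
          · right; refine ⟨?_, ?_, ?_⟩ <;> linarith [ho.1, ho.2]
          · left; refine ⟨?_, ?_, ?_⟩ <;> linarith [ho.1, ho.2]
        · rw [Nat.add_sub_cancel] at hcl
          unfold Closing at hcl
          beta_reduce at hcl
          rw [show g + 2 + (e + 1) - e = g + 1 + 2 by omega,
            show g + 2 + (e + 1) - (e + 1) = g + 1 + 1 by omega,
            show g + 2 + (e + 1) - (e + 2) = g + 1 by omega] at hcl
          unfold WeakOpening
          rcases hcl with hcl | hcl
          · right; refine ⟨?_, ?_⟩ <;> linarith [hcl.1, hcl.2.1, hcl.2.2]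
          · left; refine ⟨?_, ?_⟩ <;> linarith [hcl.1, hcl.2.1, hcl.2.2])
  rw [Finset.card_image_of_injOn] at hc
  · exact ⟨k, hk, hc⟩
  · intro a ha b hb hab
    simp only [cuts, Finset.coe_filter, Finset.mem_range, Set.mem_ofPred_eq] at ha hb
    simp only at hab
    omega

lemma IsTracked.short_of_jump (h : IsTracked B asc τ x y M l v H) (hM : ∀ x y, M x y ≠ ⊤)
    {a b : ℕ} (hab : a + 2 ≤ b) (hb : b ≤ l)
    (hg : ((H b - H a : ℝ) : EReal) ≤ shortShortcuts B M (v a) (v b)) :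
    HasPath B asc τ x y (shortShortcuts B M) (l - 1) := by
  obtain ⟨k, hk, hc⟩ := h.hasPath_of_cover (shortShortcuts_ne_top B hM) (le_shortShortcuts B M) {a}
    (fun d hd => ⟨a, b, by simp only [Finset.mem_singleton] at hd; omega,
      by simp only [Finset.mem_singleton] at hd; omega, hab, hb, hg⟩)
  simp only [Finset.card_singleton] at hc
  exact hk.mono_length (by omega)

/-- Short-Shortcuts shortens every path with at least two arcs. -/
lemma IsTracked.short_save_one (h : IsTracked B asc τ x y M l v H) (hM : ∀ x y, M x y ≠ ⊤)
    (hl : 2 ≤ l) : HasPath B asc τ x y (shortShortcuts B M) (l - 1) := by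
  have hN := shortShortcuts_ne_top B hM
  have hle := le_shortShortcuts B M
  by_cases hcut : ∃ f, f + 2 ≤ l ∧ Cut H f
  · obtain ⟨f, hf, hc⟩ := hcut
    obtain ⟨a, b, -, -, h1, h2, h3⟩ := h.cut_jump hf hc
    exact h.short_of_jump hM h1 h2 h3
  -- Without cuts the path consists of an opening funnel followed by a closing funnel.
  push Not at hcut
  have hss : ∀ f, f + 2 ≤ l → ¬ SameSign H f := fun f hf hs => hcut f hf (Or.inl hs)
  have hcl : ∀ e, Closing H e → ∀ f, e ≤ f → f + 2 ≤ l → Closing H f := by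
    intro e he f hef
    induction f, hef using Nat.le_induction with
    | base => exact fun _ => he
    | succ f hef ih => exact fun hf => (ih (by omega)).not_cut_next (hcut _ hf)
  have hco : ∀ f, f + 2 ≤ l → Closing H f ∨ Opening H f := by
    intro f hf
    rcases closing_or_opening_or_sameSign H f with h | h | h
    · exact Or.inl h
    · exact Or.inr h
    · exact absurd h (hss f hf)
  obtain ⟨e, rfl⟩ : ∃ e, l = e + 2 := ⟨l - 2, by omega⟩
  cases asc with
  | true =>
    obtain ⟨hA, -⟩ := h.adm.2.1 rfl
    -- The start is lowest, so the first pair cannot open, and the whole path is a closing funnel.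
    -- Since the end is highest, the last three arcs go up, down, up, and contracting them loses
    -- nothing.
    have c0 : Closing H 0 := by
      refine (hco 0 (by omega)).resolve_right ?_
      have h1 := hA 1 (by omega)
      have h2 := hA 2 (by omega)
      rintro (h | h) <;> norm_num at h <;> linarith [h.1, h.2]
    have ce := hcl 0 c0 e (by omega) le_rfl
    have hA1 := hA (e + 1) (by omega)
    have hA0 := hA e (by omega)
    rcases ce with ce | ce
    · linarith [ce.2.1]
    obtain ⟨d, rfl⟩ : ∃ d, e = d + 1 := by
      refine ⟨e - 1, ?_⟩
      rcases Nat.eq_zero_or_pos e with rfl | he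
      · linarith [hA1.1, ce.1]
      · omega
    have cd := hcl 0 c0 d (by omega) (by omega)
    simp only [add_assoc] at *
    norm_num at *
    rcases cd with cd | cd
    · refine h.short_of_jump hM (a := d) (b := d + 3) (by omega) le_rfl ?_
      have := short_triple_up (B := B) (h.exact d (by omega)) (h.exact (d + 1) (by omega))
        (h.exact (d + 2) (by omega)) (by linarith) (by simp only [add_assoc]; norm_num; linarith)
        (by simp only [add_assoc]; norm_num; linarith) (by simp only [add_assoc]; norm_num; linarith)
      refine le_trans (le_of_eq ?_) this
      congr 1
      simp only [add_assoc]; norm_num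
    · linarith [cd.2.1, ce.1]
  | false =>
    have hB := h.adm.1
    -- An ascending arc at either end can be absorbed by its neighbour, since losing its gain does
    -- no harm. After these two cases both end arcs descend.
    by_cases hfirst : H 0 ≤ H 1
    · have h2 : H 2 < H 1 := by
        by_contra hcon
        exact hss 0 (by omega) (Or.inl ⟨hfirst, not_lt.1 hcon⟩)
      have := h.hasPath_lossy_start hN hle (b := 2) (c := 1) (by omega) hl (by omega)
        (short_pair_second (h.exact 0 (by omega)) (h.exact 1 (by omega)) (by simpa using hfirst)
          (by simpa using h2) (hB 1 2 (by omega) (by omega)))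
      exact this.mono_length (by omega)
    push Not at hfirst
    by_cases hlast : H (e + 1) ≤ H (e + 2)
    · have h2 : H (e + 1) < H e := by
        by_contra hcon
        exact hss e (by omega) (Or.inl ⟨not_lt.1 hcon, hlast⟩)
      have := h.hasPath_lossy_end hN hle (a := e) (c := e + 1) (by omega) (by omega) (by omega)
        (short_pair_first (h.exact e (by omega)) (h.exact (e + 1) (by omega)) (by linarith)
          (by simpa using hlast) (hB e (e + 1) (by omega) (by omega)))
      exact this.mono_length (by omega)
    push Not at hlast
    have he1 : 1 ≤ e := by
      by_contra hcon
      obtain rfl : e = 0 := by omega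
      exact hss 0 (by omega) (Or.inr ⟨hfirst.le, hlast.le⟩)
    -- Down-up-down at the start, where the third arc loses at least as much as the first: the three
    -- arcs are replaced by one with the gain of the third.
    have startTriple : Opening H 0 → H 3 - H 2 ≤ H 1 - H 0 →
        HasPath B false τ x y (shortShortcuts B M) (e + 2 - 1) := by
      intro ho hg
      have ho' : H 0 < H 2 := by
        rcases ho with ho | ho
        · norm_num at ho; linarith [ho.1]
        · exact ho.2
      have := h.hasPath_lossy_start hN hle (b := 3) (c := 2) (by omega) (by omega) (by omega)
        (short_triple_min (h.exact 0 (by omega)) (h.exact 1 (by omega)) (h.exact 2 (by omega))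
          (by norm_num; linarith) (by norm_num; linarith) (by norm_num; linarith) (by norm_num))
      exact this.mono_length (by omega)
    have openingTwo : Opening H 0 → Opening H 1 → H 3 - H 2 ≤ H 1 - H 0 := by
      intro h0 h1
      unfold Opening at h0 h1
      norm_num at h0 h1
      rcases h0 with h0 | h0
      · linarith [h0.1]
      · rcases h1 with h1 | h1
        · linarith [h1.2]
        · linarith [h1.1, h0.2]
    have opening_back : ∀ f, f + 2 ≤ e + 2 → Opening H f → ∀ g, g ≤ f → Opening H g := by
      intro f hf ho g hg
      refine (hco g (by omega)).resolve_left fun hc => ?_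
      have := hcl g hc f hg hf
      unfold Closing at this
      unfold Opening at ho
      rcases this with h1 | h1 <;> rcases ho with h2 | h2 <;> linarith [h1.1, h1.2.1, h1.2.2, h2.1, h2.2]
    obtain ⟨d, rfl⟩ : ∃ d, e = d + 1 := ⟨e - 1, by omega⟩
    simp only [add_assoc] at hlast
    norm_num at hlast
    have e1 := h.exact d (by omega)
    have e2 := h.exact (d + 1) (by omega)
    have e3 := h.exact (d + 2) (by omega)
    simp only [add_assoc] at e2 e3
    norm_num at e2 e3
    -- If the last two pairs close, the end triple collapses to its first arc. Otherwise the path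
    -- opens from its start: if the first two pairs open, the third arc loses more than the first,
    -- and if there are only three arcs their two losses are compared.
    rcases hco (d + 1) (by omega) with hc | ho
    · have hc' := hc
      unfold Closing at hc'
      simp only [add_assoc] at hc'
      norm_num at hc'
      have hc'' : H (d + 1) < H (d + 2) ∧ H (d + 1) ≤ H (d + 3) := by
        rcases hc' with h1 | h1
        · exact ⟨h1.1, h1.2.2⟩
        · linarith [h1.2.1]
      have hd : H (d + 1) < H d := by
        by_contra hcon
        exact hss d (by omega) (Or.inl ⟨not_lt.1 hcon, hc''.1.le⟩)
      have hBd := hB d (d + 1) (by omega) (by omega)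
      rcases hco d (by omega) with hcd | hod
      · have hcd' : H (d + 2) ≤ H d := by
          rcases hcd with h1 | h1
          · linarith [h1.1]
          · exact h1.2.2
        have := h.hasPath_lossy_end hN hle (a := d) (c := d + 1) (by omega) (by omega) (by omega)
          (short_triple_down e1 e2 e3 (by linarith) (by linarith) (by linarith) le_rfl
            (by linarith) hBd)
        exact this.mono_length (by omega)
      · rcases Nat.eq_zero_or_pos d with rfl | hd0
        · rcases le_total (H 3 - H 2) (H 1 - H 0) with hg | hg
          · exact startTriple hod hg
          · have hod' : H 0 < H 2 := by
              rcases hod with h1 | h1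
              · norm_num at h1; linarith [h1.1]
              · exact h1.2
            norm_num at e1 e2 e3
            have := h.hasPath_lossy_end hN hle (a := 0) (c := 1) (by omega) (by omega) (by omega)
              (short_triple_min (s := H 1 - H 0) e1 e2 e3 (by linarith) (by linarith) le_rfl hg)
            exact this.mono_length (by omega)
        · exact startTriple (opening_back d (by omega) hod 0 (by omega))
            (openingTwo (opening_back d (by omega) hod 0 (by omega))
              (opening_back d (by omega) hod 1 (by omega)))
    · exact startTriple (opening_back _ (by omega) ho 0 (by omega))
        (openingTwo (opening_back _ (by omega) ho 0 (by omega))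
          (opening_back _ (by omega) ho 1 (by omega)))

end Tracked
end ElectricCar

namespace ElectricCar
variable {n : ℕ}

/-! ### The data structure: duality, invariants and monotonicity -/

/-- The data structure of the reversed graph. -/
def DS.dual (D : DS n) : DS n where
  sc := fun x y => D.sc y x
  fst := fun x y z => D.lst z y x
  lst := fun x y z => D.fst z y x

/-- Gains of arc-bounded paths lie in the range of the bounding arc. -/
def DS.FstSound (M : Table n) (D : DS n) : Prop :=
  ∀ u v x, D.fst u v x ≤ max (M u v) 0 ∧ (M u v = ⊥ → D.fst u v x = ⊥)

/-- The last invariant is the previous one on the reversed graph. Facts on entries bounded by their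
last arc thus follow by duality from those on entries bounded by their first arc. -/
structure DS.Sound (M : Table n) (D : DS n) : Prop where
  ne_top : ∀ x y, M x y ≠ ⊤
  sc : D.sc = M
  fst : D.FstSound M
  lst : D.dual.FstSound M.tr

def DS.FstLe (D D' : DS n) : Prop := ∀ u v x, D.fst u v x ≤ D'.fst u v x

/-- Entrywise comparison of the entries for arc-bounded paths. -/
def DS.Le (D D' : DS n) : Prop := D.FstLe D' ∧ D.dual.FstLe D'.dual

lemma DS.Le.refl (D : DS n) : D.Le D := ⟨fun _ _ _ => le_rfl, fun _ _ _ => le_rfl⟩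

lemma DS.Le.trans {D₁ D₂ D₃ : DS n} (h : D₁.Le D₂) (h' : D₂.Le D₃) : D₁.Le D₃ :=
  ⟨fun u v x => (h.1 u v x).trans (h'.1 u v x), fun u v x => (h.2 u v x).trans (h'.2 u v x)⟩

lemma DS.Sound.dual {M : Table n} {D : DS n} (h : D.Sound M) : D.dual.Sound M.tr :=
  ⟨fun x y => h.ne_top y x, by
    funext x y
    simp only [DS.dual, Table.tr, h.sc], h.lst, h.fst⟩

lemma DS.Sound.fst_nonpos {M : Table n} {D : DS n} (h : D.Sound M) {u v x : Fin n}
    (hm : M u v ≤ 0) : D.fst u v x ≤ 0 := (h.fst u v x).1.trans (max_le hm le_rfl)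

lemma DS.Sound.fst_ne_top {M : Table n} {D : DS n} (h : D.Sound M) (u v x : Fin n) :
    D.fst u v x ≠ ⊤ :=
  ne_top_of_le_ne_top (max_ne_top (h.ne_top u v) EReal.zero_ne_top) (h.fst u v x).1

lemma DS.Sound.lst_ne_top {M : Table n} {D : DS n} (h : D.Sound M) (u v x : Fin n) :
    D.lst u v x ≠ ⊤ := h.dual.fst_ne_top x v u

lemma DS.init_dual (M : Table n) : DS.init M.tr = (DS.init M).dual := rfl

lemma DS.init_sound {M : Table n} (hM : ∀ x y, M x y ≠ ⊤) : (DS.init M).Sound M := by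
  have key : ∀ M : Table n, (DS.init M).FstSound M := by
    intro M u v x
    simp only [DS.init]
    split_ifs
    · exact ⟨le_max_left _ _, id⟩
    · exact ⟨bot_le, fun _ => rfl⟩
  exact ⟨hM, rfl, key M, key M.tr⟩

/-- Operations that keep the invariants and never decrease an entry. -/
def IsOp (M : Table n) (f : DS n → DS n) : Prop := ∀ D, D.Sound M → (f D).Sound M ∧ D.Le (f D)

lemma IsOp.iterate {M : Table n} {f : DS n → DS n} (hf : IsOp M f) (k : ℕ) : IsOp M f^[k] := by
  induction k with
  | zero => exact fun D hD => ⟨hD, DS.Le.refl D⟩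
  | succ k ih =>
    intro D hD
    rw [Function.iterate_succ_apply']
    obtain ⟨h1, h2⟩ := ih D hD
    exact ⟨(hf _ h1).1, h2.trans (hf _ h1).2⟩

lemma IsOp.comp {M : Table n} {f g : DS n → DS n} (hf : IsOp M f) (hg : IsOp M g) :
    IsOp M (fun D => g (f D)) := fun D hD =>
  ⟨(hg _ (hf D hD).1).1, (hf D hD).2.trans (hg _ (hf D hD).1).2⟩

lemma add_nonpos_of_le_eabs {d k : EReal} (hd : d ≤ 0) (hk : k ≤ eabs d) : d + k ≤ 0 := by
  induction d with
  | bot => simp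
  | top => simp at hd
  | coe d =>
    have hd' : d ≤ 0 := by exact_mod_cast hd
    have h1 : eabs (d : EReal) = ((-d : ℝ) : EReal) := by
      unfold eabs
      rw [max_eq_right]
      · rfl
      · exact_mod_cast (show d ≤ -d by linarith)
    rw [h1] at hk
    calc (d : EReal) + k ≤ d + ((-d : ℝ) : EReal) := by gcongr
      _ = 0 := by norm_cast; simp

/-! ### Breadth-Search -/

lemma breadthSearch_dual (M : Table n) (D : DS n) :
    breadthSearch M.tr D.dual = (breadthSearch M D).dual := by
  simp only [breadthSearch, DS.dual, Table.tr]
  congr 1 <;> funext x y z <;> rw [add_comm]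

lemma breadthSearch_fstSound {M : Table n} {D : DS n} (hD : D.Sound M) :
    (breadthSearch M D).FstSound M ∧ D.FstLe (breadthSearch M D) := by
  refine ⟨fun x y z => ⟨?_, fun hbot => ?_⟩, fun x y z => le_max_left _ _⟩
  · refine max_le (hD.fst x y z).1 ?_
    by_cases h0 : 0 ≤ M x y
    · rw [max_eq_left h0]
      refine (add_le_add_right (b := rangeMax _ _) (c := 0) ?_ (M x y)).trans (by rw [add_zero])
      exact iSup₂_le fun a ha => hD.fst_nonpos (ha.1 h0).2
    · rw [max_eq_right (not_le.1 h0).le]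
      refine add_nonpos_of_le_eabs (not_le.1 h0).le (iSup₂_le fun a ha => ?_)
      refine (hD.fst y a z).1.trans (max_le (ha.2 h0).2 ((ha.2 h0).1.trans (ha.2 h0).2))
  · simp only [breadthSearch]
    rw [(hD.fst x y z).2 hbot, hbot, EReal.bot_add]
    simp

lemma isOp_breadthSearch (M : Table n) : IsOp M (breadthSearch M) := by
  intro D hD
  have h1 := breadthSearch_fstSound hD
  have h2 := breadthSearch_fstSound hD.dual
  rw [breadthSearch_dual] at h2
  exact ⟨⟨hD.ne_top, hD.sc, h1.1, h2.1⟩, h1.2, h2.2⟩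

/-! ### Concatenate -/

section Steps
open Classical

lemma concatStep_dual (M : Table n) (D₀ D : DS n) (t : Fin n × Fin n × Fin n × Fin n) :
    concatStep M.tr D₀.dual D.dual t = (concatStep M D₀ D t).dual := by
  obtain ⟨u, v, w, x⟩ := t
  by_cases h1 : M u v < 0 <;> by_cases h2 : M v u < 0 <;>
    simp only [concatStep, DS.dual, Table.tr, DS.setFst, DS.setLst, h1, h2, if_true, if_false] <;>
    congr 1 <;> funext a b c <;>
    simp only [and_assoc, and_comm, add_comm]

lemma concatStep_fst (M : Table n) (D₀ D : DS n) (u v w x u' v' x' : Fin n) :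
    (concatStep M D₀ D (u, v, w, x)).fst u' v' x' =
      if M u v < 0 ∧ u' = u ∧ v' = v ∧ x' = x then
        max (D.fst u v x) (D.fst u v w +
          rangeMax (fun a => -(D.fst u v w - M u v) ≤ M w a ∧ M w a ≤ 0)
            (fun a => D₀.fst w a x))
      else D.fst u' v' x' := by
  by_cases h1 : M u v < 0 <;> by_cases h2 : M v u < 0 <;>
    simp [concatStep, DS.setFst, DS.setLst, h1, h2]

lemma concatStep_sc (M : Table n) (D₀ D : DS n) (t : Fin n × Fin n × Fin n × Fin n) :
    (concatStep M D₀ D t).sc = D.sc := by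
  obtain ⟨u, v, w, x⟩ := t
  simp only [concatStep]
  split_ifs <;> rfl

lemma concatOppStep_sc (M : Table n) (D₀ D : DS n) (t : Fin n × Fin n × Fin n × Fin n) :
    (concatOppStep M D₀ D t).sc = D.sc := by
  obtain ⟨u, v, w, x⟩ := t
  simp only [concatOppStep]
  split_ifs <;> rfl

/-- The value written by one step of Concatenate-Opposite before the overwriting. -/
noncomputable def oppValue (M : Table n) (D₀ D : DS n) (u v w x : Fin n) : EReal :=
  max (D.fst u v x) (D.fst u v w +
    rangeMax (fun a => 0 ≤ M a x ∧ M a x - D₀.lst w a x ≤ D.fst u v w - M u v ∧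
      D₀.lst w a x ≤ eabs (D.fst u v w)) (fun a => D₀.lst w a x))

/-- The entry `D[uv][w]` after that value has been written. -/
noncomputable def oppCur (M : Table n) (D₀ D : DS n) (u v w x : Fin n) : EReal :=
  if w = x then oppValue M D₀ D u v w x else D.fst u v w

/-- The entries for paths bounded by their first arc after one step of Concatenate-Opposite. -/
noncomputable def oppFst (M : Table n) (D₀ D : DS n) (u v w x u' v' x' : Fin n) : EReal :=
  if M u v < 0 ∧ u' = u ∧ v' = v ∧ x' = x then
    if ∃ a, 0 ≤ M a x ∧ eabs (oppCur M D₀ D u v w x) ≤ D₀.lst w a x ∧ M a x ≤ eabs (M u v) then 0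
    else oppValue M D₀ D u v w x
  else D.fst u' v' x'

/-- The part of a step of Concatenate-Opposite that writes to the entries `D[uv][x]`. -/
noncomputable def oppHalf (M : Table n) (D₀ D : DS n) : Fin n × Fin n × Fin n × Fin n → DS n
  | (u, v, w, x) =>
    let D₁ := if M u v < 0 then D.setFst u v x (oppValue M D₀ D u v w x) else D
    if M u v < 0 ∧ ∃ a, 0 ≤ M a x ∧ eabs (D₁.fst u v w) ≤ D₀.lst w a x ∧
          M a x ≤ eabs (M u v) then
        D₁.setFst u v x 0
      else D₁

/-- The part of a step of Concatenate-Opposite that writes to the entries `D[x][vu]`. -/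
noncomputable def oppHalf' (M : Table n) (D₀ D₂ : DS n) : Fin n × Fin n × Fin n × Fin n → DS n
  | (u, v, w, x) =>
    let D₃ :=
      if M v u < 0 then
        D₂.setLst x v u (max (D₂.lst x v u)
          (rangeMax (fun a => 0 ≤ M x a ∧ M x a - D₀.fst x a w ≤ D₂.lst w v u - M v u ∧
              D₀.fst x a w ≤ eabs (D₂.lst w v u))
            (fun a => D₀.fst x a w) + D₂.lst w v u))
      else D₂
    if M v u < 0 ∧ ∃ a, 0 ≤ M x a ∧ eabs (D₃.lst w v u) ≤ D₀.fst x a w ∧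
        M x a ≤ eabs (M v u) then
      D₃.setLst x v u 0
    else D₃

lemma concatOppStep_eq (M : Table n) (D₀ D : DS n) (t : Fin n × Fin n × Fin n × Fin n) :
    concatOppStep M D₀ D t = oppHalf' M D₀ (oppHalf M D₀ D t) t := rfl

lemma setFst_dual (D : DS n) (u v x : Fin n) (e : EReal) :
    D.dual.setFst u v x e = (D.setLst x v u e).dual := by
  simp only [DS.setFst, DS.dual, DS.setLst]
  congr 1
  funext a b c
  simp only [and_assoc, and_comm]

/-- The first half reads and writes `fst`, the second `lst`, and both query the frozen `D₀`. So the
halves do not interact and are mirror images, although they run in sequence. -/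
lemma oppHalf'_eq (M : Table n) (D₀ D : DS n) (t : Fin n × Fin n × Fin n × Fin n) :
    (oppHalf' M D₀ D t).dual = oppHalf M.tr D₀.dual D.dual t := by
  obtain ⟨u, v, w, x⟩ := t
  simp only [oppHalf', oppHalf, oppValue, apply_ite DS.dual, setFst_dual]
  have key : D.dual.fst u v w + rangeMax (fun a => 0 ≤ M.tr a x ∧ M.tr a x - D₀.dual.lst w a x ≤
      D.dual.fst u v w - M.tr u v ∧ D₀.dual.lst w a x ≤ eabs (D.dual.fst u v w))
      (fun a => D₀.dual.lst w a x) = rangeMax (fun a => 0 ≤ M x a ∧ M x a - D₀.fst x a w ≤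
        D.lst w v u - M v u ∧ D₀.fst x a w ≤ eabs (D.lst w v u))
      (fun a => D₀.fst x a w) + D.lst w v u := add_comm _ _
  rw [key]
  by_cases h : M v u < 0
  · have h' : M.tr u v < 0 := h
    simp only [h, h', if_true, true_and, setFst_dual]
    rfl
  · have h' : ¬ M.tr u v < 0 := h
    simp only [h, h', if_false, false_and]

lemma oppHalf_fst (M : Table n) (D₀ D : DS n) (u v w x u' v' x' : Fin n) :
    (oppHalf M D₀ D (u, v, w, x)).fst u' v' x' = oppFst M D₀ D u v w x u' v' x' := by
  unfold oppFst
  by_cases h1 : M u v < 0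
  · have h3 : (D.setFst u v x (oppValue M D₀ D u v w x)).fst u v w = oppCur M D₀ D u v w x := by
      simp [DS.setFst, oppCur]
    simp only [oppHalf, h1, if_true, true_and, h3]
    split_ifs <;> simp_all [DS.setFst]
  · simp only [oppHalf, h1, if_false, false_and]

lemma oppHalf_lst (M : Table n) (D₀ D : DS n) (t : Fin n × Fin n × Fin n × Fin n) :
    (oppHalf M D₀ D t).lst = D.lst := by
  obtain ⟨u, v, w, x⟩ := t
  simp only [oppHalf]
  split_ifs <;> rfl

lemma oppFst_congr (M : Table n) (D₀ : DS n) {D D' : DS n} (h : D.fst = D'.fst)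
    (u v w x u' v' x' : Fin n) :
    oppFst M D₀ D u v w x u' v' x' = oppFst M D₀ D' u v w x u' v' x' := by
  obtain ⟨s, f, l⟩ := D
  obtain ⟨s', f', l'⟩ := D'
  obtain rfl : f = f' := h
  rfl

lemma concatOppStep_fst (M : Table n) (D₀ D : DS n) (u v w x u' v' x' : Fin n) :
    (concatOppStep M D₀ D (u, v, w, x)).fst u' v' x' = oppFst M D₀ D u v w x u' v' x' := by
  rw [concatOppStep_eq, ← oppHalf_fst]
  have := congrArg DS.lst (oppHalf'_eq M D₀ (oppHalf M D₀ D (u, v, w, x)) (u, v, w, x))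
  rw [oppHalf_lst] at this
  exact congrFun (congrFun (congrFun this x') v') u'

lemma concatOppStep_lst (M : Table n) (D₀ D : DS n) (u v w x u' v' x' : Fin n) :
    (concatOppStep M D₀ D (u, v, w, x)).lst x' v' u' =
      oppFst M.tr D₀.dual D.dual u v w x u' v' x' := by
  have h1 : (oppHalf M D₀ D (u, v, w, x)).dual.fst = D.dual.fst := by
    funext a b c
    simp only [DS.dual, oppHalf_lst]
  rw [concatOppStep_eq, ← oppFst_congr M.tr D₀.dual h1, ← oppHalf_fst, ← oppHalf'_eq]
  rfl

lemma concatOppStep_dual (M : Table n) (D₀ D : DS n) (t : Fin n × Fin n × Fin n × Fin n) :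
    concatOppStep M.tr D₀.dual D.dual t = (concatOppStep M D₀ D t).dual := by
  obtain ⟨u, v, w, x⟩ := t
  have ext : ∀ E E' : DS n, E.sc = E'.sc → E.fst = E'.fst → E.lst = E'.lst → E = E' := by
    rintro ⟨⟩ ⟨⟩ h1 h2 h3
    simp_all
  apply ext
  · rw [concatOppStep_sc]
    simp only [DS.dual, concatOppStep_sc]
  · funext a b c
    rw [concatOppStep_fst]
    exact (concatOppStep_lst M D₀ D u v w x a b c).symm
  · funext a b c
    rw [concatOppStep_lst]
    exact (concatOppStep_fst M D₀ D u v w x c b a).symm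

lemma concatStep_fstSound {M : Table n} {D₀ D : DS n} (h₀ : D₀.Sound M) (hD : D.Sound M)
    (t : Fin n × Fin n × Fin n × Fin n) :
    (concatStep M D₀ D t).FstSound M ∧ D.FstLe (concatStep M D₀ D t) := by
  obtain ⟨u, v, w, x⟩ := t
  refine ⟨fun u' v' x' => ?_, fun u' v' x' => ?_⟩
  · rw [concatStep_fst]
    split_ifs with h
    · obtain ⟨h, rfl, rfl, rfl⟩ := h
      refine ⟨max_le (hD.fst _ _ _).1 (le_max_of_le_right ?_), fun hbot => ?_⟩
      · exact add_nonpos (hD.fst_nonpos h.le) (iSup₂_le fun a ha => h₀.fst_nonpos ha.2)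
      · rw [(hD.fst _ _ _).2 hbot, (hD.fst _ _ _).2 hbot, EReal.bot_add]
        simp
    · exact hD.fst _ _ _
  · rw [concatStep_fst]
    split_ifs with h
    · obtain ⟨h, rfl, rfl, rfl⟩ := h
      exact le_max_left _ _
    · exact le_rfl

lemma oppValue_nonpos {M : Table n} {D₀ D : DS n} (hD : D.Sound M) {u v w x : Fin n}
    (h : M u v < 0) : oppValue M D₀ D u v w x ≤ 0 :=
  max_le (hD.fst_nonpos h.le) (add_nonpos_of_le_eabs (hD.fst_nonpos h.le)
    (iSup₂_le fun _ ha => ha.2.2))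

lemma oppValue_bot {M : Table n} {D₀ D : DS n} (hD : D.Sound M) {u v w x : Fin n}
    (h : M u v = ⊥) : oppValue M D₀ D u v w x = ⊥ := by
  unfold oppValue
  rw [(hD.fst _ _ _).2 h, (hD.fst _ _ _).2 h, EReal.bot_add]
  simp

lemma concatOppStep_fstSound {M : Table n} {D₀ D : DS n} (h₀ : D₀.Sound M) (hD : D.Sound M)
    (t : Fin n × Fin n × Fin n × Fin n) :
    (concatOppStep M D₀ D t).FstSound M ∧ D.FstLe (concatOppStep M D₀ D t) := by
  obtain ⟨u, v, w, x⟩ := t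
  refine ⟨fun u' v' x' => ?_, fun u' v' x' => ?_⟩
  · rw [concatOppStep_fst, oppFst]
    split_ifs with h h'
    · obtain ⟨h, rfl, rfl, rfl⟩ := h
      refine ⟨le_max_right _ _, fun hbot => ?_⟩
      obtain ⟨a, -, ha, -⟩ := h'
      rw [oppCur, oppValue_bot hD hbot, (hD.fst _ _ _).2 hbot, ite_self] at ha
      exact absurd (top_le_iff.1 (by simpa [eabs] using ha)) (h₀.lst_ne_top _ _ _)
    · obtain ⟨h, rfl, rfl, rfl⟩ := h
      exact ⟨le_max_of_le_right (oppValue_nonpos hD h), fun hbot => oppValue_bot hD hbot⟩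
    · exact hD.fst _ _ _
  · rw [concatOppStep_fst, oppFst]
    split_ifs with h h'
    · obtain ⟨h, rfl, rfl, rfl⟩ := h
      -- Overwriting with 0 never lowers an entry, because entries bounded by a negative arc are at
      -- most 0.
      exact hD.fst_nonpos h.le
    · obtain ⟨h, rfl, rfl, rfl⟩ := h
      exact le_max_left _ _
    · exact le_rfl

lemma isOp_concatStep {M : Table n} {D₀ : DS n} (h₀ : D₀.Sound M)
    (t : Fin n × Fin n × Fin n × Fin n) : IsOp M (fun D => concatStep M D₀ D t) := by
  intro D hD
  have h1 := concatStep_fstSound h₀ hD t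
  have h2 := concatStep_fstSound h₀.dual hD.dual t
  rw [concatStep_dual] at h2
  exact ⟨⟨hD.ne_top, (concatStep_sc M D₀ D t).trans hD.sc, h1.1, h2.1⟩, h1.2, h2.2⟩

lemma isOp_concatOppStep {M : Table n} {D₀ : DS n} (h₀ : D₀.Sound M)
    (t : Fin n × Fin n × Fin n × Fin n) : IsOp M (fun D => concatOppStep M D₀ D t) := by
  intro D hD
  have h1 := concatOppStep_fstSound h₀ hD t
  have h2 := concatOppStep_fstSound h₀.dual hD.dual t
  rw [concatOppStep_dual] at h2
  exact ⟨⟨hD.ne_top, (concatOppStep_sc M D₀ D t).trans hD.sc, h1.1, h2.1⟩, h1.2, h2.2⟩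

lemma isOp_foldl {α : Type*} {M : Table n} {f : DS n → α → DS n}
    (hf : ∀ t, IsOp M (fun D => f D t)) (L : List α) : IsOp M (fun D => L.foldl f D) := by
  induction L with
  | nil => exact fun D hD => ⟨hD, DS.Le.refl D⟩
  | cons t L ih =>
    intro D hD
    exact ⟨(ih _ (hf t D hD).1).1, (hf t D hD).2.trans (ih _ (hf t D hD).1).2⟩

/-- Inside a fold every step is applied to some intermediate state. -/
lemma exists_le_foldl {α : Type*} {M : Table n} {f : DS n → α → DS n}
    (hf : ∀ t, IsOp M (fun D => f D t)) {L : List α} {t : α} (ht : t ∈ L) :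
    ∀ D, D.Sound M → ∃ D', D'.Sound M ∧ D.Le D' ∧ (f D' t).Le (L.foldl f D) := by
  induction L with
  | nil => simp at ht
  | cons s L ih =>
    intro D hD
    rcases List.mem_cons.1 ht with rfl | ht
    · exact ⟨D, hD, DS.Le.refl D, (isOp_foldl hf L _ (hf t D hD).1).2⟩
    · obtain ⟨D', h1, h2, h3⟩ := ih ht (f D s) (hf s D hD).1
      exact ⟨D', h1, (hf s D hD).2.trans h2, h3⟩

lemma isOp_concatenate (M : Table n) (U W X : Finset (Fin n)) : IsOp M (concatenate M U W X) :=
  fun D hD => isOp_foldl (fun t => isOp_concatStep hD t) _ D hD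

lemma isOp_concatenateOpposite (M : Table n) (U W X : Finset (Fin n)) :
    IsOp M (concatenateOpposite M U W X) :=
  fun D hD => isOp_foldl (fun t => isOp_concatOppStep hD t) _ D hD

lemma foldl_dual {α : Type*} {f g : DS n → α → DS n} (h : ∀ D t, f D.dual t = (g D t).dual)
    (L : List α) : ∀ D : DS n, L.foldl f D.dual = (L.foldl g D).dual := by
  induction L with
  | nil => exact fun _ => rfl
  | cons t L ih =>
    intro D
    rw [List.foldl_cons, List.foldl_cons, h, ih]

lemma concatenate_dual (M : Table n) (U W X : Finset (Fin n)) (D : DS n) :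
    concatenate M.tr U W X D.dual = (concatenate M U W X D).dual :=
  foldl_dual (fun E t => concatStep_dual M D E t) _ D

lemma concatenateOpposite_dual (M : Table n) (U W X : Finset (Fin n)) (D : DS n) :
    concatenateOpposite M.tr U W X D.dual = (concatenateOpposite M U W X D).dual :=
  foldl_dual (fun E t => concatOppStep_dual M D E t) _ D

lemma iterate_dual {f g : DS n → DS n} (h : ∀ D : DS n, f D.dual = (g D).dual) (k : ℕ) :
    ∀ D : DS n, f^[k] D.dual = (g^[k] D).dual := by
  induction k with
  | zero => exact fun _ => rfl
  | succ k ih =>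
    intro D
    rw [Function.iterate_succ_apply, Function.iterate_succ_apply, h, ih]

lemma mem_tuples {U W X : Finset (Fin n)} {u v w x : Fin n} (hu : u ∈ U) (hw : w ∈ W)
    (hx : x ∈ X) : (u, v, w, x) ∈ tuples U W X := by
  simp [tuples, hu, hw, hx]

/-- Earlier tuples may already have enlarged the entry for `u v w`. This only widens the range of
the query, so bounds on the entries at the start of the call suffice. -/
lemma concatenate_le_fst {M : Table n} {D : DS n} (hD : D.Sound M) {U W X : Finset (Fin n)}
    {u v w x a : Fin n} (hu : u ∈ U) (hw : w ∈ W) (hx : x ∈ X) {m p d q : ℝ}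
    (hm : M u v = (m : EReal)) (hm0 : m < 0) (hp : M w a = (p : EReal)) (hp0 : p ≤ 0)
    (hdp : -(d - m) ≤ p) (hd : (d : EReal) ≤ D.fst u v w) (hq : (q : EReal) ≤ D.fst w a x) :
    ((d + q : ℝ) : EReal) ≤ (concatenate M U W X D).fst u v x := by
  obtain ⟨E, hE, hDE, hle⟩ := exists_le_foldl (f := concatStep M D)
    (fun t => isOp_concatStep hD t) (mem_tuples (v := v) hu hw hx) D hD
  refine le_trans ?_ (hle.1 u v x)
  rw [concatStep_fst, if_pos ⟨by rw [hm]; exact_mod_cast hm0, rfl, rfl, rfl⟩]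
  refine le_max_of_le_right ?_
  have hdE := hd.trans (hDE.1 u v w)
  push_cast
  refine add_le_add hdE (hq.trans (le_rangeMax (k := fun a => D.fst w a x) a ⟨?_, ?_⟩))
  · rw [hm, hp]
    have : (-((d : EReal) - m)) ≤ (p : EReal) := by exact_mod_cast hdp
    exact le_trans (EReal.neg_le_neg_iff.2 (EReal.sub_le_sub hdE le_rfl)) this
  · rw [hp]; exact_mod_cast hp0

/-- An enlarged left entry could do harm here, since the query rejects right entries exceeding its
absolute value. This is what the overwriting is for: in that case 0 is written, and 0 is at least `d
+ q`. -/
lemma concatenateOpposite_le_fst {M : Table n} {D : DS n} (hD : D.Sound M)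
    {U W X : Finset (Fin n)}
    {u v w x a : Fin n} (hu : u ∈ U) (hw : w ∈ W) (hx : x ∈ X) {m p d q : ℝ}
    (hm : M u v = (m : EReal)) (hm0 : m < 0) (hp : M a x = (p : EReal)) (hp0 : 0 ≤ p)
    (hpm : p ≤ -m) (hdp : p - q ≤ d - m) (hdq : d + q ≤ 0)
    (hd : (d : EReal) ≤ D.fst u v w) (hq : (q : EReal) ≤ D.lst w a x) :
    ((d + q : ℝ) : EReal) ≤ (concatenateOpposite M U W X D).fst u v x := by
  obtain ⟨E, hE, hDE, hle⟩ := exists_le_foldl (f := concatOppStep M D)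
    (fun t => isOp_concatOppStep hD t) (mem_tuples (v := v) hu hw hx) D hD
  refine le_trans ?_ (hle.1 u v x)
  have hm' : M u v < 0 := by rw [hm]; exact_mod_cast hm0
  rw [concatOppStep_fst, oppFst, if_pos ⟨hm', rfl, rfl, rfl⟩]
  have hdE := hd.trans (hDE.1 u v w)
  split_ifs with h
  · exact_mod_cast hdq
  rcases le_total (D.lst w a x) (eabs (E.fst u v w)) with h1 | h1
  · refine le_max_of_le_right ?_
    push_cast
    refine add_le_add hdE (hq.trans (le_rangeMax (k := fun a => D.lst w a x) a ⟨?_, ?_, h1⟩))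
    · rw [hp]; exact_mod_cast hp0
    · rw [hp, hm]
      refine (EReal.sub_le_sub le_rfl hq).trans (le_trans ?_ (EReal.sub_le_sub hdE le_rfl))
      exact_mod_cast hdp
  · exfalso
    apply h
    refine ⟨a, by rw [hp]; exact_mod_cast hp0, le_trans ?_ h1, ?_⟩
    · unfold oppCur
      have hle0 : ∀ {p q : EReal}, p ≤ q → q ≤ 0 → eabs q ≤ eabs p := by
        intro p q hpq hq
        unfold eabs
        rw [max_eq_right (hq.trans (EReal.neg_le_neg_iff.2 hq |>.trans' (by simp)))]
        exact le_max_of_le_right (EReal.neg_le_neg_iff.2 hpq)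
      split_ifs with hwx
      · refine hle0 ?_ (oppValue_nonpos hE hm')
        rw [hwx]
        exact le_max_left _ _
      · exact le_rfl
    · rw [hp, hm]
      refine le_max_of_le_right ?_
      exact_mod_cast hpm

end Steps
end ElectricCar

namespace ElectricCar
variable {n : ℕ}

/-! ### Entries of the data structure along a path -/

/-- The entry for `v e, …, v r`, bounded by its first arc, is at least the gain of the path. -/
def FstOK (D : DS n) (v : ℕ → Fin n) (H : ℕ → ℝ) (e r : ℕ) : Prop :=
  ((H r - H e : ℝ) : EReal) ≤ D.fst (v e) (v (e + 1)) (v r)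

/-- The entry for `v s, …, v r`, bounded by its last arc, is at least the gain of the path. -/
def LstOK (D : DS n) (v : ℕ → Fin n) (H : ℕ → ℝ) (s r : ℕ) : Prop :=
  ((H r - H s : ℝ) : EReal) ≤ D.lst (v s) (v (r - 1)) (v r)

def Funnel (H : ℕ → ℝ) (e r : ℕ) : Prop := ∀ f, e ≤ f → f + 2 ≤ r → Closing H f

def OpeningFunnel (H : ℕ → ℝ) (s r : ℕ) : Prop := ∀ f, s ≤ f → f + 2 ≤ r → WeakOpening H f

lemma FstOK.mono {D D' : DS n} {v : ℕ → Fin n} {H : ℕ → ℝ} {e r : ℕ} (h : FstOK D v H e r)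
    (hD : D.Le D') : FstOK D' v H e r := le_trans h (hD.1 _ _ _)

lemma LstOK.mono {D D' : DS n} {v : ℕ → Fin n} {H : ℕ → ℝ} {e r : ℕ} (h : LstOK D v H e r)
    (hD : D.Le D') : LstOK D' v H e r := le_trans h (hD.2 _ _ _)

/-- Signs alternate along a funnel. Funnels are split at even offsets only, so that both parts start
with a descending arc, as Concatenate requires. -/
lemma Funnel.descending {H : ℕ → ℝ} {e r : ℕ} (hF : Funnel H e r) (h : H (e + 1) < H e) (d : ℕ)
    (hd : e + 2 * d + 1 ≤ r) : H (e + 2 * d + 1) < H (e + 2 * d) := by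
  induction d with
  | zero => simpa using h
  | succ d ih =>
    have h1 := ih (by omega)
    have h2 := hF (e + 2 * d) (by omega) (by omega)
    have h3 := hF (e + 2 * d + 1) (by omega) (by omega)
    rw [show e + 2 * (d + 1) = e + 2 * d + 2 by ring]
    unfold Closing at h2 h3
    rw [show e + 2 * d + 1 + 2 = e + 2 * d + 2 + 1 by ring, show e + 2 * d + 1 + 1 = e + 2 * d + 2
      by ring] at h3
    rcases h2 with h2 | h2 <;> rcases h3 with h3 | h3 <;> linarith [h2.1, h2.2.1, h3.1, h3.2.1]

lemma Funnel.bounded {H : ℕ → ℝ} {e r : ℕ} (hF : Funnel H e r) (h : H (e + 1) < H e)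
    {k : ℕ} (hk : e ≤ k) (hkr : k ≤ r) (her : e < r) : H (e + 1) ≤ H k ∧ H k ≤ H e := by
  have := closing_bounded (H := H) (r := r) (r - e - 1) e (by omega) hF k hk hkr
  rwa [min_eq_right h.le, max_eq_left h.le] at this

section Path
variable {M : Table n} {v : ℕ → Fin n} {l : ℕ} {H : ℕ → ℝ}

lemma fstOK_init (hex : Exact M v l H) {e : ℕ} (he : e < l) :
    FstOK (DS.init M) v H e (e + 1) := by
  simp only [FstOK, DS.init, if_true]
  rw [hex e he]

lemma fstOK_breadthSearch (hex : Exact M v l H) {D : DS n} {e r : ℕ} (he : e + 2 ≤ l)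
    (hc : Closing H e) (h : FstOK D v H (e + 1) r) : FstOK (breadthSearch M D) v H e r := by
  unfold FstOK at h ⊢
  have e1 := hex e (by omega)
  have e2 := hex (e + 1) (by omega)
  refine le_max_of_le_right ?_
  rw [show H r - H e = (H (e + 1) - H e) + (H r - H (e + 1)) by ring, EReal.coe_add, ← e1]
  refine add_le_add le_rfl (h.trans (le_rangeMax
    (k := fun a => D.fst (v (e + 1)) a (v r)) (v (e + 1 + 1)) ?_))
  rw [OppositeWithin, e1, e2, show e + 1 + 1 = e + 2 from rfl]
  unfold eabs
  rcases hc with hc | hc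
  · refine ⟨fun _ => ⟨?_, ?_⟩, fun h => absurd ?_ h⟩ <;> norm_cast <;> linarith
  · refine ⟨fun h => absurd h ?_, fun _ => ⟨?_, le_max_of_le_right ?_⟩⟩ <;> norm_cast <;> linarith

lemma fstOK_concatenate (hex : Exact M v l H) {D : DS n} (hD : D.Sound M)
    {U W X : Finset (Fin n)} {e j r : ℕ} (he : e < l) (hj : j < l) (hU : v e ∈ U) (hW : v j ∈ W)
    (hX : v r ∈ X) (h1 : H (e + 1) < H e) (h2 : H (j + 1) ≤ H j) (h3 : H (e + 1) ≤ H (j + 1))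
    (hej : FstOK D v H e j) (hjr : FstOK D v H j r) :
    FstOK (concatenate M U W X D) v H e r := by
  have := concatenate_le_fst hD hU hW hX (hex e he) (by linarith) (hex j hj) (by linarith)
    (by linarith) hej hjr
  refine le_trans (le_of_eq ?_) this
  congr 1; ring

lemma fstOK_concatenateOpposite (hex : Exact M v l H) {D : DS n} (hD : D.Sound M)
    {U W X : Finset (Fin n)} {e j r : ℕ} (he : e < l) (hr : r < l) (hU : v e ∈ U) (hW : v j ∈ W)
    (hX : v (r + 1) ∈ X) (h1 : H (e + 1) < H e) (h2 : H r ≤ H (r + 1)) (h3 : H (e + 1) ≤ H r)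
    (h4 : H (r + 1) ≤ H e) (hej : FstOK D v H e j) (hjr : LstOK D v H j (r + 1)) :
    FstOK (concatenateOpposite M U W X D) v H e (r + 1) := by
  have := concatenateOpposite_le_fst hD hU hW hX (hex e he) (by linarith) (hex r hr) (by linarith)
    (by linarith) (by linarith) (by linarith) hej hjr
  refine le_trans (le_of_eq ?_) this
  congr 1; ring

lemma fstOK_iterate_breadthSearch (hex : Exact M v l H) {D : DS n} (hD : D.Sound M) {e' r : ℕ}
    (hr : r ≤ l) (he' : e' < r) (h : FstOK D v H e' r) (j : ℕ) :
    ∀ e, e ≤ e' → e' ≤ e + j → Funnel H e r → FstOK ((breadthSearch M)^[j] D) v H e r := by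
  induction j with
  | zero =>
    intro e h1 h2 _
    obtain rfl : e = e' := by omega
    exact h
  | succ j ih =>
    intro e h1 h2 hF
    rw [Function.iterate_succ_apply']
    have hs := ((isOp_breadthSearch M).iterate j D hD).1
    rcases eq_or_lt_of_le h1 with rfl | h1
    · exact (ih e le_rfl (by omega) hF).mono (isOp_breadthSearch M _ hs).2
    · exact fstOK_breadthSearch hex (by omega) (hF e le_rfl (by omega))
        (ih (e + 1) (by omega) (by omega) fun f hf hf' => hF f (by omega) hf')

/-- The deterministic part of Compute-Funnels. -/
noncomputable def funnelsFrom (M : Table n) (L K : ℕ) (S : Finset (Fin n)) : DS n :=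
  (breadthSearch M)^[L] (concatenate M S S Finset.univ
    ((concatenate M S S S)^[K] ((breadthSearch M)^[L] (DS.init M))))

lemma funnelsFrom_sound (hM : ∀ x y, M x y ≠ ⊤) (L K : ℕ) (S : Finset (Fin n)) :
    (funnelsFrom M L K S).Sound M :=
  ((((isOp_breadthSearch M).iterate L).comp ((isOp_concatenate M S S S).iterate K)).comp
    ((isOp_concatenate M S S Finset.univ).comp ((isOp_breadthSearch M).iterate L)) _
    (DS.init_sound hM)).1

lemma funnelsFrom_dual (M : Table n) (L K : ℕ) (S : Finset (Fin n)) :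
    funnelsFrom M.tr L K S = (funnelsFrom M L K S).dual := by
  unfold funnelsFrom
  rw [DS.init_dual, iterate_dual (breadthSearch_dual M), iterate_dual (concatenate_dual M S S S),
    concatenate_dual, iterate_dual (breadthSearch_dual M)]

/-- If the sample hits all windows of the path, all closing funnels are found. -/
lemma fstOK_funnelsFrom (hM : ∀ x y, M x y ≠ ⊤) (hex : Exact M v l H) {L K k : ℕ}
    {S : Finset (Fin n)} (hk : 1 ≤ k) (hkL : 2 * k ≤ L + 1) (hK : l ≤ 2 ^ K)
    (hit : ∀ i, i + 2 * (k - 1) ≤ l → ∃ j, j < k ∧ v (i + 2 * j) ∈ S)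
    {e r : ℕ} (her : e < r) (hr : r ≤ l) (hF : Funnel H e r) :
    FstOK (funnelsFrom M L K S) v H e r := by
  set D₁ := (breadthSearch M)^[L] (DS.init M) with hD₁
  set D₂ := (concatenate M S S S)^[K] D₁ with hD₂
  set D₃ := concatenate M S S Finset.univ D₂ with hD₃
  have s₁ : D₁.Sound M := ((isOp_breadthSearch M).iterate L _ (DS.init_sound hM)).1
  have o₂ := (isOp_concatenate M S S S).iterate K _ s₁
  have o₃ := isOp_concatenate M S S Finset.univ _ o₂.1
  have o₄ := (isOp_breadthSearch M).iterate L _ o₃.1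
  -- Breadth-Search alone finds the funnels with at most `L + 1` arcs.
  have a₁ : ∀ e r, e < r → r ≤ l → Funnel H e r → r ≤ e + (L + 1) → FstOK D₁ v H e r := by
    intro e r her hr hF hL
    refine fstOK_iterate_breadthSearch hex (DS.init_sound hM) hr (e' := r - 1) (by omega) ?_ L e
      (by omega) (by omega) hF
    have := fstOK_init hex (e := r - 1) (by omega)
    rwa [show r - 1 + 1 = r by omega] at this
  have a₂ : ∀ t e d, 1 ≤ d → d ≤ k - 1 + 2 ^ t → e + 2 * d + 1 ≤ l → v e ∈ S →
      v (e + 2 * d) ∈ S → H (e + 1) < H e → Funnel H e (e + 2 * d + 1) →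
      FstOK ((concatenate M S S S)^[t] D₁) v H e (e + 2 * d) := by
    intro t
    induction t with
    | zero =>
      intro e d hd1 hd2 hl _ _ _ hF
      exact a₁ e _ (by omega) (by omega) (fun f h1 h2 => hF f h1 (by omega)) (by
        rw [pow_zero] at hd2; omega)
    | succ t ih =>
      intro e d hd1 hd2 hl he hd hlt hF
      rw [Function.iterate_succ_apply']
      have hs := ((isOp_concatenate M S S S).iterate t _ s₁).1
      by_cases hdt : d ≤ k - 1 + 2 ^ t
      · exact (ih e d hd1 hdt hl he hd hlt hF).mono (isOp_concatenate M S S S _ hs).2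
      · have hp : 1 ≤ 2 ^ t := Nat.one_le_two_pow
        rw [pow_succ] at hd2
        -- Splitting at the offset 2^t + j with j < k leaves both halves within the bound for `t`.
        obtain ⟨j, hj, hjS⟩ := hit (e + 2 * 2 ^ t) (by omega)
        rw [show e + 2 * 2 ^ t + 2 * j = e + 2 * (2 ^ t + j) by ring] at hjS
        have hdesc := hF.descending hlt (2 ^ t + j) (by omega)
        refine fstOK_concatenate hex hs (j := e + 2 * (2 ^ t + j)) (by omega) (by omega) he hjS hd
          hlt hdesc.le (hF.bounded hlt (by omega) (by omega) (by omega)).1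
          (ih e (2 ^ t + j) (by omega) (by omega) (by omega) he hjS hlt
            fun f h1 h2 => hF f h1 (by omega)) ?_
        have hde : e + 2 * (2 ^ t + j) + 2 * (d - (2 ^ t + j)) = e + 2 * d := by omega
        have := ih (e + 2 * (2 ^ t + j)) (d - (2 ^ t + j)) (by omega) (by omega) (by omega) hjS
          (by rwa [hde]) hdesc (fun f h1 h2 => hF f (by omega) (by omega))
        rwa [hde] at this
  -- From a sampled start to any end: some sampled position is close enough to `r` for `a₁` to
  -- supply the rest.
  have a₃ : ∀ e r, e < r → r ≤ l → Funnel H e r → v e ∈ S → H (e + 1) < H e →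
      FstOK D₃ v H e r := by
    intro e r her hr hF he hlt
    by_cases hL : r ≤ e + (L + 1)
    · exact (a₁ e r her hr hF hL).mono (o₂.2.trans o₃.2)
    · set d := (r - e - 1) / 2 with hd
      have hd1 : 2 * d ≤ r - e - 1 := Nat.mul_div_le _ _
      have hd2 : r - e - 1 ≤ 2 * d + 1 := by omega
      obtain ⟨j, hj, hjS⟩ := hit (e + 2 * (d - (k - 1))) (by omega)
      rw [show e + 2 * (d - (k - 1)) + 2 * j = e + 2 * (d - (k - 1) + j) by ring] at hjS
      set c := d - (k - 1) + j with hc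
      have hdesc := hF.descending hlt c (by omega)
      have hpow : c ≤ k - 1 + 2 ^ K := by omega
      exact fstOK_concatenate hex o₂.1 (j := e + 2 * c) (by omega) (by omega) he hjS
        (Finset.mem_univ _) hlt hdesc.le (hF.bounded hlt (by omega) (by omega) (by omega)).1
        (a₂ K e c (by omega) hpow (by omega) he hjS hlt fun f h1 h2 => hF f h1 (by omega))
        ((a₁ (e + 2 * c) r (by omega) hr (fun f h1 h2 => hF f (by omega) h2) (by omega)).mono o₂.2)
  by_cases hL : r ≤ e + (L + 1)
  · exact (a₁ e r her hr hF hL).mono (o₂.2.trans (o₃.2.trans o₄.2))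
  -- From any start: a sampled descending arc follows soon, and the final Breadth-Search extends its
  -- entry backwards.
  · obtain ⟨e₀, h0, h0', hlt⟩ : ∃ e₀, e ≤ e₀ ∧ e₀ ≤ e + 1 ∧ H (e₀ + 1) < H e₀ := by
      rcases hF e le_rfl (by omega) with h | h
      · exact ⟨e + 1, by omega, by omega, h.2.1⟩
      · exact ⟨e, by omega, by omega, h.1⟩
    have hF₀ : Funnel H e₀ r := fun f h1 h2 => hF f (by omega) h2
    obtain ⟨j, hj, hjS⟩ := hit e₀ (by omega)
    exact fstOK_iterate_breadthSearch hex o₃.1 hr (e' := e₀ + 2 * j) (by omega)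
      (a₃ _ r (by omega) hr (fun f h1 h2 => hF f (by omega) h2) hjS
        (hF₀.descending hlt j (by omega))) L e (by omega) (by omega) hF

lemma Exact.tr (hex : Exact M v l H) :
    Exact M.tr (fun i => v (l - i)) l (fun i => -H (l - i)) := by
  intro k hk
  have := hex (l - (k + 1)) (by omega)
  rw [show l - (k + 1) + 1 = l - k by omega] at this
  simp only [Table.tr, this]
  congr 1
  ring

lemma closing_tr {f : ℕ} (hf : f + 2 ≤ l) (h : WeakOpening H (l - 2 - f)) :
    Closing (fun i => -H (l - i)) f := by
  unfold WeakOpening at h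
  unfold Closing
  rw [show l - 2 - f + 1 = l - (f + 1) by omega, show l - 2 - f + 2 = l - f by omega,
    show l - 2 - f = l - (f + 2) by omega] at h
  rcases h with h | h
  · right
    refine ⟨?_, ?_, ?_⟩ <;> linarith [h.1, h.2]
  · left
    refine ⟨?_, ?_, ?_⟩ <;> linarith [h.1, h.2]

/-- An opening funnel read backwards is a closing one, and the windows hit by `S` are mapped to
windows by reversal. -/
lemma lstOK_funnelsFrom (hM : ∀ x y, M x y ≠ ⊤) (hex : Exact M v l H) {L K k : ℕ}
    {S : Finset (Fin n)} (hk : 1 ≤ k) (hkL : 2 * k ≤ L + 1) (hK : l ≤ 2 ^ K)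
    (hit : ∀ i, i + 2 * (k - 1) ≤ l → ∃ j, j < k ∧ v (i + 2 * j) ∈ S)
    {s r : ℕ} (hsr : s < r) (hr : r ≤ l) (hF : OpeningFunnel H s r) :
    LstOK (funnelsFrom M L K S) v H s r := by
  have := fstOK_funnelsFrom (M := M.tr) (S := S) (fun x y => hM y x) hex.tr hk hkL hK (by
    intro i hi
    obtain ⟨j, hj, hjS⟩ := hit (l - i - 2 * (k - 1)) (by omega)
    refine ⟨k - 1 - j, by omega, ?_⟩
    rwa [show l - (i + 2 * (k - 1 - j)) = l - i - 2 * (k - 1) + 2 * j by omega])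
    (e := l - r) (r := l - s) (by omega) (by omega)
    (fun f h1 h2 => closing_tr (by omega) (hF _ (by omega) (by omega)))
  rw [funnelsFrom_dual] at this
  unfold FstOK at this
  unfold LstOK
  simp only [DS.dual] at this
  rw [show l - (l - s) = s by omega, show l - (l - r) = r by omega,
    show l - (l - r + 1) = r - 1 by omega] at this
  refine le_trans (le_of_eq ?_) this
  congr 1; ring

/-- One iteration in a round of Long-Shortcuts. -/
noncomputable def longStep (M : Table n) (T : Finset (Fin n)) (D : DS n) : DS n :=
  concatenate M T Finset.univ Finset.univ (concatenateOpposite M T Finset.univ Finset.univ D)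

lemma isOp_longStep (M : Table n) (T : Finset (Fin n)) : IsOp M (longStep M T) :=
  (isOp_concatenateOpposite M T _ _).comp (isOp_concatenate M T _ _)

/-- The table knows all funnels of the path. -/
structure KnowsFunnels (D : DS n) (v : ℕ → Fin n) (H : ℕ → ℝ) (l : ℕ) : Prop where
  fst : ∀ e r, e < r → r ≤ l → Funnel H e r → FstOK D v H e r
  lst : ∀ s r, s < r → r ≤ l → OpeningFunnel H s r → LstOK D v H s r

lemma KnowsFunnels.mono {D D' : DS n} (h : KnowsFunnels D v H l) (hD : D.Le D') :
    KnowsFunnels D' v H l :=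
  ⟨fun e r h1 h2 h3 => (h.fst e r h1 h2 h3).mono hD, fun e r h1 h2 h3 =>
    (h.lst e r h1 h2 h3).mono hD⟩

/-- All heights from `e` to `R` lie within the range of the descending arc at `e`. -/
def Within (H : ℕ → ℝ) (e R : ℕ) : Prop := ∀ k, e ≤ k → k ≤ R → H (e + 1) ≤ H k ∧ H k ≤ H e

/-- After `s` the path has no cut, so it opens up to some p and closes from there.
Concatenate-Opposite appends the opening part, which must end with an ascending arc, and Concatenate
the closing part, which must begin with a descending one; the sign of the arc at p decides to which
part it belongs. -/
lemma fstOK_longStep (hex : Exact M v l H) {D : DS n} (hD : D.Sound M)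
    (hK : KnowsFunnels D v H l) {T : Finset (Fin n)} {e s r : ℕ} (hT : v e ∈ T)
    (hlt : H (e + 1) < H e) (hes : e < s) (hsr : s < r) (hr : r ≤ l) (hW : Within H e r)
    (hcut : ∀ f, s ≤ f → f + 2 ≤ r → ¬ Cut H f) (hs : FstOK D v H e s) :
    FstOK (longStep M T D) v H e r := by
  classical
  obtain ⟨p, hp1, hp2, hpo, hpc⟩ : ∃ p, s ≤ p ∧ p < r ∧ (∀ f, s ≤ f → f < p → WeakOpening H f) ∧
      ∀ f, p ≤ f → f + 2 ≤ r → Closing H f := by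
    have hno : ∀ f, s ≤ f → f + 2 ≤ r → ¬ Closing H f → WeakOpening H f := by
      intro f h1 h2 h3
      rcases closing_or_opening_or_sameSign H f with h | h | h
      · exact absurd h h3
      · exact h.weak
      · exact absurd (Or.inl h) (hcut f h1 h2)
    by_cases hex : ∃ f, s ≤ f ∧ f + 2 ≤ r ∧ Closing H f
    · obtain ⟨h1, h2, h3⟩ := Nat.find_spec hex
      refine ⟨Nat.find hex, h1, by omega, fun f hf1 hf2 => ?_, fun f hf1 => ?_⟩
      · refine hno f hf1 (by omega) fun hc => ?_
        exact Nat.find_min hex hf2 ⟨hf1, by omega, hc⟩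
      · induction f, hf1 using Nat.le_induction with
        | base => exact fun _ => h3
        | succ f hf ih => exact fun hf' => (ih (by omega)).not_cut_next (hcut _ (by omega) hf')
    · push Not at hex
      exact ⟨r - 1, by omega, by omega, fun f h1 h2 => hno f h1 (by omega) (hex f h1 (by omega)),
        fun f h1 h2 => by omega⟩
  have o1 := isOp_concatenateOpposite M T Finset.univ Finset.univ D hD
  have o2 := isOp_concatenate M T Finset.univ Finset.univ _ o1.1
  have hK1 := hK.mono o1.2
  unfold longStep
  rcases le_or_gt (H p) (H (p + 1)) with hup | hdown
  · have h1 : FstOK (concatenateOpposite M T Finset.univ Finset.univ D) v H e (p + 1) :=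
      fstOK_concatenateOpposite hex hD (by omega) (by omega) hT (Finset.mem_univ _)
        (Finset.mem_univ _) hlt hup (hW p (by omega) (by omega)).1
        (hW (p + 1) (by omega) (by omega)).2 hs
        (hK.lst s (p + 1) (by omega) (by omega) fun f h1 h2 => hpo f h1 (by omega))
    rcases eq_or_lt_of_le (show p + 1 ≤ r from hp2) with rfl | hp3
    · exact h1.mono o2.2
    · refine fstOK_concatenate hex o1.1 (by omega) (by omega) hT (Finset.mem_univ _)
        (Finset.mem_univ _) hlt ?_ (hW (p + 2) (by omega) (by omega)).1 h1
        (hK1.fst (p + 1) r hp3 hr fun f h1 h2 => hpc f (by omega) h2)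
      rcases hpc p le_rfl (by omega) with h | h
      · exact h.2.1.le
      · linarith [h.1]
  · have h1 : FstOK (concatenateOpposite M T Finset.univ Finset.univ D) v H e p := by
      rcases eq_or_lt_of_le hp1 with rfl | hp3
      · exact hs.mono o1.2
      · obtain ⟨q, rfl⟩ : ∃ q, p = q + 1 := ⟨p - 1, by omega⟩
        refine fstOK_concatenateOpposite hex hD (by omega) (by omega) hT (Finset.mem_univ _)
          (Finset.mem_univ _) hlt ?_ (hW q (by omega) (by omega)).1
          (hW (q + 1) (by omega) (by omega)).2 hs
          (hK.lst s (q + 1) (by omega) (by omega) fun f h1 h2 => hpo f h1 (by omega))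
        rcases hpo q (by omega) (by omega) with h | h
        · exact h.1.le
        · rw [show q + 1 + 1 = q + 2 from rfl] at hdown
          linarith [h.1, h.2]
    exact fstOK_concatenate hex o1.1 (by omega) (by omega) hT (Finset.mem_univ _)
      (Finset.mem_univ _) hlt hdown.le (hW (p + 1) (by omega) (by omega)).1 h1
      (hK1.fst p r hp2 hr hpc)

open Classical in
/-- The cuts strictly inside the path from `e` to `r`. -/
noncomputable def cutsIn (H : ℕ → ℝ) (e r : ℕ) : Finset ℕ :=
  (Finset.range r).filter fun f => e < f ∧ f + 2 ≤ r ∧ Cut H f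

/-- Each iteration gets past one more cut: with j the last inner cut, the piece up to `j + 1` has
fewer inner cuts, and no cut remains between `j + 1` and `r`. -/
lemma fstOK_iterate_longStep (hex : Exact M v l H) {D : DS n} (hD : D.Sound M)
    (hK : KnowsFunnels D v H l) {T : Finset (Fin n)} {e R : ℕ} (hT : v e ∈ T)
    (hlt : H (e + 1) < H e) (hR : R ≤ l) (hW : Within H e R) (hc : e + 2 ≤ R → Closing H e)
    (t : ℕ) : ∀ r, e < r → r ≤ R → (cutsIn H e r).card ≤ t →
      FstOK ((longStep M T)^[t] D) v H e r := by
  classical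
  have base : ∀ r, e < r → r ≤ R → cutsIn H e r = ∅ → FstOK D v H e r := by
    intro r h1 h2 h3
    refine hK.fst e r h1 (by omega) fun f hf => ?_
    induction f, hf using Nat.le_induction with
    | base => exact fun h => hc (by omega)
    | succ f hf ih =>
      intro hf'
      refine (ih (by omega)).not_cut_next fun hcut => ?_
      have : f + 1 ∈ cutsIn H e r := by
        simp only [cutsIn, Finset.mem_filter, Finset.mem_range]
        exact ⟨by omega, by omega, hf', hcut⟩
      rw [h3] at this
      simp at this
  induction t with
  | zero =>
    intro r h1 h2 h3
    exact base r h1 h2 (Finset.card_eq_zero.1 (by omega))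
  | succ t ih =>
    intro r h1 h2 h3
    rcases (cutsIn H e r).eq_empty_or_nonempty with h0 | h0
    · exact (base r h1 h2 h0).mono ((isOp_longStep M T).iterate _ D hD).2
    · rw [Function.iterate_succ_apply']
      obtain ⟨j, hj, hmax⟩ := (cutsIn H e r).exists_max_image id h0
      have hj' : e < j ∧ j + 2 ≤ r ∧ Cut H j := (Finset.mem_filter.1 hj).2
      have o := (isOp_longStep M T).iterate t D hD
      refine fstOK_longStep hex o.1 (hK.mono o.2) hT hlt (s := j + 1) (by omega) (by omega)
        (by omega) (fun k hk hk' => hW k hk (by omega)) ?_ (ih (j + 1) (by omega) (by omega) ?_)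
      · intro f hf hf' hcut
        have := hmax f (by
          simp only [cutsIn, Finset.mem_filter, Finset.mem_range]
          exact ⟨by omega, by omega, hf', hcut⟩)
        simp only [id] at this
        omega
      · have : cutsIn H e (j + 1) ⊂ cutsIn H e r := by
          refine ⟨fun f hf => ?_, fun hsub => ?_⟩
          · simp only [cutsIn, Finset.mem_filter, Finset.mem_range] at hf ⊢
            exact ⟨by omega, hf.2.1, by omega, hf.2.2.2⟩
          · have := hsub hj
            simp only [cutsIn, Finset.mem_filter, Finset.mem_range] at this
            omega
        have := Finset.card_lt_card this
        omega

/-- The shortcuts recorded for an arc-bounded path with its exit arc. -/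
lemma arcBoundedToMonotone_le {B : ℝ} (hex : Exact M v l H) {D : DS n} {T : Finset (Fin n)}
    {e r : ℕ} (he : e < l) (hr : r < l) (hT : v e ∈ T) (hlt : H (e + 1) < H e)
    (hB : -B ≤ H (r + 1) - H e) (h : FstOK D v H e r) :
    (H (r + 1) ≤ H (e + 1) → ((H (r + 1) - H e : ℝ) : EReal) ≤
      arcBoundedToMonotone B M D T (v e) (v (r + 1))) ∧
    (H (e + 1) ≤ H (r + 1) → ((H (e + 1) - H e : ℝ) : EReal) ≤
      arcBoundedToMonotone B M D T (v e) (v (r + 1))) ∧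
    (H e ≤ H (r + 1) → ((H (r + 1) - H (e + 1) : ℝ) : EReal) ≤
      arcBoundedToMonotone B M D T (v (e + 1)) (v (r + 1))) := by
  have e1 := hex e he
  have e2 := hex r hr
  have hm : M (v e) (v (e + 1)) ≤ 0 := by rw [e1]; exact_mod_cast (by linarith)
  set σ := D.fst (v e) (v (e + 1)) (v r) + M (v r) (v (r + 1)) with hσ
  have hσle : ((H (r + 1) - H e : ℝ) : EReal) ≤ σ := by
    rw [show H (r + 1) - H e = (H r - H e) + (H (r + 1) - H r) by ring, EReal.coe_add, hσ, e2]
    exact add_le_add h le_rfl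
  have case2 : M (v e) (v (e + 1)) ≤ σ → ((H (e + 1) - H e : ℝ) : EReal) ≤
      arcBoundedToMonotone B M D T (v e) (v (r + 1)) := by
    intro h2
    rw [← e1]
    refine le_sup_of_le_left (le_sup_of_le_left (le_sup_of_le_left (le_sup_of_le_left
      (le_sup_right.trans' ?_))))
    exact le_iSup₂_of_le (v (e + 1)) (v r) (le_iSup_of_le ⟨hT, hm, h2⟩ le_rfl)
  refine ⟨fun h1 => ?_, fun h1 => case2 ?_, fun h1 => ?_⟩
  · rcases le_total σ (M (v e) (v (e + 1))) with h2 | h2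
    · refine hσle.trans (le_sup_of_le_left (le_sup_of_le_left (le_sup_of_le_left
        (le_sup_of_le_left (le_sup_of_le_left (le_sup_right.trans' ?_))))))
      exact le_iSup₂_of_le (v (e + 1)) (v r)
        (le_iSup_of_le ⟨hT, hm, le_trans (by exact_mod_cast hB) hσle, h2⟩ le_rfl)
    · exact le_trans (by exact_mod_cast (by linarith)) (case2 h2)
  · rw [e1]
    exact le_trans (by exact_mod_cast (by linarith)) hσle
  · have h0 : 0 ≤ σ := le_trans (by exact_mod_cast (by linarith)) hσle
    have : ((H (r + 1) - H (e + 1) : ℝ) : EReal) ≤ -(M (v e) (v (e + 1))) + σ := by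
      rw [e1, show H (r + 1) - H (e + 1) = -(H (e + 1) - H e) + (H (r + 1) - H e) by ring,
        EReal.coe_add]
      exact add_le_add le_rfl hσle
    refine this.trans (le_sup_of_le_left (le_sup_of_le_left (le_sup_of_le_left
        (le_sup_right.trans' ?_))))
    exact le_iSup₂_of_le (v e) (v r) (le_iSup_of_le ⟨hT, hm, h0⟩ le_rfl)

end Path

lemma arcBoundedToMonotone_ne_top {B : ℝ} {M : Table n} {D : DS n} (hD : D.Sound M)
    (T : Finset (Fin n)) (p q : Fin n) : arcBoundedToMonotone B M D T p q ≠ ⊤ := by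
  have hfst : ∀ u v x, D.fst u v x + M x q ≠ ⊤ := fun u v x =>
    EReal.add_ne_top (hD.fst_ne_top u v x) (hD.ne_top x q)
  have hlst : ∀ u v x, M p x + D.lst x v u ≠ ⊤ := fun u v x =>
    EReal.add_ne_top (hD.ne_top p x) (hD.lst_ne_top x v u)
  refine max_ne_top (max_ne_top (max_ne_top (max_ne_top (max_ne_top (max_ne_top ?_ ?_) ?_) ?_) ?_)
    ?_) ?_
  · rw [hD.sc]; exact hD.ne_top p q
  · exact iSup_ne_top fun v => iSup_ne_top fun x => iSup_prop_ne_top fun _ => hfst p v x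
  · exact iSup_ne_top fun v => iSup_ne_top fun x => iSup_prop_ne_top fun _ => hD.ne_top p v
  · refine iSup_ne_top fun u => iSup_ne_top fun x => iSup_prop_ne_top fun h => ?_
    refine EReal.add_ne_top ?_ (hfst u p x)
    rw [Ne, EReal.neg_eq_top_iff]
    -- If the bounding arc were missing its negated gain would be infinite, but then the entry is -∞
    -- too and the condition fails.
    intro hbot
    rw [(hD.fst u p x).2 hbot, EReal.bot_add] at h
    simp at h
  · exact iSup_ne_top fun v => iSup_ne_top fun x => iSup_prop_ne_top fun _ => hlst q v x
  · exact iSup_ne_top fun v => iSup_ne_top fun x => iSup_prop_ne_top fun _ => hD.ne_top v q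
  · refine iSup_ne_top fun u => iSup_ne_top fun x => iSup_prop_ne_top fun h => ?_
    rw [sub_eq_add_neg]
    refine EReal.add_ne_top (hlst u q x) ?_
    rw [Ne, EReal.neg_eq_top_iff]
    intro hbot
    have : D.lst x q u = ⊥ := (hD.dual.fst u q x).2 hbot
    rw [this, EReal.add_bot] at h
    simp at h

lemma le_arcBoundedToMonotone {B : ℝ} {M : Table n} {D : DS n} (hD : D.Sound M)
    (T : Finset (Fin n)) : M ≤ arcBoundedToMonotone B M D T := by
  intro p q
  rw [← hD.sc]
  exact le_sup_of_le_left (le_sup_of_le_left (le_sup_of_le_left (le_sup_of_le_left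
      (le_sup_of_le_left (le_sup_left)))))

lemma arcBoundedToMonotone_dual (B : ℝ) (M : Table n) (D : DS n) (T : Finset (Fin n)) :
    arcBoundedToMonotone B M.tr D.dual T = (arcBoundedToMonotone B M D T).tr := by
  funext p q
  simp only [arcBoundedToMonotone, DS.dual, Table.tr, sub_eq_add_neg, add_comm]
  ac_rfl
end ElectricCar

/-! ### Candidate arcs, their extents, and the shortcuts that they yield. -/

namespace ElectricCar
variable {n : ℕ}

open Classical in
/-- The last position up to which the path stays in the range of the arc at `e`. -/
noncomputable def extent (H : ℕ → ℝ) (l e : ℕ) : ℕ := Nat.findGreatest (Within H e) (l - 1)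

/-- Descending arcs that start a closing funnel and are not too close to the end. -/
def Candidate (H : ℕ → ℝ) (l e : ℕ) : Prop := e + 3 ≤ l ∧ H (e + 1) < H e ∧ Closing H e

open Classical in
lemma Within.le_extent {H : ℕ → ℝ} {l e R : ℕ} (h : Within H e R) (hR : R ≤ l - 1) :
    R ≤ extent H l e := Nat.le_findGreatest hR h

open Classical in
lemma extent_le (H : ℕ → ℝ) (l e : ℕ) : extent H l e ≤ l - 1 := Nat.findGreatest_le _

lemma Candidate.within_two {H : ℕ → ℝ} {l e : ℕ} (h : Candidate H l e) : Within H e (e + 2) := by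
  obtain ⟨-, h2, h3⟩ := h
  intro k hk hk'
  obtain rfl | rfl | rfl : k = e ∨ k = e + 1 ∨ k = e + 2 := by omega
  · exact ⟨h2.le, le_rfl⟩
  · exact ⟨le_rfl, h2.le⟩
  · rcases h3 with h3 | h3
    · linarith [h3.1]
    · exact ⟨h3.2.1.le, h3.2.2⟩

lemma Candidate.le_extent {H : ℕ → ℝ} {l e : ℕ} (h : Candidate H l e) : e + 2 ≤ extent H l e :=
  h.within_two.le_extent (by have := h.1; omega)

open Classical in
lemma Candidate.within {H : ℕ → ℝ} {l e : ℕ} (h : Candidate H l e) :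
    Within H e (extent H l e) :=
  Nat.findGreatest_spec (m := e + 2) (by have := h.1; omega) h.within_two

open Classical in
lemma not_within_succ {H : ℕ → ℝ} {l e : ℕ} (h : extent H l e < l - 1) :
    ¬ Within H e (extent H l e + 1) :=
  Nat.findGreatest_is_greatest (Nat.lt_succ_self _) h

/-- For descending targets the last height may be lowered. -/
lemma exists_lowered {B : ℝ} {asc : Bool} {τ : ℝ} {l : ℕ} {H : ℕ → ℝ} (hl : 1 ≤ l)
    (h : Adm B asc τ l H) : ∃ h' : ℕ → ℝ, Adm B asc τ l h' ∧ (∀ k, k < l → h' k = H k) ∧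
      h' l ≤ H l ∧ (asc = false → ∀ c, (∀ a, a < l → H a + τ ≤ c) → h' l ≤ c) := by
  cases asc with
  | true => exact ⟨H, h, fun _ _ => rfl, le_rfl, by simp⟩
  | false =>
    obtain ⟨hτ, hd⟩ := h.2.2 rfl
    have hne : (Finset.range l).Nonempty := ⟨0, Finset.mem_range.2 hl⟩
    -- The least final height at which no drop to the end gets worse than `τ`. It is needed when a
    -- path ends within the range of a sampled arc, where only the gain of that arc is recorded.
    set c := (Finset.range l).sup' hne (fun a => H a + τ) with hc
    have hca : ∀ a, a < l → H a + τ ≤ c := fun a ha =>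
      Finset.le_sup' (fun a => H a + τ) (Finset.mem_range.2 ha)
    have hcl : ∀ d, (∀ a, a < l → H a + τ ≤ d) → c ≤ d := fun d hd =>
      Finset.sup'_le hne _ fun a ha => hd a (Finset.mem_range.1 ha)
    have key : ∀ a b, a ≤ b → b ≤ l →
        τ ≤ (fun k => if k = l then c else H k) b - (fun k => if k = l then c else H k) a := by
      intro a b hab hb
      simp only
      split_ifs with h1 h2 h2
      · have := hd 0 0 le_rfl (by omega); linarith
      · have := hca a (by omega); linarith
      · omega
      · exact hd a b hab hb
    refine ⟨fun k => if k = l then c else H k, ⟨fun a b hab hb => hτ.trans (key a b hab hb),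
      by simp, fun _ => ⟨hτ, key⟩⟩, fun k hk => if_neg hk.ne, ?_, fun _ d hd => ?_⟩
    · simp only [if_true]
      exact hcl _ fun a ha => by have := hd a l ha.le le_rfl; linarith
    · simp only [if_true]
      exact hcl d hd

/-- The shortcuts found from sampled candidates shorten the path. -/
lemma IsTracked.long_of_cover {B : ℝ} {asc : Bool} {τ : ℝ} {x y : Fin n} {M : Table n} {l : ℕ}
    {v : ℕ → Fin n} {H : ℕ → ℝ} (h : IsTracked B asc τ x y M l v H)
    {D D' : DS n} (hD : D.Sound M) (hK : KnowsFunnels D v H l) (hD' : D'.Sound M)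
    {T T' : Finset (Fin n)} {t : ℕ} (hle : ((longStep M T)^[t] D).Le D') (hT : T ⊆ T')
    (A : Finset ℕ) (hA : ∀ a ∈ A, ∃ e, Candidate H l e ∧ v e ∈ T ∧
      (cutsIn H e (extent H l e)).card ≤ t ∧ e ≤ a ∧ a < extent H l e) :
    ∃ k, HasPath B asc τ x y (arcBoundedToMonotone B M D' T') k ∧ 6 * k + A.card ≤ 6 * l := by
  classical
  rcases Nat.eq_zero_or_pos l with hl0 | hl0
  · have : A = ∅ := by
      apply Finset.eq_empty_of_forall_notMem
      intro a ha
      obtain ⟨e, he, -⟩ := hA a ha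
      have := he.1
      omega
    subst this
    refine ⟨l, HasPath.mono ⟨l, le_rfl, v, H, h⟩ (arcBoundedToMonotone_ne_top hD' T')
      (le_arcBoundedToMonotone hD' T'), by simp⟩
  obtain ⟨h', hadm, hlt, hl, hlow⟩ := exists_lowered hl0 h.adm
  set N := arcBoundedToMonotone B M D' T' with hN
  have hle' : ∀ b, b ≤ l → h' b ≤ H b := by
    intro b hb
    rcases eq_or_lt_of_le hb with rfl | hb
    · exact hl
    · exact (hlt b hb).le
  have lower : ∀ a b, a < l → b ≤ l → ((H b - H a : ℝ) : EReal) ≤ N (v a) (v b) →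
      ((h' b - h' a : ℝ) : EReal) ≤ N (v a) (v b) := by
    intro a b ha hb hg
    refine le_trans ?_ hg
    rw [hlt a ha]
    exact_mod_cast sub_le_sub_right (hle' b hb) _
  obtain ⟨k, φ, h0, hk, hφ, hc⟩ := exists_chain_of_cover
    (fun a b => ((h' b - h' a : ℝ) : EReal) ≤ N (v a) (v b)) l
    (fun a ha => lower a (a + 1) ha ha (h.coe_le (le_arcBoundedToMonotone hD' T') ha))
    -- The shift makes the position covered whether the jump starts at `e` or at `e + 1`.
    (A.image (· + 1)) (by
      intro d hd
      obtain ⟨a, ha, rfl⟩ := Finset.mem_image.1 hd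
      obtain ⟨e, he, heT, hcard, hea, hae⟩ := hA a ha
      have he3 := he.1
      have hx2 := he.le_extent
      have hxl := extent_le H l e
      set r := extent H l e with hr
      have hok : FstOK D' v H e r :=
        (fstOK_iterate_longStep h.exact hD hK heT he.2.1 (by omega) he.within
          (fun _ => he.2.2) t r (by omega) le_rfl hcard).mono hle
      obtain ⟨g1, g2, g3⟩ := arcBoundedToMonotone_le (B := B) h.exact (T := T') (e := e) (r := r)
        (by omega) (by omega) (hT heT) he.2.1 (h.adm.1 e (r + 1) (by omega) (by omega)) hok
      rcases le_or_gt (H e) (H (r + 1)) with hup | hup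
      · exact ⟨e + 1, r + 1, by omega, by omega, by omega, by omega,
          lower _ _ (by omega) (by omega) (g3 hup)⟩
      rcases le_or_gt (H (r + 1)) (H (e + 1)) with hdn | hdn
      · exact ⟨e, r + 1, by omega, by omega, by omega, by omega,
          lower _ _ (by omega) (by omega) (g1 hdn)⟩
      -- If the exit arc stays within the range, the extent was stopped only by the end of the path.
      have hrl : r = l - 1 := by
        by_contra hne
        refine not_within_succ (H := H) (l := l) (e := e) (by omega) ?_
        rw [← hr]
        intro k hk hk'
        rcases eq_or_lt_of_le hk' with rfl | hk''
        · exact ⟨hdn.le, hup.le⟩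
        · exact he.within k hk (by omega)
      refine ⟨e, r + 1, by omega, by omega, by omega, by omega, ?_⟩
      have hrl' : r + 1 = l := by omega
      cases asc with
      | true =>
        have := ((h.adm.2.1 rfl).1 e (by omega)).2
        rw [hrl'] at hup
        linarith
      | false =>
        have hd := (h.adm.2.2 rfl).2
        refine le_trans ?_ (g2 hdn.le)
        rw [hlt e (by omega), hrl']
        -- Every earlier height plus `τ` is at most `H (e + 1)`: up to `e + 1` by admissibility, and
        -- later because those heights do not exceed `H e`.
        have : h' l ≤ H (e + 1) := by
          refine hlow rfl _ fun a ha => ?_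
          rcases le_or_gt a (e + 1) with hae' | hae'
          · have := hd a (e + 1) hae' (by omega); linarith
          · have h1 := hd e (e + 1) (by omega) (by omega)
            have h2 := (he.within a (by omega) (by omega)).2
            linarith
        exact_mod_cast sub_le_sub_right this _)
  refine ⟨k, hasPath_of_chain (arcBoundedToMonotone_ne_top hD' T') h.source h.target h.inj hadm
    h0 hk hφ, ?_⟩
  rwa [Finset.card_image_of_injective _ (add_left_injective 1)] at hc

/-! ### Counting -/

open Classical in
noncomputable def candidates (H : ℕ → ℝ) (l : ℕ) : Finset ℕ :=
  (Finset.range l).filter (Candidate H l)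

lemma mem_candidates {H : ℕ → ℝ} {l e : ℕ} : e ∈ candidates H l ↔ Candidate H l e := by
  simp only [candidates, Finset.mem_filter, Finset.mem_range]
  exact ⟨fun h => h.2, fun h => ⟨by have := h.1; omega, h⟩⟩

-- A closing pair that starts downwards is a candidate; if it starts upwards, the next pair is a
-- candidate or a cut. Only the last two positions escape.
open Classical in
lemma card_closing_le (H : ℕ → ℝ) (l : ℕ) :
    ((Finset.range (l - 1)).filter (Closing H)).card ≤
      2 * (candidates H l).card + (cuts H l).card + 2 := by
  have hsub : (Finset.range (l - 1)).filter (Closing H) ⊆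
      candidates H l ∪ ((candidates H l ∪ cuts H l).image (· - 1) ∪ {l - 2, l - 3}) := by
    intro f hf
    simp only [Finset.mem_filter, Finset.mem_range] at hf
    obtain ⟨hfl, hc⟩ := hf
    by_cases hlast : f + 4 ≤ l
    · rcases le_or_gt (H f) (H (f + 1)) with hup | hdn
      · refine Finset.mem_union_right _ (Finset.mem_union_left _ ?_)
        refine Finset.mem_image.2 ⟨f + 1, ?_, by simp⟩
        by_cases hcut : Cut H (f + 1)
        · refine Finset.mem_union_right _ ?_
          simp only [cuts, Finset.mem_filter, Finset.mem_range]
          exact ⟨by omega, hcut⟩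
        · refine Finset.mem_union_left _ (mem_candidates.2 ⟨by omega, ?_, hc.not_cut_next hcut⟩)
          rcases hc with hc | hc
          · exact hc.2.1
          · linarith [hc.1]
      · exact Finset.mem_union_left _ (mem_candidates.2 ⟨by omega, hdn, hc⟩)
    · refine Finset.mem_union_right _ (Finset.mem_union_right _ ?_)
      simp only [Finset.mem_insert, Finset.mem_singleton]
      omega
  have h1 := Finset.card_le_card hsub
  have h2 := Finset.card_union_le (candidates H l)
    ((candidates H l ∪ cuts H l).image (· - 1) ∪ {l - 2, l - 3})
  have h3 := Finset.card_union_le ((candidates H l ∪ cuts H l).image (· - 1)) {l - 2, l - 3}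
  have h4 : ((candidates H l ∪ cuts H l).image (· - 1)).card ≤ _ := Finset.card_image_le
  have h5 := Finset.card_union_le (candidates H l) (cuts H l)
  have h6 : ({l - 2, l - 3} : Finset ℕ).card ≤ 2 := Finset.card_le_two
  omega

open Classical in
/-- A path or its reverse has many closing pairs. -/
lemma card_closing_add_closing_tr (H : ℕ → ℝ) (l : ℕ) :
    l - 1 ≤ ((Finset.range (l - 1)).filter (Closing H)).card +
      ((Finset.range (l - 1)).filter (Closing (fun i => -H (l - i)))).card + (cuts H l).card := by
  have hsub : Finset.range (l - 1) ⊆ (Finset.range (l - 1)).filter (Closing H) ∪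
      (((Finset.range (l - 1)).filter (Closing (fun i => -H (l - i)))).image (fun f => l - 2 - f) ∪
        cuts H l) := by
    intro f hf
    have hf' := Finset.mem_range.1 hf
    rcases closing_or_opening_or_sameSign H f with h | h | h
    · exact Finset.mem_union_left _ (Finset.mem_filter.2 ⟨hf, h⟩)
    · refine Finset.mem_union_right _ (Finset.mem_union_left _ (Finset.mem_image.2
        ⟨l - 2 - f, Finset.mem_filter.2 ⟨Finset.mem_range.2 (by omega), closing_tr (by omega) ?_⟩,
          by omega⟩))
      rw [show l - 2 - (l - 2 - f) = f by omega]
      exact h.weak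
    · exact Finset.mem_union_right _ (Finset.mem_union_right _ (Finset.mem_filter.2 ⟨hf, Or.inl h⟩))
  have h1 := Finset.card_le_card hsub
  rw [Finset.card_range] at h1
  have h2 := Finset.card_union_le ((Finset.range (l - 1)).filter (Closing H))
    (((Finset.range (l - 1)).filter (Closing (fun i => -H (l - i)))).image (fun f => l - 2 - f) ∪
        cuts H l)
  have h3 := Finset.card_union_le (((Finset.range (l - 1)).filter
    (Closing (fun i => -H (l - i)))).image (fun f => l - 2 - f)) (cuts H l)
  have h4 : (((Finset.range (l - 1)).filter
    (Closing (fun i => -H (l - i)))).image (fun f => l - 2 - f)).card ≤ _ := Finset.card_image_le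
  omega

/-- Every candidate sees a cut or the end of the path. -/
lemma Candidate.exists_cut {H : ℕ → ℝ} {l e : ℕ} (h : Candidate H l e) :
    ∃ j ∈ insert (l - 2) (cuts H l), e ≤ j ∧ j < extent H l e := by
  classical
  have hel := h.1
  have within_of_funnel : ∀ r, e + 2 ≤ r → Funnel H e r → Within H e r := fun r hr hF k hk hkr =>
    hF.bounded h.2.1 hk hkr (by omega)
  by_cases hex : ∃ f, e < f ∧ f + 2 ≤ l ∧ Cut H f
  · obtain ⟨h1, h2, h3⟩ := Nat.find_spec hex
    set j := Nat.find hex with hj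
    refine ⟨j, Finset.mem_insert_of_mem ?_, h1.le, ?_⟩
    · simp only [cuts, Finset.mem_filter, Finset.mem_range]
      exact ⟨by omega, h3⟩
    · have : Within H e (j + 1) := by
        refine within_of_funnel _ (by omega) fun f hf => ?_
        induction f, hf using Nat.le_induction with
        | base => exact fun _ => h.2.2
        | succ f hf ih =>
          intro hf'
          refine (ih (by omega)).not_cut_next fun hc => ?_
          exact Nat.find_min hex (m := f + 1) (by omega) ⟨by omega, by omega, hc⟩
      exact this.le_extent (by omega)
  · push Not at hex
    refine ⟨l - 2, Finset.mem_insert_self _ _, by omega, ?_⟩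
    have : Within H e (l - 1) := by
      refine within_of_funnel _ (by omega) fun f hf => ?_
      induction f, hf using Nat.le_induction with
      | base => exact fun _ => h.2.2
      | succ f hf ih =>
        exact fun hf' => (ih (by omega)).not_cut_next (hex (f + 1) (by omega) (by omega))
    have := this.le_extent (l := l) le_rfl
    omega

open Classical in
/-- There is a scale with many candidates, most of which lie in the extents of many others. -/
lemma exists_scale (H : ℕ → ℝ) (l I : ℕ) (hI1 : 1 ≤ I) (hI : (cuts H l).card + 1 ≤ 2 ^ I) (θ : ℝ)
    (hθ : 0 ≤ θ) : ∃ i, 1 ≤ i ∧ i ≤ I ∧ ∃ A : Finset ℕ, A ⊆ candidates H l ∧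
      (candidates H l).card ≤ I * (A.card + 2 * θ * ((cuts H l).card + 1)) ∧
      ∀ a ∈ A, 2 ^ i * θ ≤ (((candidates H l).filter fun e =>
        (cutsIn H e (extent H l e)).card ≤ 2 ^ i ∧ e ≤ a ∧ a < extent H l e).card : ℝ) := by
  -- The position `l - 2` stands for the end of the path, so that every extent contains a point of
  -- `Q`. The scale i of a candidate satisfies 2^(i-1) ≤ N e ≤ 2^i, and some scale holds a fraction
  -- 1/I of all candidates.
  set Q := insert (l - 2) (cuts H l) with hQ
  have hQc : Q.card ≤ (cuts H l).card + 1 := Finset.card_insert_le _ _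
  set N : ℕ → ℕ := fun e => (Q.filter fun j => e ≤ j ∧ j < extent H l e).card with hN
  have hN1 : ∀ e ∈ candidates H l, 1 ≤ N e := by
    intro e he
    obtain ⟨j, hj, h1, h2⟩ := (mem_candidates.1 he).exists_cut
    exact Finset.card_pos.2 ⟨j, Finset.mem_filter.2 ⟨hj, h1, h2⟩⟩
  have hNI : ∀ e, N e ≤ 2 ^ I := fun e => (Finset.card_filter_le _ _).trans (hQc.trans hI)
  have hcutsIn : ∀ e ∈ candidates H l, (cutsIn H e (extent H l e)).card ≤ N e := by
    intro e he
    apply Finset.card_le_card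
    intro j hj
    simp only [cutsIn, Finset.mem_filter, Finset.mem_range] at hj
    refine Finset.mem_filter.2 ⟨Finset.mem_insert_of_mem ?_, by omega, by omega⟩
    simp only [cuts, Finset.mem_filter, Finset.mem_range]
    have := extent_le H l e
    exact ⟨by omega, hj.2.2.2⟩
  set s : ℕ → ℕ := fun e => max 1 (Nat.clog 2 (N e)) with hs
  have hsI : ∀ e ∈ candidates H l, s e ∈ Finset.Icc 1 I := by
    intro e _
    rw [Finset.mem_Icc]
    refine ⟨le_max_left _ _, max_le hI1 ?_⟩
    exact Nat.clog_le_of_le_pow (hNI e)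
  have hs2 : ∀ e, N e ≤ 2 ^ s e := fun e => (Nat.le_pow_clog (by norm_num) _).trans
    (Nat.pow_le_pow_right (by norm_num) (le_max_right _ _))
  have hs1 : ∀ e ∈ candidates H l, 2 ^ (s e - 1) ≤ N e := by
    intro e he
    by_cases h2 : 2 ≤ N e
    · have h3 : 0 < Nat.clog 2 (N e) := Nat.clog_pos (by norm_num) h2
      have h4 := Nat.pow_pred_clog_lt_self (b := 2) (by norm_num) (x := N e) h2
      have h5 : s e = Nat.clog 2 (N e) := max_eq_right h3
      rw [h5]
      exact h4.le
    · have h1 := hN1 e he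
      have h3 : N e = 1 := by omega
      simp [hs, h3]
  obtain ⟨i, hi, hic⟩ : ∃ i ∈ Finset.Icc 1 I,
      (candidates H l).card ≤ I * ((candidates H l).filter fun e => s e = i).card := by
    by_contra hcon
    push Not at hcon
    have h1 := Finset.card_eq_sum_card_fiberwise (f := s) (s := candidates H l)
      (t := Finset.Icc 1 I) hsI
    have h2 : ∑ i ∈ Finset.Icc 1 I, I * ((candidates H l).filter fun e => s e = i).card <
        ∑ _i ∈ Finset.Icc 1 I, (candidates H l).card :=
      Finset.sum_lt_sum_of_nonempty ⟨1, Finset.mem_Icc.2 ⟨le_rfl, hI1⟩⟩ hcon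
    rw [← Finset.mul_sum, ← h1, Finset.sum_const, Nat.card_Icc] at h2
    simp at h2
  rw [Finset.mem_Icc] at hi
  set X := (candidates H l).filter fun e => s e = i with hX
  set deg : ℕ → ℕ := fun a => (X.filter fun e => e ≤ a ∧ a < extent H l e).card with hdeg
  -- The shallow candidates lie in few extents of their own scale. Each such extent contains at
  -- least 2^(i-1) points of `Q`, so `mul_card_le_of_shallow` leaves at most 2θ|Q| of them.
  set S := X.filter fun a => (deg a : ℝ) < 2 ^ i * θ with hS
  have hSX : S ⊆ X := Finset.filter_subset _ _
  have hXc : X ⊆ candidates H l := Finset.filter_subset _ _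
  have hshallow := mul_card_le_of_shallow (extent H l) (2 ^ (i - 1)) (2 ^ i * θ) (by positivity)
    S Q (fun e he => by
      have := (mem_candidates.1 (hXc (hSX he))).le_extent; omega) (by
    intro e he
    have h1 := hs1 e (hXc (hSX he))
    rw [(Finset.mem_filter.1 (hSX he)).2] at h1
    exact_mod_cast h1) (by
    intro a ha
    refine le_trans ?_ (Finset.mem_filter.1 ha).2.le
    norm_cast
    apply Finset.card_le_card
    intro e he
    rw [Finset.mem_filter] at he ⊢
    exact ⟨hSX he.1, he.2⟩)
  have hSc : (S.card : ℝ) ≤ 2 * θ * ((cuts H l).card + 1) := by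
    have hp : (2 : ℝ) ^ i = 2 ^ (i - 1) * 2 := by rw [← pow_succ]; congr 1; omega
    rw [hp] at hshallow
    have hpos : (0 : ℝ) < 2 ^ (i - 1) := by positivity
    have : (S.card : ℝ) ≤ 2 * θ * Q.card := by
      refine le_of_mul_le_mul_left (hshallow.trans (le_of_eq ?_)) hpos
      ring
    refine this.trans ?_
    have : (Q.card : ℝ) ≤ (cuts H l).card + 1 := by exact_mod_cast hQc
    gcongr
  refine ⟨i, hi.1, hi.2, X \ S, Finset.sdiff_subset.trans hXc, ?_, ?_⟩
  · have h1 : ((candidates H l).card : ℝ) ≤ I * X.card := by exact_mod_cast hic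
    have h2 : (X.card : ℝ) = (X \ S).card + S.card := by
      exact_mod_cast (Finset.card_sdiff_add_card_eq_card hSX).symm
    refine h1.trans ?_
    rw [h2]
    gcongr
  · intro a ha
    rw [Finset.mem_sdiff] at ha
    have h1 : 2 ^ i * θ ≤ (deg a : ℝ) := by
      by_contra hcon
      exact ha.2 (Finset.mem_filter.2 ⟨ha.1, not_le.1 hcon⟩)
    refine h1.trans ?_
    norm_cast
    apply Finset.card_le_card
    intro e he
    rw [Finset.mem_filter] at he ⊢
    refine ⟨hXc he.1, ?_, he.2⟩
    have h2 := hs2 e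
    rw [(Finset.mem_filter.1 he.1).2] at h2
    exact (hcutsIn e (hXc he.1)).trans h2
end ElectricCar

namespace ElectricCar
open scoped ENNReal
variable {n : ℕ}

/-! ### Randomness -/

section Random
variable {α β : Type}

/-- The mean of a nonnegative quantity. -/
noncomputable def mean (p : PMF α) (f : α → ℝ≥0∞) : ℝ≥0∞ := ∑' a, p a * f a

lemma mean_pure (a : α) (f : α → ℝ≥0∞) : mean (PMF.pure a) f = f a := by
  rw [mean, tsum_eq_single a (fun b hb => by simp [PMF.pure_apply, hb])]
  simp

lemma mean_bind (p : PMF α) (g : α → PMF β) (f : β → ℝ≥0∞) :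
    mean (p.bind g) f = mean p fun a => mean (g a) f := by
  simp only [mean, PMF.bind_apply, ← ENNReal.tsum_mul_right, ← ENNReal.tsum_mul_left]
  rw [ENNReal.tsum_comm]
  simp only [mul_assoc]

lemma mean_le_mean {p : PMF α} {f g : α → ℝ≥0∞} (h : ∀ a ∈ p.support, f a ≤ g a) :
    mean p f ≤ mean p g := by
  refine ENNReal.tsum_le_tsum fun a => ?_
  by_cases ha : a ∈ p.support
  · exact mul_le_mul_right (h a ha) _
  · rw [PMF.mem_support_iff, not_not] at ha
    simp [ha]

lemma mean_const (p : PMF α) (c : ℝ≥0∞) : mean p (fun _ => c) = c := by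
  rw [mean, ENNReal.tsum_mul_right, PMF.tsum_coe, one_mul]

lemma mean_le_const {p : PMF α} {f : α → ℝ≥0∞} {c : ℝ≥0∞} (h : ∀ a ∈ p.support, f a ≤ c) :
    mean p f ≤ c := (mean_le_mean h).trans (mean_const p c).le

lemma mean_add (p : PMF α) (f g : α → ℝ≥0∞) :
    mean p (fun a => f a + g a) = mean p f + mean p g := by
  simp only [mean, mul_add, ENNReal.tsum_add]

lemma mean_mul_left (p : PMF α) (f : α → ℝ≥0∞) (c : ℝ≥0∞) :
    mean p (fun a => c * f a) = c * mean p f := by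
  simp only [mean, ← ENNReal.tsum_mul_left]
  congr 1; ext a; ring

lemma toOuterMeasure_eq_mean (p : PMF α) (s : Set α) :
    p.toOuterMeasure s = mean p (s.indicator 1) := by
  rw [PMF.toOuterMeasure_apply, mean]
  congr 1; ext a
  by_cases ha : a ∈ s <;> simp [ha]

lemma toOuterMeasure_bind (p : PMF α) (g : α → PMF β) (s : Set β) :
    (p.bind g).toOuterMeasure s = mean p fun a => (g a).toOuterMeasure s := by
  simp only [toOuterMeasure_eq_mean, mean_bind]

/-- The failure probability of a composition. -/
lemma toOuterMeasure_bind_le {p : PMF α} {g : α → PMF β} {s : Set α} {t : Set β} {ε : ℝ≥0∞}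
    (h : ∀ a ∈ p.support, a ∉ s → (g a).toOuterMeasure t ≤ ε) :
    (p.bind g).toOuterMeasure t ≤ p.toOuterMeasure s + ε := by
  rw [toOuterMeasure_bind, toOuterMeasure_eq_mean]
  have : mean p (s.indicator 1) + ε = mean p fun a => s.indicator 1 a + ε := by
    rw [mean_add, mean_const]
  rw [this]
  refine mean_le_mean fun a ha => ?_
  by_cases has : a ∈ s
  · have : (g a).toOuterMeasure t ≤ 1 := by
      rw [toOuterMeasure_eq_mean]
      exact mean_le_const fun b _ => Set.indicator_le_self' (by simp) b
    simpa [has] using this.trans le_self_add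
  · simpa [has] using h a ha has

lemma toOuterMeasure_le_of_support {p : PMF α} {s t : Set α}
    (h : ∀ a ∈ p.support, a ∈ s → a ∈ t) : p.toOuterMeasure s ≤ p.toOuterMeasure t :=
  PMF.toOuterMeasure_mono p fun a ha => h a ha.2 ha.1

end Random

lemma mean_coin (q : ℝ) (f : Bool → ℝ≥0∞) : mean (coin q) f =
    min 1 (ENNReal.ofReal q) * f true + (1 - min 1 (ENNReal.ofReal q)) * f false := by
  rw [mean, tsum_bool, add_comm]
  rfl

lemma one_sub_min_le_exp (q : ℝ) :
    1 - min 1 (ENNReal.ofReal q) ≤ ENNReal.ofReal (Real.exp (-q)) := by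
  rcases le_total 1 (ENNReal.ofReal q) with h | h
  · simp [min_eq_left h]
  · rw [min_eq_right h]
    rcases le_total q 0 with hq | hq
    · rw [ENNReal.ofReal_of_nonpos hq, tsub_zero, ← ENNReal.ofReal_one]
      exact ENNReal.ofReal_le_ofReal (Real.one_le_exp (by linarith))
    · rw [← ENNReal.ofReal_one, ← ENNReal.ofReal_sub _ hq]
      exact ENNReal.ofReal_le_ofReal (Real.one_sub_le_exp_neg q)

open Classical in
lemma sampleFrom_disjoint_le (q : ℝ) (A : Finset (Fin n)) (L : List (Fin n)) :
    (sampleFrom q L).toOuterMeasure {S | Disjoint A S} ≤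
      (1 - min 1 (ENNReal.ofReal q)) ^ (L.filter (· ∈ A)).length := by
  induction L with
  | nil =>
    rw [toOuterMeasure_eq_mean]
    simpa using mean_le_const fun b _ => Set.indicator_le_self' (by simp) b
  | cons a L ih =>
    rw [sampleFrom, toOuterMeasure_bind, mean_coin, PMF.toOuterMeasure_map_apply,
      PMF.toOuterMeasure_map_apply]
    by_cases ha : a ∈ A
    · have h1 : (fun S => if true = true then insert a S else S) ⁻¹' {S | Disjoint A S} = ∅ := by
        ext S
        simp [ha]
      rw [h1]
      have : (List.filter (· ∈ A) (a :: L)).length = (L.filter (· ∈ A)).length + 1 := by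
        simp [ha]
      rw [this, pow_succ']
      simpa using mul_le_mul_right ih _
    · have h1 : (fun S => if true = true then insert a S else S) ⁻¹' {S | Disjoint A S} =
          {S | Disjoint A S} := by
        ext S
        simp [ha]
      have : (List.filter (· ∈ A) (a :: L)).length = (L.filter (· ∈ A)).length := by
        simp [ha]
      rw [h1, this]
      have h2 : (fun S : Finset (Fin n) => if false = true then insert a S else S) ⁻¹'
          {S | Disjoint A S} = {S | Disjoint A S} := by
        ext S; simp
      rw [h2, ← add_mul, add_tsub_cancel_of_le (min_le_left _ _), one_mul]
      exact ih

/-- With high probability a random sample hits every large set of a small family. -/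
lemma sampleVertices_miss_le (q c : ℝ) (hq : 0 ≤ q) (F : Finset (Finset (Fin n)))
    (hF : ∀ A ∈ F, c ≤ (A.card : ℝ)) :
    (sampleVertices n q).toOuterMeasure {S | ∃ A ∈ F, Disjoint A S} ≤
      F.card * ENNReal.ofReal (Real.exp (-(q * c))) := by
  classical
  have h1 : {S : Finset (Fin n) | ∃ A ∈ F, Disjoint A S} = ⋃ A ∈ F, {S | Disjoint A S} := by
    ext S; simp
  rw [h1]
  refine (MeasureTheory.measure_biUnion_finset_le F _).trans ?_
  rw [← nsmul_eq_mul]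
  refine Finset.sum_le_card_nsmul _ _ _ fun A hA => ?_
  refine (sampleFrom_disjoint_le q A _).trans ?_
  have hlen : ((List.finRange n).filter (· ∈ A)).length = A.card := by
    rw [← List.toFinset_card_of_nodup ((List.nodup_finRange n).filter _)]
    congr 1; ext a; simp
  have hlen' : ((List.finRange n).filter fun x => decide (x ∈ A)).length = A.card := by
    convert hlen
  rw [hlen']
  refine (pow_le_pow_left' (one_sub_min_le_exp q) _).trans ?_
  rw [← ENNReal.ofReal_pow (Real.exp_nonneg _), ← Real.exp_nat_mul]
  refine ENNReal.ofReal_le_ofReal (Real.exp_le_exp.2 ?_)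
  have := mul_le_mul_of_nonneg_left (hF A hA) hq
  linarith

/-! ### Logarithms -/

lemma one_le_lg (hn : 2 ≤ n) : 1 ≤ lg n := by
  rw [lg, Real.le_logb_iff_rpow_le (by norm_num) (by positivity)]
  simpa using hn

lemma log_le_lg (hn : 2 ≤ n) : Real.log n ≤ lg n := by
  rw [lg, Real.logb, le_div_iff₀ (Real.log_pos (by norm_num))]
  have h1 : Real.log 2 ≤ 1 := Real.log_two_lt_d9.le.trans (by norm_num)
  have h2 : 0 ≤ Real.log n := Real.log_nonneg (by norm_cast; omega)
  nlinarith

lemma le_two_pow_ceil_lg : n ≤ 2 ^ ⌈lg n⌉₊ := by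
  rcases Nat.eq_zero_or_pos n with rfl | hn
  · simp
  have h : (n : ℝ) ≤ (2 : ℝ) ^ (⌈lg n⌉₊ : ℝ) := by
    rw [← Real.logb_le_iff_le_rpow (by norm_num) (by exact_mod_cast hn)]
    exact Nat.le_ceil _
  rw [Real.rpow_natCast] at h
  exact_mod_cast h

lemma logb_two_le_self {x : ℝ} (hx : 1 ≤ x) : Real.logb 2 x ≤ x := by
  rw [Real.logb_le_iff_le_rpow (by norm_num) (by linarith)]
  have := one_add_mul_self_le_rpow_one_add (s := 1) (by norm_num) hx
  norm_num at this
  linarith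

/-- The number of scales. -/
noncomputable def scales (n : ℕ) : ℕ := ⌈Real.logb 2 ((n : ℝ) ^ (1 / 2 : ℝ) * lg n ^ 2)⌉₊

lemma one_lt_sqrt (hn : 2 ≤ n) : 1 < (n : ℝ) ^ (1 / 2 : ℝ) :=
  Real.one_lt_rpow (by exact_mod_cast hn) (by norm_num)

lemma one_le_scales (hn : 2 ≤ n) : 1 ≤ scales n := by
  have h1 := one_lt_sqrt hn
  have h2 := one_le_lg hn
  rw [scales, Nat.one_le_ceil_iff]
  refine Real.logb_pos (by norm_num) ?_
  have : 1 ≤ lg n ^ 2 := one_le_pow₀ h2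
  nlinarith

lemma sqrt_le_two_pow_scales (hn : 2 ≤ n) : (n : ℝ) ^ (1 / 2 : ℝ) ≤ 2 ^ scales n := by
  have h1 := one_lt_sqrt hn
  have h2 : 1 ≤ lg n ^ 2 := one_le_pow₀ (one_le_lg hn)
  have h3 : (n : ℝ) ^ (1 / 2 : ℝ) * lg n ^ 2 ≤ (2 : ℝ) ^ (scales n : ℝ) := by
    rw [← Real.logb_le_iff_le_rpow (by norm_num) (by positivity)]
    exact Nat.le_ceil _
  rw [Real.rpow_natCast] at h3
  nlinarith

lemma scales_le (hn : 2 ≤ n) : (scales n : ℝ) ≤ 4 * lg n := by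
  have h1 := one_lt_sqrt hn
  have h2 := one_le_lg hn
  have h3 : Real.logb 2 ((n : ℝ) ^ (1 / 2 : ℝ) * lg n ^ 2) = lg n / 2 + 2 * Real.logb 2 (lg n) := by
    rw [Real.logb_mul (by positivity) (by positivity), Real.logb_rpow_eq_mul_logb_of_pos
      (by positivity), Real.logb_pow]
    rw [← lg]
    push_cast
    ring
  have h4 := logb_two_le_self h2
  have h5 : 0 ≤ Real.logb 2 (lg n) := Real.logb_nonneg (by norm_num) h2
  rw [scales, h3]
  have := Nat.ceil_lt_add_one (a := lg n / 2 + 2 * Real.logb 2 (lg n)) (by positivity)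
  linarith

/-- The binary logarithm is at least the natural one, so the exponential is at most n^(-4). -/
lemma union_bound (hn : 2 ≤ n) {m : ℕ} (hm : m ≤ n) {x : ℝ} (hx : 4 * lg n ≤ x) :
    (m : ℝ≥0∞) * ENNReal.ofReal (Real.exp (-x)) ≤ 1 / 4 := by
  have hn0 : (0 : ℝ) < n := by positivity
  have h2 : (2 : ℝ) ≤ n := by exact_mod_cast hn
  have h1 : Real.exp (-x) ≤ ((n : ℝ) ^ 4)⁻¹ := by
    rw [← Real.exp_log (inv_pos.2 (pow_pos hn0 4)), Real.log_inv, Real.log_pow]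
    refine Real.exp_le_exp.2 ?_
    have := log_le_lg hn
    push_cast
    linarith
  have h3 : (m : ℝ) * Real.exp (-x) ≤ 1 / 4 := by
    have hmn : (m : ℝ) ≤ n := by exact_mod_cast hm
    calc (m : ℝ) * Real.exp (-x) ≤ n * ((n : ℝ) ^ 4)⁻¹ := by gcongr
      _ = ((n : ℝ) ^ 3)⁻¹ := by field_simp
      _ ≤ ((2 : ℝ) ^ 3)⁻¹ := by gcongr
      _ ≤ 1 / 4 := by norm_num
  calc (m : ℝ≥0∞) * ENNReal.ofReal (Real.exp (-x)) = ENNReal.ofReal (m * Real.exp (-x)) := by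
        rw [ENNReal.ofReal_mul (by positivity), ENNReal.ofReal_natCast]
    _ ≤ ENNReal.ofReal (1 / 4) := ENNReal.ofReal_le_ofReal h3
    _ = 1 / 4 := by
      rw [ENNReal.ofReal_div_of_pos (by norm_num)]
      simp
end ElectricCar

namespace ElectricCar
open scoped ENNReal
variable {n : ℕ}

/-! ### Compute-Funnels -/

lemma computeFunnels_eq (κ : Constants) (M : Table n) : computeFunnels κ M =
    (sampleVertices n (κ.funnelSample * lg n * (⌈κ.funnel * (n : ℝ) ^ (2 / 3 : ℝ)⌉₊ : ℕ) / n)).map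
      (funnelsFrom M ⌈(n : ℝ) / (⌈κ.funnel * (n : ℝ) ^ (2 / 3 : ℝ)⌉₊ : ℕ)⌉₊ ⌈lg n⌉₊) := rfl

lemma computeFunnels_sound (κ : Constants) {M : Table n} (hM : ∀ x y, M x y ≠ ⊤) {D : DS n}
    (hD : D ∈ (computeFunnels κ M).support) : D.Sound M := by
  rw [computeFunnels_eq, PMF.support_map] at hD
  obtain ⟨S, -, rfl⟩ := hD
  exact funnelsFrom_sound hM _ _ _

lemma computeFunnels_tr (κ : Constants) (M : Table n) :
    computeFunnels κ M.tr = (computeFunnels κ M).map DS.dual := by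
  rw [computeFunnels_eq, computeFunnels_eq, PMF.map_comp]
  congr 1
  ext1 S
  exact funnelsFrom_dual M _ _ S

lemma lt_of_injOn {l : ℕ} {v : ℕ → Fin n} (hinj : Set.InjOn v (Set.Iic l)) : l < n := by
  have h : ((Finset.range (l + 1)).image v).card = l + 1 := by
    rw [Finset.card_image_of_injOn, Finset.card_range]
    intro a ha b hb hab
    simp only [Finset.coe_range, Set.mem_Iio] at ha hb
    exact hinj (Set.mem_Iic.2 (by omega)) (Set.mem_Iic.2 (by omega)) hab
  have := Finset.card_le_univ ((Finset.range (l + 1)).image v)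
  rw [h, Fintype.card_fin] at this
  omega

/-- The sets to hit are the windows of k positions at even offsets, at most n of them. As k ≥
n/(2s), the sampling rate times the window size is at least 4 log n, which suffices for
`union_bound`. -/
lemma computeFunnels_fail_le {κ : Constants} (hn : 2 ≤ n) (hf : 0 < κ.funnel)
    (hs : 8 ≤ κ.funnelSample) {M : Table n} (hM : ∀ x y, M x y ≠ ⊤) {l : ℕ} {v : ℕ → Fin n}
    {H : ℕ → ℝ} (hinj : Set.InjOn v (Set.Iic l)) (hex : Exact M v l H) :
    (computeFunnels κ M).toOuterMeasure {D | ¬ KnowsFunnels D v H l} ≤ 1 / 4 := by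
  classical
  have hln := lt_of_injOn hinj
  have hn0 : (0 : ℝ) < n := by positivity
  have hlg := one_le_lg hn
  rw [computeFunnels_eq, PMF.toOuterMeasure_map_apply]
  set s := ⌈κ.funnel * (n : ℝ) ^ (2 / 3 : ℝ)⌉₊ with hsdef
  have hs1 : 1 ≤ s := by
    rw [hsdef, Nat.one_le_ceil_iff]
    positivity
  have hs0 : (0 : ℝ) < s := by exact_mod_cast hs1
  set L := ⌈(n : ℝ) / s⌉₊ with hL
  have hL1 : 1 ≤ L := by
    rw [hL, Nat.one_le_ceil_iff]
    positivity
  -- The longest window compatible with the condition 2k ≤ L + 1 of `fstOK_funnelsFrom`.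
  set k := (L + 1) / 2 with hk
  have hkn : (n : ℝ) / (2 * s) ≤ k := by
    have h1 : (n : ℝ) / s ≤ L := Nat.le_ceil _
    have h2 : (L : ℝ) ≤ 2 * k := by
      have : L ≤ 2 * k := by omega
      exact_mod_cast this
    rw [mul_comm, ← div_div]
    linarith
  set F : Finset (Finset (Fin n)) := ((Finset.range (l + 1)).filter fun i => i + 2 * (k - 1) ≤ l).image
    fun i => (Finset.range k).image fun j => v (i + 2 * j) with hF
  have hFc : F.card ≤ n := by
    refine Finset.card_image_le.trans ((Finset.card_filter_le _ _).trans ?_)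
    rw [Finset.card_range]
    omega
  refine le_trans (toOuterMeasure_le_of_support (t := {S | ∃ A ∈ F, Disjoint A S}) ?_)
    ((sampleVertices_miss_le _ k (by positivity) F ?_).trans (union_bound hn hFc ?_))
  · intro S _ hS
    by_contra hcon
    refine hS ?_
    have hit : ∀ i, i + 2 * (k - 1) ≤ l → ∃ j, j < k ∧ v (i + 2 * j) ∈ S := by
      intro i hi
      by_contra hno
      push Not at hno
      refine hcon ⟨_, Finset.mem_image_of_mem _ (Finset.mem_filter.2
        ⟨Finset.mem_range.2 (by omega), hi⟩), ?_⟩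
      rw [Finset.disjoint_left]
      intro a ha haS
      obtain ⟨j, hj, rfl⟩ := Finset.mem_image.1 ha
      exact hno j (Finset.mem_range.1 hj) haS
    have hle : l ≤ 2 ^ ⌈lg n⌉₊ := hln.le.trans le_two_pow_ceil_lg
    exact ⟨fun e r her hr hFu => fstOK_funnelsFrom hM hex (by omega) (by omega) hle hit her hr hFu,
      fun e r her hr hFu => lstOK_funnelsFrom hM hex (by omega) (by omega) hle hit her hr hFu⟩
  · intro A hA
    obtain ⟨i, hi, rfl⟩ := Finset.mem_image.1 hA
    rw [Finset.mem_filter] at hi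
    rw [Finset.card_image_of_injOn, Finset.card_range]
    intro a ha b hb hab
    simp only [Finset.coe_range, Set.mem_Iio] at ha hb
    have := hinj (Set.mem_Iic.2 (by omega)) (Set.mem_Iic.2 (by omega)) hab
    omega
  · calc 4 * lg n = 8 * lg n * s / n * (n / (2 * s)) := by field_simp; norm_num
      _ ≤ κ.funnelSample * lg n * s / n * k := by gcongr

/-! ### Long-Shortcuts -/

lemma longRound_eq (κ : Constants) (M : Table n) (i : ℕ) (st : DS n × Finset (Fin n)) :
    longRound κ M i st =
      (sampleVertices n (κ.longSample * lg n ^ 2 / (2 ^ i * (n : ℝ) ^ (1 / 2 : ℝ)))).map fun T =>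
        ((longStep M T)^[2 ^ i] st.1, st.2 ∪ T) := rfl

lemma longRounds_sound (κ : Constants) {M : Table n} {D : DS n} (hD : D.Sound M) (k : ℕ) :
    ∀ st ∈ (longRounds κ M D k).support, st.1.Sound M ∧ D.Le st.1 := by
  induction k with
  | zero =>
    intro st hst
    rw [longRounds, PMF.mem_support_pure_iff] at hst
    subst hst
    exact ⟨hD, DS.Le.refl D⟩
  | succ k ih =>
    intro st hst
    rw [longRounds, PMF.mem_support_bind_iff] at hst
    obtain ⟨st', h1, h2⟩ := hst
    obtain ⟨h3, h4⟩ := ih st' h1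
    rw [longRound_eq, PMF.support_map] at h2
    obtain ⟨T, -, rfl⟩ := h2
    obtain ⟨h5, h6⟩ := (isOp_longStep M T).iterate (2 ^ (k + 1)) _ h3
    exact ⟨h5, h4.trans h6⟩

/-- The round for scale `i` sampled a vertex of every set of the family. -/
def HitAtScale (M : Table n) (D : DS n) (i : ℕ) (F : Finset (Finset (Fin n)))
    (st : DS n × Finset (Fin n)) : Prop :=
  ∃ (D₁ : DS n) (T : Finset (Fin n)), D₁.Sound M ∧ D.Le D₁ ∧ ((longStep M T)^[2 ^ i] D₁).Le st.1 ∧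
    T ⊆ st.2 ∧ ∀ A ∈ F, ¬ Disjoint A T

/-- In round `i` the sampling rate times the size of each set is at least 4 log n. Later rounds only
enlarge the data structure and the sample, so a hit persists with certainty. -/
lemma longRounds_fail_le {κ : Constants} (hn : 2 ≤ n) (hs : 4 ≤ κ.longSample) {M : Table n}
    {D : DS n} (hD : D.Sound M) {i : ℕ} (hi : 1 ≤ i) (F : Finset (Finset (Fin n)))
    (hFn : F.card ≤ n) (hF : ∀ A ∈ F, 2 ^ i * ((n : ℝ) ^ (1 / 2 : ℝ) / lg n) ≤ (A.card : ℝ))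
    {k : ℕ} (hk : i ≤ k) :
    (longRounds κ M D k).toOuterMeasure {st | ¬ HitAtScale M D i F st} ≤ 1 / 4 := by
  have hlg := one_le_lg hn
  have hsq := one_lt_sqrt hn
  induction k, hk using Nat.le_induction with
  | base =>
    obtain ⟨j, rfl⟩ : ∃ j, i = j + 1 := ⟨i - 1, by omega⟩
    rw [longRounds]
    refine (toOuterMeasure_bind_le (s := ∅) (ε := 1 / 4) fun st hst _ => ?_).trans (by simp)
    rw [longRound_eq, PMF.toOuterMeasure_map_apply]
    refine le_trans (toOuterMeasure_le_of_support (t := {S | ∃ A ∈ F, Disjoint A S}) ?_)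
      ((sampleVertices_miss_le _ _ (by positivity) F hF).trans (union_bound hn hFn ?_))
    · intro T _ hT
      by_contra hcon
      simp only [Set.mem_ofPred_eq, not_exists, not_and] at hcon
      obtain ⟨h1, h2⟩ := longRounds_sound κ hD j st hst
      exact hT ⟨st.1, T, h1, h2, DS.Le.refl _, Finset.subset_union_right, hcon⟩
    · calc 4 * lg n = 4 * lg n ^ 2 / (2 ^ (j + 1) * (n : ℝ) ^ (1 / 2 : ℝ)) *
            (2 ^ (j + 1) * ((n : ℝ) ^ (1 / 2 : ℝ) / lg n)) := by field_simp
        _ ≤ _ := by gcongr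
  | succ k hk ih =>
    rw [longRounds]
    refine (toOuterMeasure_bind_le (ε := 0) (s := {st | ¬ HitAtScale M D i F st})
      fun st hst hh => ?_).trans (by simpa using ih)
    rw [Set.mem_ofPred_eq, not_not] at hh
    obtain ⟨D₁, T, h1, h2, h3, h4, h5⟩ := hh
    rw [nonpos_iff_eq_zero, PMF.toOuterMeasure_apply_eq_zero_iff, Set.disjoint_left]
    intro st' hst'
    rw [longRound_eq, PMF.support_map] at hst'
    obtain ⟨T', -, rfl⟩ := hst'
    rw [Set.mem_ofPred_eq, not_not]
    have h6 := (isOp_longStep M T').iterate (2 ^ (k + 1)) _ (longRounds_sound κ hD k st hst).1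
    exact ⟨D₁, T, h1, h2, h3.trans h6.2, h4.trans Finset.subset_union_left, h5⟩

lemma longRounds_tr (κ : Constants) (M : Table n) (D : DS n) (k : ℕ) :
    longRounds κ M.tr D.dual k = (longRounds κ M D k).map fun st => (st.1.dual, st.2) := by
  induction k with
  | zero => rw [longRounds, longRounds, PMF.pure_map]
  | succ k ih =>
    rw [longRounds, longRounds, ih, PMF.bind_map, PMF.map_bind]
    congr 1
    ext1 st
    simp only [Function.comp_apply, longRound_eq, PMF.map_comp]
    congr 1
    ext1 T
    simp only [Function.comp_apply, Prod.mk.injEq, and_true]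
    refine iterate_dual (fun D => ?_) _ _
    rw [longStep, longStep, concatenateOpposite_dual, concatenate_dual]

lemma longShortcuts_eq (κ : Constants) (B : ℝ) (M : Table n) : longShortcuts κ B M =
    (computeFunnels κ M).bind fun D => (longRounds κ M D (scales n)).map fun st =>
      arcBoundedToMonotone B M st.1 st.2 := rfl

/-- Allows a path to be replaced by its reverse, so that only one of the two needs many candidates.
-/
lemma longShortcuts_tr (κ : Constants) (B : ℝ) (M : Table n) :
    longShortcuts κ B M.tr = (longShortcuts κ B M).map Table.tr := by
  rw [longShortcuts_eq, longShortcuts_eq, computeFunnels_tr, PMF.bind_map, PMF.map_bind]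
  congr 1
  ext1 D
  simp only [Function.comp_apply, longRounds_tr, PMF.map_comp]
  congr 1
  ext1 st
  exact arcBoundedToMonotone_dual B M st.1 st.2

lemma longShortcuts_support (κ : Constants) (B : ℝ) {M : Table n} (hM : ∀ x y, M x y ≠ ⊤)
    {N : Table n} (hN : N ∈ (longShortcuts κ B M).support) : (∀ x y, N x y ≠ ⊤) ∧ M ≤ N := by
  rw [longShortcuts_eq, PMF.mem_support_bind_iff] at hN
  obtain ⟨D, hD, hN⟩ := hN
  rw [PMF.support_map] at hN
  obtain ⟨st, hst, rfl⟩ := hN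
  have h := (longRounds_sound κ (computeFunnels_sound κ hM hD) _ st hst).1
  exact ⟨arcBoundedToMonotone_ne_top h _, le_arcBoundedToMonotone h _⟩

variable {B : ℝ} {asc : Bool} {τ : ℝ} {x y : Fin n} {M : Table n} {l : ℕ} {v : ℕ → Fin n}
  {H : ℕ → ℝ}

/-- The sets to hit are, for each position a of `A`, the candidates with at most 2^i inner cuts
whose extent contains a. Hitting them all covers `A` by shortcuts; Compute-Funnels and round i each
fail with probability at most 1/4. -/
lemma IsTracked.long_of_candidates {κ : Constants} (h : IsTracked B asc τ x y M l v H)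
    (hn : 2 ≤ n) (hM : ∀ x y, M x y ≠ ⊤) (hf : 0 < κ.funnel) (hs : 8 ≤ κ.funnelSample)
    (hls : 4 ≤ κ.longSample) (hcuts : (cuts H l).card + 1 ≤ 2 ^ scales n) :
    ∃ c : ℕ, ((candidates H l).card : ℝ) ≤ scales n * (c + 2 * ((n : ℝ) ^ (1 / 2 : ℝ) / lg n) *
        ((cuts H l).card + 1)) ∧
      (longShortcuts κ B M).toOuterMeasure
        {N | ¬ ∃ k, HasPath B asc τ x y N k ∧ 6 * k + c ≤ 6 * l} ≤ 1 / 2 := by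
  classical
  have hlg := one_le_lg hn
  have hsq := one_lt_sqrt hn
  obtain ⟨i, hi1, hi2, A, hAc, hA, hdeep⟩ := exists_scale H l (scales n) (one_le_scales hn) hcuts
    ((n : ℝ) ^ (1 / 2 : ℝ) / lg n) (by positivity)
  refine ⟨A.card, hA, ?_⟩
  have hln := lt_of_injOn h.inj
  set X : ℕ → Finset ℕ := fun a => (candidates H l).filter fun e =>
    (cutsIn H e (extent H l e)).card ≤ 2 ^ i ∧ e ≤ a ∧ a < extent H l e with hX
  set F : Finset (Finset (Fin n)) := A.image fun a => (X a).image v with hF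
  have hlt : ∀ e ∈ candidates H l, e < l := fun e he => by have := (mem_candidates.1 he).1; omega
  have hFn : F.card ≤ n := by
    refine Finset.card_image_le.trans ((Finset.card_le_card hAc).trans ?_)
    have : candidates H l ⊆ Finset.range l := fun e he => Finset.mem_range.2 (hlt e he)
    have := Finset.card_le_card this
    rw [Finset.card_range] at this
    omega
  have hFc : ∀ S ∈ F, 2 ^ i * ((n : ℝ) ^ (1 / 2 : ℝ) / lg n) ≤ (S.card : ℝ) := by
    intro S hS
    obtain ⟨a, ha, rfl⟩ := Finset.mem_image.1 hS
    rw [Finset.card_image_of_injOn]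
    · exact hdeep a ha
    · intro e he f hf' hef
      have h1 := hlt e (Finset.mem_filter.1 he).1
      have h2 := hlt f (Finset.mem_filter.1 hf').1
      exact h.inj (Set.mem_Iic.2 h1.le) (Set.mem_Iic.2 h2.le) hef
  rw [longShortcuts_eq]
  refine (toOuterMeasure_bind_le (s := {D | ¬ KnowsFunnels D v H l}) (ε := 1 / 4)
    fun D hD hgood => ?_).trans ((add_le_add_left (computeFunnels_fail_le hn hf hs hM h.inj
      h.exact) _).trans ?_)
  · rw [Set.mem_ofPred_eq, not_not] at hgood
    have hsound := computeFunnels_sound κ hM hD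
    rw [PMF.toOuterMeasure_map_apply]
    refine le_trans (toOuterMeasure_le_of_support ?_)
      (longRounds_fail_le hn hls hsound hi1 F hFn hFc hi2)
    refine fun st hst => mt fun hhit => ?_
    obtain ⟨D₁, T, h1, h2, h3, h4, h5⟩ := hhit
    refine h.long_of_cover h1 (hgood.mono h2) (longRounds_sound κ hsound _ st hst).1 h3 h4 A ?_
    intro a ha
    have := h5 _ (Finset.mem_image_of_mem _ ha)
    rw [Finset.not_disjoint_iff] at this
    obtain ⟨w, hw, hwT⟩ := this
    obtain ⟨e, he, rfl⟩ := Finset.mem_image.1 hw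
    obtain ⟨he1, he2, he3, he4⟩ := Finset.mem_filter.1 he
    exact ⟨e, mem_candidates.1 he1, hwT, he2, he3, he4⟩
  · rw [ENNReal.div_add_div_same, ENNReal.div_le_iff (by norm_num) (by norm_num)]
    norm_num
    rw [← ENNReal.div_eq_inv_mul, ENNReal.le_div_iff_mul_le (by norm_num) (by norm_num)]
    norm_num

/-- Long-Shortcuts is likely to shorten a long path with few cuts. -/
lemma IsTracked.long_save {κ : Constants} (h : IsTracked B asc τ x y M l v H)
    (hn : 2 ≤ n) (hM : ∀ x y, M x y ≠ ⊤) (hf : 0 < κ.funnel) (hs : 8 ≤ κ.funnelSample)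
    (hls : 4 ≤ κ.longSample) (hl : 256 * (n : ℝ) ^ (1 / 2 : ℝ) < l)
    (hcuts : 256 * (n : ℝ) ^ (1 / 2 : ℝ) * (cuts H l).card < l)
    (hcuts' : 256 * (n : ℝ) ^ (1 / 2 : ℝ) * (cuts (fun i => -H (l - i)) l).card < l) :
    (longShortcuts κ B M).toOuterMeasure {N | ¬ ∃ k : ℕ, HasPath B asc τ x y N k ∧
      (k : ℝ) ≤ l * (1 - 1 / (384 * lg n))} ≤ 1 / 2 := by
  classical
  have hlg := one_le_lg hn
  have hsq := one_lt_sqrt hn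
  have hln := lt_of_injOn h.inj
  have hsqn : (n : ℝ) ^ (1 / 2 : ℝ) * (n : ℝ) ^ (1 / 2 : ℝ) = n := by
    rw [← Real.rpow_add (by positivity)]; norm_num
  set q := (n : ℝ) ^ (1 / 2 : ℝ) with hq
  have hlnr : (l : ℝ) < n := by exact_mod_cast hln
  have key : ∀ {x' y' : Fin n} {M' : Table n} {v' : ℕ → Fin n} {H' : ℕ → ℝ},
      IsTracked B asc τ x' y' M' l v' H' → (∀ x y, M' x y ≠ ⊤) → 256 * q * (cuts H' l).card < l →
      (l : ℝ) ≤ 8 * (candidates H' l).card →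
      (longShortcuts κ B M').toOuterMeasure {N | ¬ ∃ k : ℕ, HasPath B asc τ x' y' N k ∧
        (k : ℝ) ≤ l * (1 - 1 / (384 * lg n))} ≤ 1 / 2 := by
    intro x' y' M' v' H' h' hM' hc' hcand
    -- This makes the shallow term at most l/(64 log n). Multiplied by the at most 4 log n scales it
    -- is l/16, half of the l/8 candidates. So c ≥ l/(64 log n), of which a sixth is saved: 384 = 6
    -- · 64.
    have hcut : (((cuts H' l).card : ℝ) + 1) * (128 * q) ≤ l := by nlinarith
    obtain ⟨c, hc1, hc2⟩ := h'.long_of_candidates hn hM' hf hs hls (by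
      have h1 := sqrt_le_two_pow_scales hn
      have h2 : ((cuts H' l).card : ℝ) + 1 ≤ 2 ^ scales n := by
        refine le_trans ?_ h1
        rw [← hq]
        nlinarith
      exact_mod_cast h2)
    refine le_trans (toOuterMeasure_le_of_support ?_) hc2
    refine fun N _ => mt fun hk => ?_
    obtain ⟨k, hk1, hk2⟩ := hk
    refine ⟨k, hk1, ?_⟩
    have hk3 : 6 * (k : ℝ) + c ≤ 6 * l := by exact_mod_cast hk2
    have h1 : 2 * (q / lg n) * ((cuts H' l).card + 1) ≤ l / (64 * lg n) := by
      rw [le_div_iff₀ (by positivity)]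
      calc 2 * (q / lg n) * (((cuts H' l).card : ℝ) + 1) * (64 * lg n)
          = (((cuts H' l).card : ℝ) + 1) * (128 * q) := by field_simp; ring
        _ ≤ l := hcut
    have h2 : ((candidates H' l).card : ℝ) ≤ 4 * lg n * (c + l / (64 * lg n)) := by
      refine hc1.trans ?_
      have := scales_le hn
      gcongr
    have h3 : 4 * lg n * (c + l / (64 * lg n)) = 4 * lg n * c + l / 16 := by field_simp; ring
    have h4 : (l : ℝ) / (64 * lg n) ≤ c := by
      rw [div_le_iff₀ (by positivity)]
      linarith
    have h5 : (l : ℝ) * (1 - 1 / (384 * lg n)) = l - l / (64 * lg n) / 6 := by field_simp; ring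
    rw [h5]
    linarith
  have hl256 : (256 : ℝ) < l := by linarith
  have hc1 : 256 * ((cuts H l).card : ℝ) ≤ l := by nlinarith
  have hc2 : 256 * ((cuts (fun i => -H (l - i)) l).card : ℝ) ≤ l := by nlinarith
  have hC := card_closing_add_closing_tr H l
  have hC1 := card_closing_le H l
  have hC2 := card_closing_le (fun i => -H (l - i)) l
  have hsum : (l : ℝ) - 1 ≤ 2 * (candidates H l).card + (cuts H l).card + 2 +
      (2 * (candidates (fun i => -H (l - i)) l).card + (cuts (fun i => -H (l - i)) l).card + 2) +
        (cuts H l).card := by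
    have : l ≤ 2 * (candidates H l).card + (cuts H l).card + 2 +
      (2 * (candidates (fun i => -H (l - i)) l).card + (cuts (fun i => -H (l - i)) l).card + 2) +
        (cuts H l).card + 1 := by omega
    have : (l : ℝ) ≤ 2 * (candidates H l).card + (cuts H l).card + 2 +
      (2 * (candidates (fun i => -H (l - i)) l).card + (cuts (fun i => -H (l - i)) l).card + 2) +
        (cuts H l).card + 1 := by exact_mod_cast this
    linarith
  -- The path or its reverse has at least l/8 candidates.
  rcases le_or_gt (l : ℝ) (8 * (candidates H l).card) with hcase | hcase
  · exact key h hM hcuts hcase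
  · have := key h.tr (fun a b => hM b a) hcuts' (by linarith)
    rw [longShortcuts_tr, PMF.toOuterMeasure_map_apply] at this
    refine le_trans (toOuterMeasure_le_of_support ?_) this
    refine fun N _ => mt fun hk => ?_
    obtain ⟨k, hk1, hk2⟩ := hk
    exact ⟨k, hk1.tr, hk2⟩
end ElectricCar

namespace ElectricCar
open scoped ENNReal
variable {n : ℕ}

/-! ### Update-Shortcuts -/

section Update
variable {B : ℝ} {asc : Bool} {τ : ℝ} {x y : Fin n} {M : Table n}

/-- The least number of arcs of an admissible path. -/
noncomputable def pathLength (B : ℝ) (asc : Bool) (τ : ℝ) (x y : Fin n) (M : Table n) : ℕ :=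
  sInf {k | HasPath B asc τ x y M k}

lemma pathLength_le {k : ℕ} (h : HasPath B asc τ x y M k) : pathLength B asc τ x y M ≤ k :=
  Nat.sInf_le h

lemma HasPath.exists_shortest {k : ℕ} (h : HasPath B asc τ x y M k) :
    ∃ v H, IsTracked B asc τ x y M (pathLength B asc τ x y M) v H := by
  obtain ⟨l, hl, v, H, ht⟩ : HasPath B asc τ x y M (pathLength B asc τ x y M) :=
    Nat.sInf_mem (s := {k | HasPath B asc τ x y M k}) ⟨k, h⟩
  obtain rfl : l = pathLength B asc τ x y M :=
    le_antisymm hl (pathLength_le ⟨l, le_rfl, v, H, ht⟩)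
  exact ⟨v, H, ht⟩

/-- There is an admissible path whose number of arcs is at most the real number `b`. -/
def HasPathBelow (B : ℝ) (asc : Bool) (τ : ℝ) (x y : Fin n) (b : ℝ) (M : Table n) : Prop :=
  ∃ k : ℕ, HasPath B asc τ x y M k ∧ (k : ℝ) ≤ b

lemma HasPathBelow.mono {b : ℝ} {M' : Table n} (h : HasPathBelow B asc τ x y b M)
    (hM' : ∀ x y, M' x y ≠ ⊤) (hle : M ≤ M') : HasPathBelow B asc τ x y b M' := by
  obtain ⟨k, hk, hb⟩ := h
  exact ⟨k, hk.mono hM' hle, hb⟩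

lemma iterate_short_ne_top (B : ℝ) {M : Table n} (hM : ∀ x y, M x y ≠ ⊤) (j : ℕ) :
    ∀ x y, (shortShortcuts B)^[j] M x y ≠ ⊤ := by
  induction j with
  | zero => exact hM
  | succ j ih =>
    rw [Function.iterate_succ_apply']
    exact shortShortcuts_ne_top B ih

lemma le_iterate_short (B : ℝ) (M : Table n) (j : ℕ) : M ≤ (shortShortcuts B)^[j] M := by
  induction j with
  | zero => exact le_rfl
  | succ j ih =>
    rw [Function.iterate_succ_apply']
    exact ih.trans (le_shortShortcuts B _)

lemma sup_ne_top' {M N : Table n} (hM : ∀ x y, M x y ≠ ⊤) (hN : ∀ x y, N x y ≠ ⊤) (x y : Fin n) :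
    (M ⊔ N) x y ≠ ⊤ := max_ne_top (hM x y) (hN x y)

lemma innerIteration_support {κ : Constants} {r : ℕ} {st st' : Table n × Table n}
    (h1 : ∀ x y, st.1 x y ≠ ⊤) (h2 : ∀ x y, st.2 x y ≠ ⊤)
    (h : st' ∈ (innerIteration κ B r st).support) :
    st'.1 = shortShortcuts B st.1 ∧ (∀ x y, st'.2 x y ≠ ⊤) ∧ st.2 ≤ st'.2 := by
  rw [innerIteration, PMF.mem_support_bind_iff] at h
  obtain ⟨b, -, hb⟩ := h
  cases b with
  | true =>
    simp only [if_true] at hb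
    rw [PMF.support_map] at hb
    obtain ⟨N, hN, rfl⟩ := hb
    exact ⟨rfl, sup_ne_top' h2 (longShortcuts_support κ B h1 hN).1, le_sup_left⟩
  | false =>
    simp only [Bool.false_eq_true, if_false] at hb
    rw [PMF.mem_support_pure_iff] at hb
    subst hb
    exact ⟨rfl, h2, le_rfl⟩

lemma repeat_inner_support {κ : Constants} {r : ℕ} (k : ℕ) :
    ∀ {st st' : Table n × Table n}, (∀ x y, st.1 x y ≠ ⊤) → (∀ x y, st.2 x y ≠ ⊤) →
    st' ∈ (repeatStep (innerIteration κ B r) k st).support →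
    st'.1 = (shortShortcuts B)^[k] st.1 ∧ (∀ x y, st'.2 x y ≠ ⊤) ∧ st.2 ≤ st'.2 := by
  induction k with
  | zero =>
    intro st st' h1 h2 h
    rw [repeatStep, PMF.mem_support_pure_iff] at h
    subst h
    exact ⟨rfl, h2, le_rfl⟩
  | succ k ih =>
    intro st st' h1 h2 h
    rw [repeatStep, PMF.mem_support_bind_iff] at h
    obtain ⟨st₁, h3, h4⟩ := h
    obtain ⟨h5, h6, h7⟩ := innerIteration_support h1 h2 h3
    obtain ⟨h8, h9, h10⟩ := ih (by rw [h5]; exact shortShortcuts_ne_top B h1) h6 h4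
    rw [h5] at h8
    exact ⟨h8, h9, h7.trans h10⟩

lemma updateShortcuts_support {κ : Constants} (hM : ∀ x y, M x y ≠ ⊤) {N : Table n}
    (hN : N ∈ (updateShortcuts κ B M).support) : (∀ x y, N x y ≠ ⊤) ∧ M ≤ N := by
  rw [updateShortcuts, PMF.support_map] at hN
  obtain ⟨st, hst, rfl⟩ := hN
  obtain ⟨h1, h2, h3⟩ := repeat_inner_support _ (st := (M, M)) hM hM hst
  refine ⟨sup_ne_top' ?_ h2, h3.trans le_sup_right⟩
  rw [h1]
  exact iterate_short_ne_top B hM _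

/-- In this table, Long-Shortcuts is likely to find a path below the bound. -/
def LongGood (κ : Constants) (B : ℝ) (asc : Bool) (τ : ℝ) (x y : Fin n) (b : ℝ) (M : Table n) :
    Prop :=
  (longShortcuts κ B M).toOuterMeasure {N | ¬ HasPathBelow B asc τ x y b N} ≤ 1 / 2

/-- The failure probability of a round in which Long-Shortcuts is likely to succeed. -/
noncomputable def roundFail (n r : ℕ) : ℝ≥0∞ :=
  min 1 (ENNReal.ofReal (lg n / r)) * (1 / 2) + (1 - min 1 (ENNReal.ofReal (lg n / r)))

lemma toOuterMeasure_le_one {α : Type} (p : PMF α) (s : Set α) : p.toOuterMeasure s ≤ 1 := by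
  rw [toOuterMeasure_eq_mean]
  exact mean_le_const fun b _ => Set.indicator_le_self' (by simp) b

lemma innerIteration_fail_le {κ : Constants} {r : ℕ} {b : ℝ} {st : Table n × Table n}
    (h1 : ∀ x y, st.1 x y ≠ ⊤) (h2 : ∀ x y, st.2 x y ≠ ⊤)
    (hg : LongGood κ B asc τ x y b st.1) :
    (innerIteration κ B r st).toOuterMeasure {st' | ¬ HasPathBelow B asc τ x y b st'.2} ≤
      roundFail n r := by
  rw [innerIteration, toOuterMeasure_bind, mean_coin, roundFail]
  refine add_le_add (mul_le_mul_right ?_ _) ?_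
  · simp only [if_true]
    rw [PMF.toOuterMeasure_map_apply]
    refine (toOuterMeasure_le_of_support ?_).trans hg
    exact fun N hN => mt fun hb => hb.mono
      (sup_ne_top' h2 (longShortcuts_support κ B h1 hN).1) le_sup_right
  · exact (mul_le_mul_right (toOuterMeasure_le_one _ _) _).trans (mul_one _).le

-- The first component of the state is deterministic, so it is known in advance in which iterations
-- Long-Shortcuts is likely to succeed. Their failure probabilities multiply, and a success recorded
-- in the second component persists.
open Classical in
lemma repeat_inner_fail_le {κ : Constants} {r : ℕ} {b : ℝ} (k : ℕ) :
    ∀ {st : Table n × Table n}, (∀ x y, st.1 x y ≠ ⊤) → (∀ x y, st.2 x y ≠ ⊤) →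
    (repeatStep (innerIteration κ B r) k st).toOuterMeasure
      {st' | ¬ HasPathBelow B asc τ x y b st'.2} ≤
      roundFail n r ^ ((Finset.range k).filter fun j =>
        LongGood κ B asc τ x y b ((shortShortcuts B)^[j] st.1)).card := by
  induction k with
  | zero => intro st _ _; simpa using toOuterMeasure_le_one _ _
  | succ k ih =>
    intro st h1 h2
    set c := ((Finset.range k).filter fun j =>
        LongGood κ B asc τ x y b ((shortShortcuts B)^[j] (shortShortcuts B st.1))).card with hc
    have hcount : ((Finset.range (k + 1)).filter fun j =>
        LongGood κ B asc τ x y b ((shortShortcuts B)^[j] st.1)).card =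
        c + if LongGood κ B asc τ x y b st.1 then 1 else 0 := by
      rw [Finset.card_filter, Finset.sum_range_succ', hc, Finset.card_filter]
      simp only [Function.iterate_succ_apply, Function.iterate_zero, id]
      congr
    rw [hcount, repeatStep, toOuterMeasure_bind]
    have hstep : ∀ st₁ ∈ (innerIteration κ B r st).support,
        (repeatStep (innerIteration κ B r) k st₁).toOuterMeasure
          {st' | ¬ HasPathBelow B asc τ x y b st'.2} ≤
        roundFail n r ^ c * Set.indicator {st' | ¬ HasPathBelow B asc τ x y b st'.2} 1 st₁ := by
      intro st₁ hst
      obtain ⟨h3, h4, h5⟩ := innerIteration_support h1 h2 hst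
      have h6 : ∀ x y, st₁.1 x y ≠ ⊤ := by rw [h3]; exact shortShortcuts_ne_top B h1
      by_cases hs : HasPathBelow B asc τ x y b st₁.2
      · refine le_trans (le_of_eq ?_) zero_le
        rw [PMF.toOuterMeasure_apply_eq_zero_iff, Set.disjoint_left]
        intro st₂ hst₂ hbad
        obtain ⟨-, h7, h8⟩ := repeat_inner_support k h6 h4 hst₂
        exact hbad (hs.mono h7 h8)
      · have := ih h6 h4
        rw [h3] at this
        rw [Set.indicator_of_mem (by exact hs)]
        simpa using this
    refine (mean_le_mean hstep).trans ?_
    rw [mean_mul_left, ← toOuterMeasure_eq_mean]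
    split_ifs with hg
    · rw [pow_succ]
      exact mul_le_mul_right (innerIteration_fail_le h1 h2 hg) _
    · rw [add_zero]
      exact (mul_le_mul_right (toOuterMeasure_le_one _ _) _).trans (mul_one _).le

/-- With a the truncated coin probability, a round fails with probability 1 - a/2 and a·r ≥ 1. So
r/2 rounds fail together with probability at most e^(-1/4) ≤ 4/5. -/
lemma roundFail_pow_le (hn : 2 ≤ n) {r c : ℕ} (hr : 1 ≤ r) (hc : r ≤ 2 * c) :
    roundFail n r ^ c ≤ ENNReal.ofReal (4 / 5) := by
  have hlg := one_le_lg hn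
  have hr0 : (1 : ℝ) ≤ r := by exact_mod_cast hr
  set a := min 1 (lg n / r) with ha
  have ha0 : 0 ≤ a := by positivity
  have ha1 : a ≤ 1 := min_le_left _ _
  have har : 1 ≤ a * r := by
    rcases min_choice 1 (lg n / r) with h | h
    · rw [ha, h]; linarith
    · rw [ha, h, div_mul_cancel₀ _ (by positivity)]; exact hlg
  have h1 : roundFail n r = ENNReal.ofReal (1 - a / 2) := by
    have h2 : min 1 (ENNReal.ofReal (lg n / r)) = ENNReal.ofReal a := by
      rw [ha, ENNReal.ofReal_min, ENNReal.ofReal_one]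
    have h3 : (1 : ℝ≥0∞) / 2 = ENNReal.ofReal (1 / 2) := by
      rw [ENNReal.ofReal_div_of_pos (by norm_num)]; simp
    rw [roundFail, h2, h3, ← ENNReal.ofReal_mul ha0, ← ENNReal.ofReal_one,
      ← ENNReal.ofReal_sub _ ha0, ← ENNReal.ofReal_add (by positivity) (by linarith)]
    congr 1; ring
  rw [h1, ← ENNReal.ofReal_pow (by linarith)]
  refine ENNReal.ofReal_le_ofReal ?_
  have h4 : (1 - a / 2) ^ c ≤ Real.exp (-(1 / 4)) := by
    calc (1 - a / 2) ^ c ≤ Real.exp (-(a / 2)) ^ c :=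
          pow_le_pow_left₀ (by linarith) (Real.one_sub_le_exp_neg _) _
      _ = Real.exp (c * -(a / 2)) := (Real.exp_nat_mul _ _).symm
      _ ≤ Real.exp (-(1 / 4)) := by
        refine Real.exp_le_exp.2 ?_
        have : (r : ℝ) ≤ 2 * c := by exact_mod_cast hc
        nlinarith
  refine h4.trans ?_
  have h5 := Real.add_one_le_exp (1 / 4 : ℝ)
  have h6 : Real.exp (-(1 / 4)) * Real.exp (1 / 4 : ℝ) = 1 := by rw [← Real.exp_add]; simp
  nlinarith [Real.exp_pos (-(1 / 4) : ℝ)]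

/-- The requirements on the constants of the inner procedures. -/
structure Constants.Large (κ : Constants) : Prop where
  inner : 16 ≤ κ.inner
  funnel : 0 < κ.funnel
  funnelSample : 8 ≤ κ.funnelSample
  longSample : 4 ≤ κ.longSample

/-- Either Short-Shortcuts saves many arcs, or Long-Shortcuts is likely to. -/
lemma short_or_long {κ : Constants} (hκ : κ.Large) (hn : 2 ≤ n) (hM : ∀ x y, M x y ≠ ⊤) {k : ℕ}
    (h : HasPath B asc τ x y M k) {b l₀ : ℝ} (hl : 2 ≤ pathLength B asc τ x y M)
    (hl₀ : l₀ ≤ 2 * pathLength B asc τ x y M)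
    (hb : (pathLength B asc τ x y M : ℝ) * (1 - 1 / (384 * lg n)) ≤ b) :
    (pathLength B asc τ x y (shortShortcuts B M) : ℝ) + l₀ / (3072 * (n : ℝ) ^ (1 / 2 : ℝ)) ≤
      pathLength B asc τ x y M ∨ LongGood κ B asc τ x y b M := by
  have hsq := one_lt_sqrt hn
  set q := (n : ℝ) ^ (1 / 2 : ℝ) with hq
  obtain ⟨v, H, ht⟩ := h.exists_shortest
  set l := pathLength B asc τ x y M with hl'
  -- 3072 = 2 · 256 · 6: the reference length is at most 2l, and c cuts save c/6 arcs.
  have hfrac : ∀ c : ℝ, (l : ℝ) ≤ 256 * q * c → l₀ / (3072 * q) ≤ c / 6 := by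
    intro c hc
    rw [div_le_iff₀ (by positivity)]
    nlinarith
  have hcutcase : ∀ c : ℕ, (∃ k, HasPath B asc τ x y (shortShortcuts B M) k ∧ 6 * k + c ≤ 6 * l) →
      (l : ℝ) ≤ 256 * q * c →
      (pathLength B asc τ x y (shortShortcuts B M) : ℝ) + l₀ / (3072 * q) ≤ l := by
    rintro c ⟨k', hk', hkc⟩ hc
    have h1 : (pathLength B asc τ x y (shortShortcuts B M) : ℝ) ≤ k' := by
      exact_mod_cast pathLength_le hk'
    have h2 : 6 * (k' : ℝ) + c ≤ 6 * l := by exact_mod_cast hkc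
    have := hfrac c hc
    linarith
  rcases le_or_gt (l : ℝ) (256 * q) with h1 | h1
  · left
    have h2 : (pathLength B asc τ x y (shortShortcuts B M) : ℝ) + 1 ≤ l := by
      have := pathLength_le (ht.short_save_one hM hl)
      have : pathLength B asc τ x y (shortShortcuts B M) + 1 ≤ l := by omega
      exact_mod_cast this
    have := hfrac 1 (by linarith)
    linarith
  rcases le_or_gt (l : ℝ) (256 * q * (cuts H l).card) with h2 | h2
  · exact Or.inl (hcutcase _ (ht.short_of_cuts hM) h2)
  rcases le_or_gt (l : ℝ) (256 * q * (cuts (fun i => -H (l - i)) l).card) with h3 | h3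
  · exact Or.inl (hcutcase _ (ht.short_of_cuts_tr hM) h3)
  right
  refine (toOuterMeasure_le_of_support ?_).trans
    (ht.long_save hn hM hκ.funnel hκ.funnelSample hκ.longSample h1 h2 h3)
  refine fun N _ => mt fun hN => ?_
  obtain ⟨k', hk', hkb⟩ := hN
  exact ⟨k', hk', hkb.trans hb⟩

lemma updateShortcuts_fail_le {κ : Constants} (hκ : κ.Large) (hn : 2 ≤ n)
    (hM : ∀ x y, M x y ≠ ⊤) {k : ℕ} (h : HasPath B asc τ x y M k)
    (hl : 2 ≤ pathLength B asc τ x y M) :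
    (updateShortcuts κ B M).toOuterMeasure {N | ¬ HasPathBelow B asc τ x y
      (pathLength B asc τ x y M * (1 - 1 / (384 * lg n))) N} ≤ ENNReal.ofReal (4 / 5) := by
  classical
  have hsq := one_lt_sqrt hn
  have hlg := one_le_lg hn
  set q := (n : ℝ) ^ (1 / 2 : ℝ) with hq
  set l := pathLength B asc τ x y M with hl'
  have hl2 : (2 : ℝ) ≤ l := by exact_mod_cast hl
  set b := (l : ℝ) * (1 - 1 / (384 * lg n)) with hb
  set r := ⌈κ.inner * q⌉₊ with hr
  have hrq : 16 * q ≤ r := by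
    refine le_trans ?_ (Nat.le_ceil _)
    have := hκ.inner
    gcongr
  rw [updateShortcuts, ← hq, ← hr, PMF.toOuterMeasure_map_apply]
  have hpath : ∀ j, HasPath B asc τ x y ((shortShortcuts B)^[j] M) k := fun j =>
    h.mono (iterate_short_ne_top B hM j) (le_iterate_short B M j)
  set len : ℕ → ℕ := fun j => pathLength B asc τ x y ((shortShortcuts B)^[j] M) with hlen
  -- If the deterministic iterates of Short-Shortcuts reach the bound by themselves, nothing can
  -- fail.
  by_cases hlate : (len r : ℝ) ≤ b
  · refine le_trans (le_of_eq ?_) zero_le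
    rw [PMF.toOuterMeasure_apply_eq_zero_iff, Set.disjoint_left]
    intro st hst hbad
    obtain ⟨h1, h2, -⟩ := repeat_inner_support _ (st := (M, M)) hM hM hst
    refine hbad ?_
    obtain ⟨v, H, ht⟩ := (hpath r).exists_shortest
    refine HasPathBelow.mono ⟨len r, ⟨_, le_rfl, v, H, ht⟩, hlate⟩
      (sup_ne_top' (by rw [h1]; exact iterate_short_ne_top B hM _) h2) ?_
    exact (le_of_eq h1.symm).trans le_sup_left
  push Not at hlate
  have hanti : ∀ j, len (j + 1) ≤ len j := by
    intro j
    obtain ⟨v, H, ht⟩ := (hpath j).exists_shortest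
    have h1 : HasPath B asc τ x y ((shortShortcuts B)^[j] M) (len j) := ⟨_, le_rfl, v, H, ht⟩
    refine pathLength_le (h1.mono (iterate_short_ne_top B hM _) ?_)
    rw [Function.iterate_succ_apply']
    exact le_shortShortcuts B _
  have hanti' : Antitone len := antitone_nat_of_succ_le hanti
  have hlenl : ∀ j, len j ≤ l := fun j => hanti' (Nat.zero_le j)
  have hblow : (l : ℝ) * (383 / 384) ≤ b := by
    rw [hb]
    gcongr
    rw [le_sub_comm, div_le_iff₀ (by positivity)]
    linarith
  set good : Finset ℕ := (Finset.range r).filter fun j =>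
    LongGood κ B asc τ x y b ((shortShortcuts B)^[j] M) with hgood
  -- By `short_or_long`, each iteration in which Long-Shortcuts is not likely to succeed shortens
  -- the path by at least l/(3072√n).
  have hdrop : ∀ j, j ≤ r → (len j : ℝ) + (l / (3072 * q)) *
      ((Finset.range j).filter fun j =>
        ¬ LongGood κ B asc τ x y b ((shortShortcuts B)^[j] M)).card ≤ l := by
    intro j
    induction j with
    | zero => intro _; simp [hlen, hl']
    | succ j ih =>
      intro hj
      have h1 := ih (by omega)
      have hlate' : b < len j := hlate.trans_le (by exact_mod_cast hanti' (by omega : j ≤ r))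
      rw [Finset.range_add_one, Finset.filter_insert]
      split_ifs with hg
      · have : (len (j + 1) : ℝ) ≤ len j := by exact_mod_cast hanti j
        linarith
      · rw [Finset.card_insert_of_notMem (by simp)]
        have hlj : 2 ≤ len j := by
          have : (1 : ℝ) < len j := by linarith
          exact_mod_cast this
        rcases short_or_long (l₀ := l) hκ hn (iterate_short_ne_top B hM j) (hpath j) (b := b) hlj
          (by linarith) (by
            rw [hb]
            have h5 : (len j : ℝ) ≤ l := by exact_mod_cast hlenl j
            have h6 : 0 ≤ 1 - 1 / (384 * lg n) := by
              rw [sub_nonneg, div_le_iff₀ (by positivity)]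
              linarith
            exact mul_le_mul_of_nonneg_right h5 h6) with h2 | h2
        · rw [← Function.iterate_succ_apply' (shortShortcuts B)] at h2
          push_cast
          rw [mul_add, mul_one]
          have h3 : (len (j + 1) : ℝ) + l / (3072 * q) ≤ len j := h2
          linarith
        · exact absurd h2 hg
  -- The total drop is at most l/384, so there are at most 8√n such iterations, which is at most
  -- half of r.
  have hgoodc : r ≤ 2 * good.card := by
    have h1 := hdrop r le_rfl
    set bad := ((Finset.range r).filter fun j =>
      ¬ LongGood κ B asc τ x y b ((shortShortcuts B)^[j] M)).card with hbad
    have h2 : good.card + bad = r := by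
      have := Finset.card_filter_add_card_filter_not (s := Finset.range r)
        (fun j => LongGood κ B asc τ x y b ((shortShortcuts B)^[j] M))
      rw [Finset.card_range] at this
      convert this
    have h3 : (l : ℝ) / (3072 * q) * bad ≤ l * (1 / 384) := by linarith
    have h4 : (bad : ℝ) ≤ 8 * q := by
      rw [div_mul_eq_mul_div, div_le_iff₀ (by positivity)] at h3
      have : (l : ℝ) * bad ≤ l * (8 * q) := by linarith
      exact le_of_mul_le_mul_left this (by linarith)
    have h5 : (2 * bad : ℝ) ≤ r := by linarith
    have h6 : 2 * bad ≤ r := by exact_mod_cast h5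
    omega
  have hr1 : 1 ≤ r := by
    have : (1 : ℝ) ≤ r := by linarith
    exact_mod_cast this
  refine le_trans (toOuterMeasure_le_of_support ?_)
    ((repeat_inner_fail_le (asc := asc) (τ := τ) (x := x) (y := y) (b := b) r (st := (M, M))
      hM hM).trans (roundFail_pow_le hn hr1 hgoodc))
  refine fun st hst => mt fun hs => ?_
  obtain ⟨h1, h2, -⟩ := repeat_inner_support _ (st := (M, M)) hM hM hst
  exact HasPathBelow.mono hs
    (sup_ne_top' (by rw [h1]; exact iterate_short_ne_top B hM _) h2) le_sup_right

end Update
end ElectricCar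

/-! ### Drift of a potential: repeated updates bring the path length down to one. -/

namespace ElectricCar
open scoped ENNReal
variable {n : ℕ}

section Drift
variable {B : ℝ} {asc : Bool} {τ : ℝ} {x y : Fin n} {M : Table n}

/-- A power of the length of a shortest admissible path, or zero if it has at most one arc. -/
noncomputable def potential (s : ℕ) (B : ℝ) (asc : Bool) (τ : ℝ) (x y : Fin n) (M : Table n) :
    ℝ≥0∞ :=
  if pathLength B asc τ x y M ≤ 1 then 0 else (pathLength B asc τ x y M : ℝ≥0∞) ^ s

lemma potential_le (s : ℕ) (B : ℝ) (asc : Bool) (τ : ℝ) (x y : Fin n) (M : Table n) :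
    potential s B asc τ x y M ≤ (pathLength B asc τ x y M : ℝ≥0∞) ^ s := by
  rw [potential]
  split_ifs <;> simp

lemma one_sub_pow_le_half (hn : 2 ≤ n) {s : ℕ} (hs : 384 * lg n ≤ s) :
    (1 - 1 / (384 * lg n)) ^ s ≤ 1 / 2 := by
  have hlg := one_le_lg hn
  have h0 : 0 ≤ 1 - 1 / (384 * lg n) := by
    rw [sub_nonneg, div_le_iff₀ (by positivity)]
    linarith
  calc (1 - 1 / (384 * lg n)) ^ s ≤ Real.exp (-(1 / (384 * lg n))) ^ s :=
        pow_le_pow_left₀ h0 (Real.one_sub_le_exp_neg _) _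
    _ = Real.exp (s * -(1 / (384 * lg n))) := (Real.exp_nat_mul _ _).symm
    _ ≤ Real.exp (-1) := by
      refine Real.exp_le_exp.2 ?_
      rw [mul_neg, neg_le_neg_iff, mul_one_div, le_div_iff₀ (by positivity)]
      linarith
    _ ≤ 1 / 2 := by
      have h5 := Real.add_one_le_exp (1 : ℝ)
      have h6 : Real.exp (-1) * Real.exp (1 : ℝ) = 1 := by rw [← Real.exp_add]; simp
      nlinarith [Real.exp_pos (-1 : ℝ)]

/-- The exponent is so large that the factor 1 - 1/(384 log n) in the length halves the potential.
An update fails to gain this factor with probability at most 4/5, and then the potential does not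
grow: 1/2 + (1/2)(4/5) = 9/10. -/
lemma mean_update_potential_le {κ : Constants} (hκ : κ.Large) (hn : 2 ≤ n)
    (hM : ∀ x y, M x y ≠ ⊤) {k : ℕ} (h : HasPath B asc τ x y M k) {s : ℕ}
    (hs : 384 * lg n ≤ s) :
    mean (updateShortcuts κ B M) (potential s B asc τ x y) ≤
      ENNReal.ofReal (9 / 10) * potential s B asc τ x y M := by
  classical
  have hlg := one_le_lg hn
  obtain ⟨v, H, ht⟩ := h.exists_shortest
  have hp : HasPath B asc τ x y M (pathLength B asc τ x y M) := ⟨_, le_rfl, v, H, ht⟩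
  have hmono : ∀ N ∈ (updateShortcuts κ B M).support,
      pathLength B asc τ x y N ≤ pathLength B asc τ x y M := fun N hN =>
    pathLength_le (hp.mono (updateShortcuts_support hM hN).1 (updateShortcuts_support hM hN).2)
  have hfail := fun hl => updateShortcuts_fail_le hκ hn hM h hl
  set l := pathLength B asc τ x y M with hl'
  rcases le_or_gt l 1 with hl | hl
  · refine le_trans (mean_le_const (c := 0) fun N hN => ?_) zero_le
    rw [potential, if_pos ((hmono N hN).trans hl)]
  have hpot : potential s B asc τ x y M = (l : ℝ≥0∞) ^ s := by
    rw [potential, if_neg (by omega)]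
  set bad : Set (Table n) := {N | ¬ HasPathBelow B asc τ x y (l * (1 - 1 / (384 * lg n))) N}
  have hpt : ∀ N ∈ (updateShortcuts κ B M).support, potential s B asc τ x y N ≤
      (l : ℝ≥0∞) ^ s * (ENNReal.ofReal (1 / 2) + ENNReal.ofReal (1 / 2) * bad.indicator 1 N) := by
    intro N hN
    refine (potential_le _ _ _ _ _ _ _).trans ?_
    by_cases hb : N ∈ bad
    · rw [Set.indicator_of_mem hb, Pi.one_apply, mul_one, ← ENNReal.ofReal_add (by norm_num)
        (by norm_num)]
      norm_num
      exact pow_le_pow_left' (by exact_mod_cast hmono N hN) _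
    · rw [Set.indicator_of_notMem hb, mul_zero, add_zero]
      simp only [bad, Set.mem_ofPred_eq, not_not] at hb
      obtain ⟨k', hk', hkb⟩ := hb
      have h1 : (pathLength B asc τ x y N : ℝ) ≤ l * (1 - 1 / (384 * lg n)) :=
        le_trans (by exact_mod_cast pathLength_le hk') hkb
      have h2 : (pathLength B asc τ x y N : ℝ) ^ s ≤ (l : ℝ) ^ s * (1 / 2) := by
        calc (pathLength B asc τ x y N : ℝ) ^ s ≤ (l * (1 - 1 / (384 * lg n))) ^ s := by gcongr
          _ = (l : ℝ) ^ s * (1 - 1 / (384 * lg n)) ^ s := mul_pow _ _ _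
          _ ≤ (l : ℝ) ^ s * (1 / 2) := by
            gcongr
            exact one_sub_pow_le_half hn hs
      have h3 := ENNReal.ofReal_le_ofReal h2
      rwa [ENNReal.ofReal_mul (by positivity), ENNReal.ofReal_pow (by positivity),
        ENNReal.ofReal_pow (by positivity), ENNReal.ofReal_natCast, ENNReal.ofReal_natCast] at h3
  refine (mean_le_mean hpt).trans ?_
  rw [mean_mul_left, mean_add, mean_const, mean_mul_left, ← toOuterMeasure_eq_mean, hpot, mul_comm]
  refine mul_le_mul_left ?_ _
  calc _ ≤ ENNReal.ofReal (1 / 2) + ENNReal.ofReal (1 / 2) * ENNReal.ofReal (4 / 5) := by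
        gcongr
        exact hfail hl
    _ = ENNReal.ofReal (9 / 10) := by
        rw [← ENNReal.ofReal_mul (by norm_num), ← ENNReal.ofReal_add (by norm_num) (by norm_num)]
        norm_num

lemma repeat_update_support {κ : Constants} (k : ℕ) : ∀ {M N : Table n}, (∀ x y, M x y ≠ ⊤) →
    N ∈ (repeatStep (updateShortcuts κ B) k M).support → (∀ x y, N x y ≠ ⊤) ∧ M ≤ N := by
  induction k with
  | zero =>
    intro M N hM h
    rw [repeatStep, PMF.mem_support_pure_iff] at h
    subst h
    exact ⟨hM, le_rfl⟩
  | succ k ih =>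
    intro M N hM h
    rw [repeatStep, PMF.mem_support_bind_iff] at h
    obtain ⟨N', h1, h2⟩ := h
    obtain ⟨h3, h4⟩ := updateShortcuts_support hM h1
    exact ⟨(ih h3 h2).1, h4.trans (ih h3 h2).2⟩

lemma mean_repeat_potential_le {κ : Constants} (hκ : κ.Large) (hn : 2 ≤ n) {s : ℕ}
    (hs : 384 * lg n ≤ s) {k : ℕ} (N : ℕ) : ∀ {M : Table n}, (∀ x y, M x y ≠ ⊤) →
    HasPath B asc τ x y M k →
    mean (repeatStep (updateShortcuts κ B) N M) (potential s B asc τ x y) ≤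
      ENNReal.ofReal (9 / 10) ^ N * potential s B asc τ x y M := by
  induction N with
  | zero => intro M _ _; rw [repeatStep, mean_pure, pow_zero, one_mul]
  | succ N ih =>
    intro M hM h
    rw [repeatStep, mean_bind]
    refine (mean_le_mean fun M' hM' => ih (updateShortcuts_support hM hM').1
      (h.mono (updateShortcuts_support hM hM').1 (updateShortcuts_support hM hM').2)).trans ?_
    rw [mean_mul_left, pow_succ, mul_assoc]
    exact mul_le_mul_right (mean_update_potential_le hκ hn hM h hs) _

lemma pathLength_lt {k : ℕ} (h : HasPath B asc τ x y M k) : pathLength B asc τ x y M < n := by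
  obtain ⟨v, H, ht⟩ := h.exists_shortest
  exact lt_of_injOn ht.inj

/-- The number of iterations suffices. -/
lemma drift_bound (hn : 2 ≤ n) {c a : ℝ} (hc : 0 < c) (ha : 10 * (390 + c) ≤ a) :
    (9 / 10 : ℝ) ^ ⌈a * lg n ^ 2⌉₊ * (n : ℝ) ^ ⌈384 * lg n⌉₊ ≤ (n : ℝ) ^ (-(c + 3)) := by
  have hlg := one_le_lg hn
  have hn0 : (0 : ℝ) < n := by positivity
  have hln : 0 ≤ Real.log n := Real.log_nonneg (by norm_cast; omega)
  have hll := log_le_lg hn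
  have h1 : (9 / 10 : ℝ) ^ ⌈a * lg n ^ 2⌉₊ ≤ Real.exp (-(a * lg n ^ 2 / 10)) := by
    calc (9 / 10 : ℝ) ^ ⌈a * lg n ^ 2⌉₊ ≤ Real.exp (-(1 / 10)) ^ ⌈a * lg n ^ 2⌉₊ := by
          refine pow_le_pow_left₀ (by norm_num) ?_ _
          have := Real.one_sub_le_exp_neg (1 / 10)
          norm_num at this ⊢
          exact this
      _ = Real.exp (⌈a * lg n ^ 2⌉₊ * -(1 / 10)) := (Real.exp_nat_mul _ _).symm
      _ ≤ _ := by
        refine Real.exp_le_exp.2 ?_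
        have := Nat.le_ceil (a * lg n ^ 2)
        linarith
  have h2 : (n : ℝ) ^ ⌈384 * lg n⌉₊ ≤ Real.exp (385 * lg n ^ 2) := by
    rw [← Real.exp_log (pow_pos hn0 ⌈384 * lg n⌉₊), Real.log_pow]
    refine Real.exp_le_exp.2 ?_
    have h3 := (Nat.ceil_lt_add_one (a := 384 * lg n) (by positivity)).le
    calc (⌈384 * lg n⌉₊ : ℝ) * Real.log n ≤ (385 * lg n) * lg n := by
          refine mul_le_mul (by linarith) hll hln (by positivity)
      _ = 385 * lg n ^ 2 := by ring
  rw [Real.rpow_def_of_pos hn0]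
  refine (mul_le_mul h1 h2 (by positivity) (by positivity)).trans ?_
  rw [← Real.exp_add]
  refine Real.exp_le_exp.2 ?_
  have h4 : lg n ≤ lg n ^ 2 := by nlinarith
  have h5 : 10 * (390 + c) * lg n ^ 2 ≤ a * lg n ^ 2 := by gcongr
  have h6 : Real.log n * (c + 3) ≤ lg n ^ 2 * (c + 3) := by
    refine mul_le_mul_of_nonneg_right (by linarith) (by linarith)
  nlinarith

/-- Markov's inequality: the potential is at least 1 unless the length is at most 1, and initially
it is at most n^s. -/
lemma repeat_update_fail_le {κ : Constants} (hκ : κ.Large) (hn : 2 ≤ n) {c : ℝ} (hc : 0 < c)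
    (ho : 10 * (390 + c) ≤ κ.outer) (hM : ∀ x y, M x y ≠ ⊤) {k : ℕ}
    (h : HasPath B asc τ x y M k) :
    (repeatStep (updateShortcuts κ B) ⌈κ.outer * lg n ^ 2⌉₊ M).toOuterMeasure
      {N | ¬ HasPath B asc τ x y N 1} ≤ ENNReal.ofReal ((n : ℝ) ^ (-(c + 3))) := by
  classical
  set s := ⌈384 * lg n⌉₊ with hs
  set N := ⌈κ.outer * lg n ^ 2⌉₊ with hN
  have h1 := mean_repeat_potential_le (s := s) hκ hn (Nat.le_ceil _) N hM h
  have h2 : (repeatStep (updateShortcuts κ B) N M).toOuterMeasure {N | ¬ HasPath B asc τ x y N 1} ≤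
      mean (repeatStep (updateShortcuts κ B) N M) (potential s B asc τ x y) := by
    rw [toOuterMeasure_eq_mean]
    refine mean_le_mean fun M' hM' => ?_
    obtain ⟨h3, h4⟩ := repeat_update_support N hM hM'
    by_cases hp : HasPath B asc τ x y M' 1
    · rw [Set.indicator_of_notMem (by simpa using hp)]
      exact zero_le
    -- A path exists in the later table as well, so the length is a true minimum and not the default
    -- infimum 0 of the empty set.
    · have hlen : ¬ pathLength B asc τ x y M' ≤ 1 := by
        intro hle
        obtain ⟨v, H, ht⟩ := (h.mono h3 h4).exists_shortest
        exact hp ⟨_, hle, v, H, ht⟩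
      rw [Set.indicator_of_mem (by exact hp), potential, if_neg hlen, Pi.one_apply]
      exact one_le_pow₀ (by
        have : 1 ≤ pathLength B asc τ x y M' := by omega
        exact_mod_cast this)
  refine h2.trans (h1.trans ?_)
  have h5 : potential s B asc τ x y M ≤ (n : ℝ≥0∞) ^ s := (potential_le _ _ _ _ _ _ _).trans
    (pow_le_pow_left' (by exact_mod_cast (pathLength_lt h).le) _)
  refine (mul_le_mul_right h5 _).trans ?_
  rw [← ENNReal.ofReal_natCast, ← ENNReal.ofReal_pow (by norm_num), ← ENNReal.ofReal_pow
    (by positivity), ← ENNReal.ofReal_mul (by positivity)]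
  exact ENNReal.ofReal_le_ofReal (drift_bound hn hc ho)

end Drift

/-! ### The best gain over simple paths -/

/-- The gain of `v a, …, v b`. -/
noncomputable def rangeGain (M : Table n) (v : ℕ → Fin n) (a b : ℕ) : ℝ :=
  ∑ i ∈ Finset.Ico a b, (M (v i) (v (i + 1))).toReal

lemma Exact.rangeGain_eq {M : Table n} {v : ℕ → Fin n} {l : ℕ} {H : ℕ → ℝ} (h : Exact M v l H)
    {a b : ℕ} (hab : a ≤ b) (hb : b ≤ l) : rangeGain M v a b = H b - H a := by
  rw [rangeGain, ← Finset.sum_Ico_sub _ hab]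
  refine Finset.sum_congr rfl fun i hi => ?_
  rw [Finset.mem_Ico] at hi
  rw [h i (by omega), EReal.toReal_coe]

/-- All gains of pieces of simple paths. -/
noncomputable def gainSet (M : Table n) : Set ℝ :=
  Set.range fun p : (Fin n → Fin n) × Fin n × Fin n =>
    rangeGain M (fun i => if h : i < n then p.1 ⟨i, h⟩ else p.2.1) p.2.1 p.2.2

lemma Exact.sub_mem_gainSet {M : Table n} {v : ℕ → Fin n} {l : ℕ} {H : ℕ → ℝ}
    (h : Exact M v l H) (hl : l < n) {a b : ℕ} (hab : a ≤ b) (hb : b ≤ l) :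
    H b - H a ∈ gainSet M := by
  refine ⟨(fun i => v i, ⟨a, by omega⟩, ⟨b, by omega⟩), ?_⟩
  rw [← h.rangeGain_eq hab hb]
  refine Finset.sum_congr rfl fun i hi => ?_
  rw [Finset.mem_Ico] at hi
  simp only
  rw [dif_pos (by omega), dif_pos (by omega)]

/-- The maximum gain over admissible paths is attained. -/
lemma exists_best {B : ℝ} {asc : Bool} {x y : Fin n} {M : Table n}
    (h : ∃ τ, HasPath B asc τ x y M n) :
    ∃ τ, HasPath B asc τ x y M n ∧ ∀ τ', HasPath B asc τ' x y M n → τ' ≤ τ := by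
  -- A simple path has fewer than n arcs, so only finitely many gains occur. Thus one value of τ per
  -- kind and pair of ends suffices for the union bound.
  have hfin : (gainSet M ∩ {τ | HasPath B asc τ x y M n}).Finite :=
    (Set.finite_range _).inter_of_left _
  have key : ∀ τ, HasPath B asc τ x y M n →
      ∃ τ' ∈ gainSet M ∩ {τ | HasPath B asc τ x y M n}, τ ≤ τ' := by
    rintro τ ⟨l, hl, v, H, ht⟩
    have hln := lt_of_injOn ht.inj
    cases asc with
    | true =>
      obtain ⟨h1, h2⟩ := ht.adm.2.1 rfl
      exact ⟨H l - H 0, ⟨ht.exact.sub_mem_gainSet hln (Nat.zero_le _) le_rfl, l, hl, v, H,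
        ht.source, ht.target, ht.inj, ht.exact, ht.adm.1, fun _ => ⟨h1, le_rfl⟩, by simp⟩, h2⟩
    | false =>
      obtain ⟨h1, h2⟩ := ht.adm.2.2 rfl
      obtain ⟨p, hp, hmin⟩ := ((Finset.range (l + 1) ×ˢ Finset.range (l + 1)).filter
        fun p => p.1 ≤ p.2).exists_min_image (fun p => H p.2 - H p.1) ⟨(0, 0), by simp⟩
      simp only [Finset.mem_filter, Finset.mem_product, Finset.mem_range] at hp hmin
      have hle := h2 p.1 p.2 hp.2 (by omega)
      have h0 := hmin (0, 0) (by simp)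
      refine ⟨H p.2 - H p.1, ⟨ht.exact.sub_mem_gainSet hln hp.2 (by omega), l, hl, v, H,
        ht.source, ht.target, ht.inj, ht.exact, ht.adm.1, by simp, fun _ => ⟨?_, fun a b hab hb =>
          hmin (a, b) (by simp only; omega)⟩⟩, hle⟩
      have := h1
      linarith
  obtain ⟨τ₀, hτ₀⟩ := h
  obtain ⟨τ₁, hτ₁, -⟩ := key τ₀ hτ₀
  obtain ⟨τ, hτ, hmax⟩ := Set.exists_max_image _ id hfin ⟨τ₁, hτ₁⟩
  refine ⟨τ, hτ.2, fun τ' hτ' => ?_⟩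
  obtain ⟨τ₂, h1, h2⟩ := key τ' hτ'
  exact h2.trans (hmax τ₂ h1)

/-- All admissible simple paths of `M` have a shortcut in `N`. -/
structure Complete (B : ℝ) (M N : Table n) : Prop where
  le : M ≤ N
  shortcut : ∀ asc τ x y, x ≠ y → HasPath B asc τ x y M n → (τ : EReal) ≤ N x y

lemma not_complete_le {κ : Constants} (hκ : κ.Large) (hn : 2 ≤ n) {c : ℝ} (hc : 0 < c)
    (ho : 10 * (390 + c) ≤ κ.outer) {B : ℝ} {M : Table n} (hM : ∀ x y, M x y ≠ ⊤) :
    (repeatStep (updateShortcuts κ B) ⌈κ.outer * lg n ^ 2⌉₊ M).toOuterMeasure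
      {N | ¬ Complete B M N} ≤ ENNReal.ofReal ((n : ℝ) ^ (-c)) := by
  classical
  set p := repeatStep (updateShortcuts κ B) ⌈κ.outer * lg n ^ 2⌉₊ M with hp
  set best : Bool × Fin n × Fin n → ℝ := fun t =>
    if h : ∃ τ, HasPath B t.1 τ t.2.1 t.2.2 M n then (exists_best h).choose else 0
  set bad : Bool × Fin n × Fin n → Set (Table n) := fun t =>
    {N | HasPath B t.1 (best t) t.2.1 t.2.2 M n ∧ ¬ HasPath B t.1 (best t) t.2.1 t.2.2 N 1}
  have hbad : ∀ t, p.toOuterMeasure (bad t) ≤ ENNReal.ofReal ((n : ℝ) ^ (-(c + 3))) := by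
    intro t
    by_cases h : HasPath B t.1 (best t) t.2.1 t.2.2 M n
    · exact (toOuterMeasure_le_of_support fun N _ hN => hN.2).trans
        (repeat_update_fail_le hκ hn hc ho hM h)
    · refine le_trans (le_of_eq ?_) zero_le
      rw [PMF.toOuterMeasure_apply_eq_zero_iff, Set.disjoint_left]
      exact fun N _ hN => h hN.1
  have hsub : p.toOuterMeasure {N | ¬ Complete B M N} ≤ p.toOuterMeasure (⋃ t, bad t) := by
    refine toOuterMeasure_le_of_support fun N hN hc => ?_
    by_contra hcon
    simp only [bad, Set.mem_iUnion, Set.mem_ofPred_eq, not_exists, not_and, not_not] at hcon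
    obtain ⟨-, h2⟩ := repeat_update_support _ hM hN
    refine hc ⟨h2, fun asc τ x y hxy hpath => ?_⟩
    have hex : ∃ τ, HasPath B asc τ x y M n := ⟨τ, hpath⟩
    have hb : best (asc, x, y) = (exists_best hex).choose := dif_pos hex
    obtain ⟨h3, h4⟩ := (exists_best hex).choose_spec
    rw [← hb] at h3 h4
    have h5 := (hcon (asc, x, y) h3).le_of_one hxy
    exact le_trans (by exact_mod_cast h4 τ hpath) h5
  refine hsub.trans ((MeasureTheory.measure_iUnion_fintype_le _ _).trans
    ((Finset.sum_le_card_nsmul _ _ _ fun t _ => hbad t).trans ?_))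
  rw [Finset.card_univ, nsmul_eq_mul, ← ENNReal.ofReal_natCast,
    ← ENNReal.ofReal_mul (by positivity)]
  refine ENNReal.ofReal_le_ofReal ?_
  have hn0 : (0 : ℝ) < n := by positivity
  have h2n : (2 : ℝ) ≤ n := by exact_mod_cast hn
  -- 2n² ≤ n³ accounts for the 3 in the exponent c + 3.
  have hcard : (Fintype.card (Bool × Fin n × Fin n) : ℝ) ≤ n ^ (3 : ℝ) := by
    rw [Fintype.card_prod, Fintype.card_prod, Fintype.card_bool, Fintype.card_fin]
    push_cast
    norm_cast
    rw [pow_succ, pow_two, mul_comm 2]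
    exact Nat.mul_le_mul_left _ hn
  calc _ ≤ (n : ℝ) ^ (3 : ℝ) * (n : ℝ) ^ (-(c + 3)) := by gcongr
    _ = (n : ℝ) ^ (-c) := by rw [← Real.rpow_add hn0]; congr 1; ring
end ElectricCar

namespace ElectricCar
variable {n : ℕ}

/-! ### From complete tables to the graph `H⋆` -/

section Segments
variable {B : ℝ} {M N : Table n} {u : ℕ → Fin n} {H : ℕ → ℝ} {a b : ℕ}

/-- A simple path from a vertex to itself has no arcs and gain 0, so the diagonal of the initial
table takes care of equal ends. -/
lemma Complete.le_of_hasPath (hC : Complete B M N) (hd : ∀ x, 0 ≤ M x x) {asc : Bool} {τ : ℝ}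
    {x y : Fin n} (h : HasPath B asc τ x y M n) : (τ : EReal) ≤ N x y := by
  by_cases hxy : x = y
  · subst hxy
    obtain ⟨l, -, v, H, ht⟩ := h
    have hl : l = 0 := ht.inj (Set.mem_Iic.2 le_rfl) (Set.mem_Iic.2 (Nat.zero_le _))
      (ht.target.trans ht.source.symm)
    subst hl
    have hτ : τ ≤ 0 := by
      cases asc with
      | true => simpa using (ht.adm.2.1 rfl).2
      | false => simpa using (ht.adm.2.2 rfl).2 0 0 le_rfl le_rfl
    exact le_trans (by exact_mod_cast hτ) ((hd x).trans (hC.le x x))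
  · exact hC.shortcut asc τ x y hxy h

lemma hasPath_of_segment (hinj : Set.InjOn u (Set.Icc a b))
    (hex : ∀ k, a ≤ k → k < b → M (u k) (u (k + 1)) = ((H (k + 1) - H k : ℝ) : EReal))
    (hab : a ≤ b) {asc : Bool} {τ : ℝ} (hadm : Adm B asc τ (b - a) fun k => H (a + k)) :
    HasPath B asc τ (u a) (u b) M n := by
  have hi : Set.InjOn (fun k => u (a + k)) (Set.Iic (b - a)) := by
    intro p hp q hq hpq
    simp only [Set.mem_Iic] at hp hq
    have := hinj ⟨by omega, by omega⟩ ⟨by omega, by omega⟩ hpq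
    omega
  refine ⟨b - a, (lt_of_injOn hi).le, _, _, rfl, ?_, hi, fun k hk => ?_, hadm⟩
  · congr 1; omega
  · exact hex (a + k) (by omega) (by omega)

lemma Complete.le_ascending (hC : Complete B M N) (hd : ∀ x, 0 ≤ M x x)
    (hinj : Set.InjOn u (Set.Icc a b))
    (hex : ∀ k, a ≤ k → k < b → M (u k) (u (k + 1)) = ((H (k + 1) - H k : ℝ) : EReal))
    (hab : a ≤ b) (hB : ∀ p q, a ≤ p → p ≤ q → q ≤ b → -B ≤ H q - H p)
    (hasc : ∀ k, a ≤ k → k ≤ b → H a ≤ H k ∧ H k ≤ H b) :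
    ((H b - H a : ℝ) : EReal) ≤ N (u a) (u b) := by
  refine hC.le_of_hasPath hd (asc := true) (hasPath_of_segment (H := H) hinj hex hab
    ⟨fun p q hpq hq => hB _ _ (by omega) (by omega) (by omega), fun _ => ⟨fun k hk => ?_, ?_⟩,
      by simp⟩)
  · have := hasc (a + k) (by omega) (by omega)
    simpa [Nat.add_sub_cancel' hab] using this
  · simp [Nat.add_sub_cancel' hab]

lemma Complete.le_descending (hC : Complete B M N) (hd : ∀ x, 0 ≤ M x x)
    (hinj : Set.InjOn u (Set.Icc a b))
    (hex : ∀ k, a ≤ k → k < b → M (u k) (u (k + 1)) = ((H (k + 1) - H k : ℝ) : EReal))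
    (hab : a ≤ b) {τ : ℝ} (hB : -B ≤ τ) (hτ : ∀ p q, a ≤ p → p ≤ q → q ≤ b → τ ≤ H q - H p) :
    (τ : EReal) ≤ N (u a) (u b) :=
  hC.le_of_hasPath hd (asc := false) (hasPath_of_segment (H := H) hinj hex hab
    ⟨fun _ _ _ _ => hB.trans (hτ _ _ (by omega) (by omega) (by omega)), by simp,
      fun _ => ⟨hB, fun _ _ _ _ => hτ _ _ (by omega) (by omega) (by omega)⟩⟩)

/-- A simple cycle that only visits its start at the lowest height allows charging. -/
lemma Complete.exists_charging (hC : Complete B M N) (hd : ∀ x, 0 ≤ M x x) {m : ℕ}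
    (hm : 2 ≤ m) (hcyc : u m = u 0) (hinj : Set.InjOn u (Set.Iio m)) (hex : Exact M u m H)
    (hlow : ∀ k, 0 < k → k ≤ m → H 0 < H k)
    (hB : ∀ p q, p ≤ q → q ≤ m → -B ≤ H q - H p) :
    ∃ q, 0 < q ∧ q < m ∧ 0 < N (u 0) (u q) + N (u q) (u 0) ∧ 0 < N (u 0) (u q) := by
  -- The cycle is split at its highest inner position: an ascending path up to it and a descending
  -- one back to the start.
  obtain ⟨q, hq, hmax⟩ := (Finset.Ioo 0 m).exists_max_image H ⟨1, by simp; omega⟩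
  rw [Finset.mem_Ioo] at hq
  have hmax' : ∀ k, 0 < k → k < m → H k ≤ H q := fun k h1 h2 => hmax k (Finset.mem_Ioo.2 ⟨h1, h2⟩)
  have hq0 := hlow q hq.1 hq.2.le
  have hup : ((H q - H 0 : ℝ) : EReal) ≤ N (u 0) (u q) :=
    hC.le_ascending hd (hinj.mono fun k hk => Set.mem_Iio.2 (hk.2.trans_lt hq.2))
      (fun k _ hk => hex k (by omega)) hq.1.le (fun p r _ hpr hr => hB p r hpr (by omega))
      (fun k _ hk => by
        rcases Nat.eq_zero_or_pos k with rfl | hk0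
        · exact ⟨le_rfl, hq0.le⟩
        · exact ⟨(hlow k hk0 (by omega)).le, hmax' k hk0 (by omega)⟩)
  obtain ⟨p, hp, hmin⟩ := ((Finset.Icc q m ×ˢ Finset.Icc q m).filter
    fun p => p.1 ≤ p.2).exists_min_image (fun p => H p.2 - H p.1)
      ⟨(q, q), by simp; omega⟩
  simp only [Finset.mem_filter, Finset.mem_product, Finset.mem_Icc] at hp hmin
  have hinj' : Set.InjOn u (Set.Icc q m) := by
    intro a ha b hb hab
    rcases eq_or_lt_of_le ha.2 with rfl | ha' <;> rcases eq_or_lt_of_le hb.2 with hb' | hb'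
    · exact hb'.symm
    · rw [hcyc] at hab
      have := hinj (Set.mem_Iio.2 (by omega)) (Set.mem_Iio.2 hb') hab
      have := hb.1
      omega
    · rw [hb', hcyc] at hab
      have := hinj (Set.mem_Iio.2 ha') (Set.mem_Iio.2 (by omega)) hab
      have := ha.1
      omega
    · exact hinj ha' hb' hab
  have hdown : ((H p.2 - H p.1 : ℝ) : EReal) ≤ N (u q) (u 0) := by
    rw [← hcyc]
    exact hC.le_descending hd hinj' (fun k _ hk => hex k hk) hq.2.le
      (hB _ _ hp.2 hp.1.2.2) fun a b ha hab hb => hmin (a, b) ⟨⟨⟨ha, by omega⟩, by omega, hb⟩, hab⟩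
  -- A drop after the peak starts no higher than the peak and ends above the start of the cycle,
  -- unless it is the empty drop at the very end. So less is lost than was gained.
  have hdrop : 0 < (H q - H 0) + (H p.2 - H p.1) := by
    rcases eq_or_lt_of_le hp.1.1.2 with h1 | h1
    · have : p.2 = p.1 := by omega
      rw [this]
      linarith
    · have h2 := hmax' p.1 (by omega) h1
      have h3 := hlow p.2 (by omega) hp.1.2.2
      linarith
  refine ⟨q, hq.1, hq.2, lt_of_lt_of_le ?_ (add_le_add hup hdown), lt_of_lt_of_le ?_ hup⟩
  · exact_mod_cast hdrop
  · exact_mod_cast sub_pos.2 hq0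

end Segments

/-- Starting with charge `b`, the path can be traversed and leaves charge at least `c`. -/
def Carries (B b c : ℝ) (l : ℕ) (H : ℕ → ℝ) : Prop :=
  (∀ k, k ≤ l → 0 ≤ b + (H k - H 0)) ∧ (∀ a k, a ≤ k → k ≤ l → -B ≤ H k - H a) ∧
    c ≤ b + (H l - H 0) ∧ ∀ a, a ≤ l → c - B ≤ H l - H a

def levelCharge (B : ℝ) : Level → ℝ
  | Level.zero => 0
  | Level.full => B

/-- The vertex `z` can be reached with charge `c` along a simple path from a vertex that `H⋆`
reaches from `s⁰`. -/
def Reaches (B : ℝ) (M N : Table n) (s z : Fin n) (c : ℝ) : Prop :=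
  ∃ (p : Fin n) (lev : Level) (l : ℕ) (u : ℕ → Fin n) (H : ℕ → ℝ),
    Relation.ReflTransGen (HArc B N) (s, Level.zero) (p, lev) ∧ u 0 = p ∧ u l = z ∧
      Set.InjOn u (Set.Iic l) ∧ Exact M u l H ∧ Carries B (levelCharge B lev) c l H

section Reach
variable {B : ℝ} {M N : Table n} {s : Fin n} {u : ℕ → Fin n} {H : ℕ → ℝ} {l : ℕ} {b c : ℝ}

lemma Reaches.mono {z : Fin n} (h : Reaches B M N s z b) (hcb : c ≤ b) : Reaches B M N s z c := by
  obtain ⟨p, lev, l, u, H, h1, h2, h3, h4, h5, h6, h7, h8, h9⟩ := h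
  exact ⟨p, lev, l, u, H, h1, h2, h3, h4, h5, h6, h7, hcb.trans h8, fun a ha => by
    have := h9 a ha; linarith⟩

lemma Reaches.of_full {z : Fin n}
    (h : Relation.ReflTransGen (HArc B N) (s, Level.zero) (z, Level.full)) (hB : 0 < B)
    (hc : c ≤ B) : Reaches B M N s z c := by
  refine ⟨z, Level.full, 0, fun _ => z, fun _ => 0, h, rfl, rfl, ?_, ?_, ?_⟩
  · intro a ha b hb _
    simp only [Set.mem_Iic] at ha hb
    omega
  · intro k hk
    omega
  · simp only [Carries, levelCharge]
    refine ⟨fun _ _ => by linarith, fun _ _ _ _ => by linarith, by linarith, fun _ _ => by linarith⟩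

/-- The end of a traversable simple path is reached in `H⋆` at level zero. -/
lemma Complete.reach_zero (hC : Complete B M N) (hd : ∀ x, 0 ≤ M x x)
    {lev : Level} (hinj : Set.InjOn u (Set.Iic l)) (hex : Exact M u l H)
    (h0 : ∀ k, k ≤ l → 0 ≤ levelCharge B lev + (H k - H 0))
    (hB : ∀ a k, a ≤ k → k ≤ l → -B ≤ H k - H a) :
    HArc B N (u 0, lev) (u l, Level.zero) := by
  cases lev with
  | full =>
    refine HArc.fullZero _ _ ?_
    have := hC.le_descending hd (a := 0) (b := l) (τ := -B) (hinj.mono fun k hk => hk.2)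
      (fun k _ hk => hex k hk) (Nat.zero_le _) le_rfl (fun p q _ h1 h2 => hB p q h1 h2)
    exact ne_bot_of_le_ne_bot (EReal.coe_ne_bot _) this
  | zero =>
    simp only [levelCharge, zero_add] at h0
    -- Split at a highest position: ascend to it, then lose at most what was gained, since no height
    -- lies below the start.
    obtain ⟨j, hj, hmax⟩ := (Finset.range (l + 1)).exists_max_image H ⟨0, by simp⟩
    simp only [Finset.mem_range] at hj hmax
    have h1 := hC.le_ascending hd (a := 0) (b := j) (H := H)
      (hinj.mono fun k hk => hk.2.trans (by omega)) (fun k _ hk => hex k (by omega))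
      (Nat.zero_le _) (fun p q _ h1 h2 => hB p q h1 (by omega)) (fun k _ hk =>
        ⟨by have := h0 k (by omega); linarith, hmax k (by omega)⟩)
    have h2 := hC.le_descending hd (a := j) (b := l) (H := H) (τ := max (-B) (-(H j - H 0)))
      (hinj.mono fun k hk => hk.2) (fun k _ hk => hex k hk) (by omega) (le_max_left _ _)
      (fun p q hp hpq hq => max_le (hB p q hpq hq) (by
        have h3 := hmax p (by omega)
        have h4 := h0 q hq
        linarith))
    have h3 := h0 j (by omega)
    refine HArc.zeroZero _ (u j) _ (le_trans ?_ (add_le_add h1 h2)) (le_trans ?_ h1)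
    · have : 0 ≤ (H j - H 0) + max (-B) (-(H j - H 0)) := by
        have := le_max_right (-B) (-(H j - H 0))
        linarith
      exact_mod_cast this
    · exact_mod_cast h3

lemma injOn_snoc (hinj : Set.InjOn u (Set.Iic l)) {w : Fin n} (hw : ∀ k, k ≤ l → u k ≠ w) :
    Set.InjOn (fun k => if k ≤ l then u k else w) (Set.Iic (l + 1)) := by
  intro a ha b hb hab
  simp only [Set.mem_Iic] at ha hb
  simp only at hab
  split_ifs at hab with h1 h2 h2
  · exact hinj h1 h2 hab
  · exact absurd hab (hw a h1)
  · exact absurd hab.symm (hw b h2)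
  · omega

lemma exact_snoc {w : Fin n} {g : ℝ} {i : ℕ} (hi : i ≤ l)
    (hex : ∀ k, i ≤ k → k < l → M (u k) (u (k + 1)) = ((H (k + 1) - H k : ℝ) : EReal))
    (hg : M (u l) w = (g : EReal)) (k : ℕ) (hik : i ≤ k) (hk : k < l + 1) :
    M ((fun k => if k ≤ l then u k else w) k) ((fun k => if k ≤ l then u k else w) (k + 1)) =
      (((fun k => if k ≤ l then H k else H l + g) (k + 1) -
        (fun k => if k ≤ l then H k else H l + g) k : ℝ) : EReal) := by
  rcases eq_or_lt_of_le (Nat.lt_succ_iff.1 hk) with rfl | hkl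
  · simp [hg]
  · simp only [if_pos hkl.le, if_pos (show k + 1 ≤ l by omega)]
    exact hex k hik hkl

/-- One step of the car. -/
lemma Complete.reaches_step (hC : Complete B M N) (hd : ∀ x, 0 ≤ M x x) (hB0 : 0 < B)
    {z w : Fin n} {g : ℝ} (hself : z = w → (g : EReal) ≤ M z z)
    (harc : z ≠ w → M z w = (g : EReal)) (h : Reaches B M N s z c) (hcg : 0 ≤ c + g) :
    Reaches B M N s w (min (c + g) B) := by
  obtain ⟨p, lev, l, u, H, hr, rfl, rfl, hinj, hex, h0, hB, hc1, hc2⟩ := h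
  have hcB : c ≤ B := by have := hc2 l le_rfl; linarith
  by_cases hzw : u l = w
  · subst hzw
    rcases le_or_gt g 0 with hg0 | hg0
    · exact Reaches.mono ⟨_, lev, l, u, H, hr, rfl, rfl, hinj, hex, h0, hB, hc1, hc2⟩
        ((min_le_left _ _).trans (by linarith))
    -- A self-loop of positive gain gives a zero-to-full arc at its vertex.
    · have h1 : (0 : EReal) < N (u l) (u l) :=
        lt_of_lt_of_le (by exact_mod_cast hg0) ((hself rfl).trans (hC.le _ _))
      refine Reaches.of_full ((hr.tail (hC.reach_zero hd hinj hex h0 hB)).tail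
        (HArc.zeroFull _ _ (Or.inr ⟨?_, h1⟩))) hB0 (min_le_right _ _)
      exact lt_of_lt_of_le h1 (le_add_of_nonneg_left h1.le)
  have hm := harc hzw
  set c' := min (c + g) B with hc'
  have hc'1 : c' ≤ c + g := min_le_left _ _
  have hc'2 : c' ≤ B := min_le_right _ _
  by_cases hnew : ∀ k, k ≤ l → u k ≠ w
  · refine ⟨_, lev, l + 1, fun k => if k ≤ l then u k else w,
      fun k => if k ≤ l then H k else H l + g, hr, by simp, by simp, injOn_snoc hinj hnew,
      fun k hk => exact_snoc (Nat.zero_le _) (fun k _ hk => hex k hk) hm k (Nat.zero_le _) hk,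
      ?_, ?_, ?_, ?_⟩
    · intro k hk
      simp only [Nat.zero_le, if_true]
      split_ifs with h1
      · exact h0 k h1
      · linarith
    · intro a k hak hk
      simp only
      split_ifs with h1 h2 h2
      · exact hB a k hak h1
      · omega
      · have := hc2 a h2; linarith
      · linarith
    · simp only [Nat.zero_le, if_true, Nat.not_succ_le_self, if_false]
      linarith
    · intro a ha
      simp only [Nat.not_succ_le_self, if_false]
      split_ifs with h1
      · have := hc2 a h1; linarith
      · linarith
  push Not at hnew
  obtain ⟨i, hil, rfl⟩ := hnew
  have hil' : i < l := lt_of_le_of_ne hil fun h => hzw (by rw [h])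
  -- The arc returns to `u i`. If the prefix up to there already carries the new charge, the cycle
  -- is cut off.
  by_cases hpre : Carries B (levelCharge B lev) c' i H
  · exact ⟨_, lev, i, u, H, hr, rfl, rfl, hinj.mono (Set.Iic_subset_Iic.2 hil),
      fun k hk => hex k (by omega), hpre⟩
  -- Otherwise the cycle gains charge, and never sinks by as much as `c'` below its start.
  have hcyc : H i < H l + g ∧ ∀ k, i ≤ k → k ≤ l → -c' < H k - H i := by
    by_contra hcon
    refine hpre ⟨fun k hk => h0 k (by omega), fun a k hak hk => hB a k hak (by omega), ?_, ?_⟩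
    · by_contra hlt
      refine hcon ⟨by linarith, fun k hik hk => ?_⟩
      have := h0 k hk
      linarith
    · intro a ha
      by_contra hlt
      refine hcon ⟨by have := hc2 a (by omega); linarith, fun k hik hk => ?_⟩
      have := hB a k (by omega) hk
      linarith
  obtain ⟨hpos, hdeep⟩ := hcyc
  -- The last of the lowest positions, so that later heights on the cycle are strictly greater.
  obtain ⟨j, hij, hjl, hjmin⟩ : ∃ j, i ≤ j ∧ j ≤ l ∧ ∀ k, i ≤ k → k ≤ l →
      H j ≤ H k ∧ (j < k → H j < H k) := by
    obtain ⟨j₀, hj₀, hmin⟩ := (Finset.Icc i l).exists_min_image H ⟨i, by simp; omega⟩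
    obtain ⟨j, hj, hmax⟩ := ((Finset.Icc i l).filter fun k => H k = H j₀).exists_max_image id
      ⟨j₀, by simp only [Finset.mem_filter, and_true]; exact hj₀⟩
    simp only [Finset.mem_filter, Finset.mem_Icc, id] at hj hmax hmin
    refine ⟨j, hj.1.1, hj.1.2, fun k hik hk => ?_⟩
    have h1 := hmin k ⟨hik, hk⟩
    rw [← hj.2] at h1
    refine ⟨h1, fun hjk => lt_of_le_of_ne h1 fun heq => ?_⟩
    have := hmax k ⟨⟨hik, hk⟩, by rw [← heq, hj.2]⟩
    omega
  have hreach : Relation.ReflTransGen (HArc B N) (s, Level.zero) (u j, Level.zero) :=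
    hr.tail (hC.reach_zero hd (hinj.mono (Set.Iic_subset_Iic.2 hjl))
      (fun k hk => hex k (by omega)) (fun k hk => h0 k (by omega))
      fun a k hak hk => hB a k hak (by omega))
  obtain ⟨e, he1, he2, he3⟩ : ∃ e, i ≤ e ∧ e ≤ l ∧ 0 < N (u j) (u e) + N (u e) (u j) ∧
      0 < N (u j) (u e) := by
    -- Rotate the cycle to start at `j`. Heights after the wrap are raised by the positive net gain
    -- of the cycle, so the start is strictly lowest.
    obtain ⟨q, hq0, hqm, hq1, hq2⟩ := hC.exists_charging hd (m := l + 1 - i)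
      (u := fun k => if j + k ≤ l then u (j + k) else u (j + k - (l + 1 - i)))
      (H := fun k => if j + k ≤ l then H (j + k) else H (j + k - (l + 1 - i)) + (H l + g - H i))
      (by omega) (by
        rw [if_neg (by omega), if_pos (by omega)]
        congr 1; omega) (by
        intro a ha b hb hab
        simp only [Set.mem_Iio] at ha hb
        simp only at hab
        split_ifs at hab with h1 h2 h2 <;>
        · have := hinj (Set.mem_Iic.2 (by omega)) (Set.mem_Iic.2 (by omega)) hab
          omega) (by
        intro k hk
        simp only
        rcases lt_trichotomy (j + k) l with h1 | h1 | h1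
        · rw [if_pos h1.le, if_pos (by omega), if_pos (by omega), if_pos h1.le]
          exact hex _ h1
        · rw [if_pos h1.le, if_neg (by omega), if_neg (by omega), if_pos h1.le,
            show j + (k + 1) - (l + 1 - i) = i by omega, h1, hm]
          congr 1; ring
        · rw [if_neg (by omega), if_neg (by omega), if_neg (by omega), if_neg (by omega),
            show j + (k + 1) - (l + 1 - i) = j + k - (l + 1 - i) + 1 by omega, hex _ (by omega)]
          congr 1; ring) (by
        intro k hk0 hkm
        rw [if_pos (show j + 0 ≤ l by omega), Nat.add_zero]
        split_ifs with h1
        · exact (hjmin _ (by omega) h1).2 (by omega)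
        · have := (hjmin (j + k - (l + 1 - i)) (by omega) (by omega)).1
          linarith) (by
        intro a k hak hk
        split_ifs with h1 h2 h2
        · exact hB _ _ (by omega) h1
        · omega
        · have h3 := hdeep (j + k - (l + 1 - i)) (by omega) (by omega)
          have h4 := hc2 (j + a) h2
          linarith
        · have := hB (j + a - (l + 1 - i)) (j + k - (l + 1 - i)) (by omega) (by omega)
          linarith)
    simp only [Nat.add_zero, if_pos hjl] at hq1 hq2
    split_ifs at hq1 hq2 with h1
    · exact ⟨j + q, by omega, h1, hq1, hq2⟩
    · exact ⟨j + q - (l + 1 - i), by omega, by omega, hq1, hq2⟩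
  -- The closure thus reaches `u e` fully charged; the rest of the cycle from there to `u i` is the
  -- new simple path.
  have hfull := hreach.tail (HArc.zeroFull (u j) (u e) (Or.inr he3))
  rcases eq_or_lt_of_le he1 with rfl | hie
  · exact Reaches.of_full hfull hB0 hc'2
  have hinj' : Set.InjOn (fun k => u (e + k)) (Set.Iic (l - e)) := by
    intro a ha b hb hab
    simp only [Set.mem_Iic] at ha hb
    have := hinj (Set.mem_Iic.2 (by omega)) (Set.mem_Iic.2 (by omega)) hab
    omega
  have hlast : e + (l - e) = l := by omega
  refine ⟨_, Level.full, l - e + 1, fun k => if k ≤ l - e then u (e + k) else u i,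
    fun k => if k ≤ l - e then H (e + k) else H (e + (l - e)) + g, hfull, by simp, by simp,
    injOn_snoc hinj' ?_, fun k hk => exact_snoc (u := fun k => u (e + k))
      (H := fun k => H (e + k)) (Nat.zero_le _) (fun k _ hk => hex (e + k) (by omega))
      (by simp only [hlast]; exact hm) k (Nat.zero_le _) hk, ?_, ?_, ?_, ?_⟩
  · intro k hk heq
    have := hinj (Set.mem_Iic.2 (by omega)) (Set.mem_Iic.2 hil) heq
    omega
  · intro k hk
    simp only [Nat.zero_le, if_true, levelCharge, hlast, Nat.add_zero]
    split_ifs with h1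
    · have := hB e (e + k) (by omega) (by omega); linarith
    · have := hc2 e he2; linarith
  · intro a k hak hk
    simp only [hlast]
    split_ifs with h1 h2 h2
    · exact hB _ _ (by omega) (by omega)
    · omega
    · have := hc2 (e + a) (by omega); linarith
    · linarith
  · simp only [Nat.zero_le, if_true, Nat.not_succ_le_self, if_false, levelCharge, hlast,
      Nat.add_zero]
    have := hc2 e he2; linarith
  · intro a ha
    simp only [Nat.not_succ_le_self, if_false, hlast]
    split_ifs with h1
    · have := hc2 (e + a) (by omega); linarith
    · linarith

/-- The last arc in `H⋆` of a path that ends fully charged. -/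
lemma Complete.hStarArc_of_full (hC : Complete B M N) (hd : ∀ x, 0 ≤ M x x)
    {t : Fin n} (h : Reaches B M N s t B) : HStarArc B N (s, Level.zero) (t, Level.full) := by
  have fullCase : ∀ (u : ℕ → Fin n) (H : ℕ → ℝ) (a l : ℕ), a ≤ l → Set.InjOn u (Set.Icc a l) →
      (∀ k, a ≤ k → k < l → M (u k) (u (k + 1)) = ((H (k + 1) - H k : ℝ) : EReal)) →
      (∀ p q, a ≤ p → p ≤ q → q ≤ l → -B ≤ H q - H p) → (∀ k, a ≤ k → k ≤ l → H k ≤ H l) →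
      HArc B N (u a, Level.full) (u l, Level.full) := by
    intro u H a l hal hinj hex hB hmax
    -- Split at a lowest position: as the end is highest, whatever is lost before is regained after.
    obtain ⟨j, hj, hmin⟩ := (Finset.Icc a l).exists_min_image H ⟨a, by simp; omega⟩
    simp only [Finset.mem_Icc] at hj hmin
    have h1 := hC.le_descending hd (a := a) (b := j) (H := H) (τ := max (-B) (-(H l - H j)))
      (hinj.mono (Set.Icc_subset_Icc le_rfl hj.2)) (fun k h1 h2 => hex k h1 (by omega)) hj.1
      (le_max_left _ _) (fun p q hp hpq hq => max_le (hB p q hp hpq (by omega)) (by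
        have h3 := hmax p hp (by omega)
        have h4 := hmin q ⟨by omega, by omega⟩
        linarith))
    have h2 := hC.le_ascending hd (a := j) (b := l) (H := H)
      (hinj.mono (Set.Icc_subset_Icc hj.1 le_rfl)) (fun k h1 h2 => hex k (by omega) h2) hj.2
      (fun p q h1 h2 h3 => hB p q (by omega) h2 h3)
      (fun k h1 h2 => ⟨hmin k ⟨by omega, h2⟩, hmax k (by omega) h2⟩)
    have h3 := hmax j hj.1 hj.2
    refine HArc.fullFull _ (u j) _ (le_trans ?_ (add_le_add h1 h2)) (le_trans ?_ h2)
    · have : 0 ≤ max (-B) (-(H l - H j)) + (H l - H j) := by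
        have := le_max_right (-B) (-(H l - H j))
        linarith
      exact_mod_cast this
    · exact_mod_cast sub_nonneg.2 h3
  obtain ⟨p, lev, l, u, H, hr, rfl, rfl, hinj, hex, h0, hB, hc1, hc2⟩ := h
  have hmax : ∀ k, k ≤ l → H k ≤ H l := fun k hk => by have := hc2 k hk; linarith
  cases lev with
  | full =>
    exact Relation.TransGen.tail' hr (fullCase u H 0 l (Nat.zero_le _)
      (hinj.mono fun k hk => hk.2) (fun k _ hk => hex k hk)
      (fun p q _ h1 h2 => hB p q h1 h2) fun k _ hk => hmax k hk)
  | zero =>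
    simp only [levelCharge, zero_add] at h0 hc1
    -- The first position at which the gain reaches `B` is highest so far, which yields a
    -- zero-to-full arc; the rest goes from full to full.
    have hexi : ∃ i, B ≤ H i - H 0 := ⟨l, hc1⟩
    classical
    set i := Nat.find hexi with hi
    have hi1 : B ≤ H i - H 0 := Nat.find_spec hexi
    have hi2 : ∀ k, k < i → H k - H 0 < B := fun k hk => not_le.1 (Nat.find_min hexi hk)
    have hil : i ≤ l := Nat.find_min' hexi hc1
    have h1 := hC.le_ascending hd (a := 0) (b := i) (H := H)
      (hinj.mono fun k hk => hk.2.trans hil) (fun k _ hk => hex k (by omega)) (Nat.zero_le _)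
      (fun p q _ h1 h2 => hB p q h1 (by omega)) (fun k _ hk => by
        refine ⟨by have := h0 k (by omega); linarith, ?_⟩
        rcases eq_or_lt_of_le hk with rfl | hk
        · exact le_rfl
        · have := hi2 k hk; linarith)
    have harc : HArc B N (u 0, Level.zero) (u i, Level.full) :=
      HArc.zeroFull _ _ (Or.inl (le_trans (by exact_mod_cast hi1) h1))
    exact Relation.TransGen.tail' (hr.tail harc) (fullCase u H i l hil (hinj.mono fun k hk => hk.2)
      (fun k _ hk => hex k hk) (fun p q _ h1 h2 => hB p q h1 h2) fun k _ hk => hmax k hk)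

/-- The maximum charge is attained. -/
lemma Reaches.exists_max {t : Fin n} (h : Reaches B M N s t c) :
    ∃ c', Reaches B M N s t c' ∧ ∀ c, Reaches B M N s t c → c ≤ c' := by
  have hg : (gainSet M).Finite := Set.finite_range _
  have hfin : ((gainSet M ∪ (fun x => B + x) '' gainSet M) ∩ {c | Reaches B M N s t c}).Finite :=
    (hg.union (hg.image _)).inter_of_left _
  have key : ∀ c, Reaches B M N s t c → ∃ c' ∈ (gainSet M ∪ (fun x => B + x) '' gainSet M) ∩
      {c | Reaches B M N s t c}, c ≤ c' := by
    rintro c ⟨p, lev, l, u, H, hr, hp, ht, hinj, hex, h0, hB, hc1, hc2⟩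
    have hln := lt_of_injOn hinj
    obtain ⟨j, hj, hmax⟩ := (Finset.range (l + 1)).exists_max_image H ⟨0, by simp⟩
    simp only [Finset.mem_range] at hj hmax
    have h1 := hex.sub_mem_gainSet hln (Nat.zero_le l) le_rfl
    have h2 := hex.sub_mem_gainSet hln (a := j) (b := l) (by omega) le_rfl
    -- The largest charge that this path carries: the battery either never saturates, or is last
    -- limited at the highest position `j`. Finitely many such values occur.
    refine ⟨min (levelCharge B lev + (H l - H 0)) (B + (H l - H j)), ⟨?_, p, lev, l, u, H, hr, hp,
      ht, hinj, hex, h0, hB, min_le_left _ _, fun a ha => ?_⟩, le_min hc1 ?_⟩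
    · rcases min_choice (levelCharge B lev + (H l - H 0)) (B + (H l - H j)) with h | h <;> rw [h]
      · cases lev with
        | zero => exact Or.inl (by simpa [levelCharge] using h1)
        | full => exact Or.inr ⟨_, h1, rfl⟩
      · exact Or.inr ⟨_, h2, rfl⟩
    · have h3 := hmax a (by omega)
      have h4 := min_le_right (levelCharge B lev + (H l - H 0)) (B + (H l - H j))
      linarith
    · have := hc2 j (by omega)
      linarith
  obtain ⟨c₁, hc₁, -⟩ := key c h
  obtain ⟨c', hc', hmax⟩ := Set.exists_max_image _ id hfin ⟨c₁, hc₁⟩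
  refine ⟨c', hc'.2, fun d hd => ?_⟩
  obtain ⟨d', h1, h2⟩ := key d hd
  exact h2.trans (hmax d' h1)

end Reach

/-! ### The main theorem -/

lemma initialTable_self (G : RoadNetwork n) (x : Fin n) : 0 ≤ initialTable G x x := by
  simp [initialTable]

lemma initialTable_of_arc {G : RoadNetwork n} {x y : Fin n} (h : G.Arc x y) :
    (G.gain x y : EReal) ≤ initialTable G x y := by
  simp [initialTable, h]

lemma initialTable_eq {G : RoadNetwork n} {x y : Fin n} (h : G.Arc x y) (hxy : x ≠ y) :
    initialTable G x y = (G.gain x y : EReal) := by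
  simp [initialTable, h, hxy]

lemma initialTable_ne_top (G : RoadNetwork n) (x y : Fin n) : initialTable G x y ≠ ⊤ := by
  refine max_ne_top ?_ ?_ <;> split_ifs <;> simp

lemma Complete.reaches_of_path {B : ℝ} (hB : 0 < B) {G : RoadNetwork n} {N : Table n}
    (hC : Complete B (initialTable G) N) {s t : Fin n} (P : List (Fin n)) :
    ∀ (z : Fin n) (b : ℝ), Reaches B (initialTable G) N s z b → P.head? = some z →
      P.getLast? = some t → P.IsChain G.Arc → ∀ c : ℝ, (c : EReal) ≤ G.pathCharge B b P →
      Reaches B (initialTable G) N s t c := by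
  induction P with
  | nil => intro z b _ h; simp at h
  | cons a P ih =>
    intro z b hz hhead hlast hchain c hc
    obtain rfl : a = z := by simpa using hhead
    cases P with
    | nil =>
      obtain rfl : a = t := by simpa using hlast
      exact hz.mono (by simpa [RoadNetwork.pathCharge] using hc)
    | cons w P =>
      rw [List.isChain_cons_cons] at hchain
      rw [RoadNetwork.pathCharge] at hc
      split_ifs at hc with hfeas
      · exact ih w _ (hC.reaches_step (initialTable_self G) hB
          (fun h => by subst h; exact initialTable_of_arc hchain.1)
          (fun h => initialTable_eq hchain.1 h) hz hfeas) rfl (by simpa using hlast) hchain.2 c hc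
      · exact absurd hc (by simp)

lemma Complete.hStarArc {B : ℝ} (hB : 0 < B) {G : RoadNetwork n} {N : Table n}
    (hC : Complete B (initialTable G) N) {s t : Fin n} (h : G.alpha B 0 s t = (B : EReal)) :
    HStarArc B N (s, Level.zero) (t, Level.full) := by
  have hs : Reaches B (initialTable G) N s s 0 := by
    refine ⟨s, Level.zero, 0, fun _ => s, fun _ => 0, Relation.ReflTransGen.refl, rfl, rfl, ?_, ?_,
      ?_⟩
    · intro a ha b hb _
      simp only [Set.mem_Iic] at ha hb
      omega
    · intro k hk
      omega
    · simp only [Carries, levelCharge]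
      exact ⟨by simp, fun _ _ _ _ => by linarith, by simp, fun _ _ => by linarith⟩
  -- The charge B is a supremum over possibly infinitely many walks, so at first only smaller
  -- charges are reached; `Reaches.exists_max` then closes the gap.
  have hlt : ∀ c : ℝ, c < B → Reaches B (initialTable G) N s t c := by
    intro c hc
    have h1 : (c : EReal) < G.alpha B 0 s t := by rw [h]; exact_mod_cast hc
    rw [RoadNetwork.alpha, lt_iSup_iff] at h1
    obtain ⟨P, hP⟩ := h1
    rw [lt_iSup_iff] at hP
    obtain ⟨⟨hp1, hp2, hp3⟩, hP⟩ := hP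
    exact hC.reaches_of_path hB P s 0 hs hp1 hp2 hp3 c hP.le
  obtain ⟨c', hc', hmax⟩ := (hlt 0 hB).exists_max
  refine hC.hStarArc_of_full (initialTable_self G) (hc'.mono ?_)
  exact le_of_forall_lt_imp_le_of_dense fun c hc => hmax c (hlt c hc)

end ElectricCar

theorem mainTheorem6 (c : ℝ) (hc : 0 < c) :
    ∃ K : ℝ, 0 < K ∧ ∀ κ : ElectricCar.Constants, κ.AtLeast K →
      ∀ (n : ℕ) (G : ElectricCar.RoadNetwork n) (B : ℝ), 0 < B →
        (∀ u v, G.Arc u v → -B ≤ G.gain u v ∧ G.gain u v ≤ B) →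
        ∀ s t : Fin n, G.alpha B 0 s t = (B : EReal) →
          ENNReal.ofReal (1 - (n : ℝ) ^ (-c)) ≤
            (ElectricCar.computeShortcuts κ G B).toOuterMeasure
              {M | ElectricCar.HStarArc B M
                (s, ElectricCar.Level.zero) (t, ElectricCar.Level.full)} := by
  -- The constant is dictated by `drift_bound`: (9/10)^N ≤ e^(-N/10) has to beat an exponent 385
  -- log² n coming from n^s and still leave n^(-(c+3)). It exceeds the requirements of
  -- `Constants.Large`.
  refine ⟨10 * (390 + c), by positivity, fun κ hκ n G B hB hG s t h => ?_⟩
  obtain ⟨h1, h2, h3, h4, h5⟩ := hκ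
  rcases lt_or_ge n 2 with hn | hn
  · have hn1 : n = 1 := by have := s.pos; omega
    subst hn1
    -- For a single vertex 1^(-c) = 1, so the claimed bound is 0.
    simp
  have hlarge : κ.Large := ⟨by linarith, by linarith, by linarith, by linarith⟩
  set p := ElectricCar.computeShortcuts κ G B with hp
  have hfail : p.toOuterMeasure {N | ¬ ElectricCar.Complete B (ElectricCar.initialTable G) N} ≤
      ENNReal.ofReal ((n : ℝ) ^ (-c)) :=
    ElectricCar.not_complete_le hlarge hn hc h1 (ElectricCar.initialTable_ne_top G)
  have htotal : (1 : ENNReal) ≤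
      p.toOuterMeasure {N | ElectricCar.Complete B (ElectricCar.initialTable G) N} +
        p.toOuterMeasure {N | ¬ ElectricCar.Complete B (ElectricCar.initialTable G) N} := by
    have : p.toOuterMeasure Set.univ = 1 :=
      (PMF.toOuterMeasure_apply_eq_one_iff p _).2 (Set.subset_univ _)
    rw [← this]
    refine le_trans (MeasureTheory.measure_mono fun N _ => ?_) (MeasureTheory.measure_union_le _ _)
    exact em _
  have hle : p.toOuterMeasure {N | ElectricCar.Complete B (ElectricCar.initialTable G) N} ≤
      p.toOuterMeasure {M | ElectricCar.HStarArc B M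
        (s, ElectricCar.Level.zero) (t, ElectricCar.Level.full)} :=
    ElectricCar.toOuterMeasure_le_of_support fun N _ hN => hN.hStarArc hB h
  rw [ENNReal.ofReal_sub _ (by positivity), ENNReal.ofReal_one, tsub_le_iff_right]
  exact htotal.trans (add_le_add hle hfail)
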